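/- Fix a branch factor $b\ge 2$, a capacity $s\ge 1$ and ball distribution parameters $s_0,s_1\in\mathbb N_0$ with $s_0\le s$ and $s_0+bs_1\le s+1$. Let $\mathcal V=(V_1,\dots,V_b)$ be a split vector, i.e. a random vector with values in the unit simplex $\{v\in[0,1]^b:\sum_j v_j=1\}$. The random split tree $\mathcal T_n$ storing $n$ items (Devroye) is the random $b$-ary tree defined as follows: every node $u$ of the infinite $b$-ary tree carries an independent copy $\mathcal V^{(u)}$ of $\mathcal V$, and the subtree rooted at the root stores $n$ items. If the subtree rooted at $u$ stores $m\le s$ items, then all of them are stored in $u$. If it stores $m>s$ items, then $s_0$ of them are stored in $u$, each of the $b$ child subtrees of $u$ receives $s_1$ items, and each of the remaining $m-s_0-bs_1$ items is sent to one of the child subtrees, the $j$-th child being chosen with probability $V^{(u)}_j$, independently for different items (given $\mathcal V^{(u)}$) and independently for different nodes. Let $X_n$ be the path length of $\mathcal T_n$, i.e. the sum over all items of the depth of the node storing the item, and let $W_n$ be its Wiener index, i.e. the sum over all unordered pairs of items of the distance in the tree between the nodes storing them. Assume that every marginal $V_j$ has a Lebesgue density, and let $(W,X)$ be the limit in distribution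 $$\left(\frac{W_n-\mathbb E[W_n]}{n^2},\ \frac{X_n-\mathbb E[X_n]}{n}\right)\stackrel{d}{\longrightarrow}(W,X)\qquad(n\to\infty).$$ Put $\mu:=-\mathbb E\big[\sum_{j=1}^b V_j\ln V_j\big]$ (with $0\ln 0=0$) and $C(\mathcal V):=1+\frac1\mu\sum_{j=1}^b V_j\ln V_j$. Suppose that - there are $\lambda,\nu>0$ such that $\mathbb P(\max_j V_j\ge 1-x)\le\lambda x^\nu$ for all $x\ge 0$; - $\mathbb P\big(\sum_j V_j^2=x\big)<1$ for all $x\in\mathbb R$; - $\mathbb P(C(\mathcal V)\ne 0)>0$. Then $(W,X)$ admits a bounded density $f\in\mathcal C^\infty(\mathbb R^2)$. -/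

import Mathlib

open MeasureTheory ProbabilityTheory Filter
open scoped ENNReal

/-! Random split trees with branch factor `b`, capacity `s` and ball distribution parameters
`s₀`, `s₁`, as random subtrees of the infinite `b`-ary tree. A node is the word over `Fin b` that
is read along the path from the root to it; the root is `[]`. -/

namespace SplitTree

noncomputable section

/-- The number of items that the `j`-th child subtree receives from a node whose subtree stores `n`
items. If `n ≤ s`, the node is a leaf and keeps all of them. Otherwise the node keeps `s₀` items,
every child receives `s₁` items, and each of the remaining `n - s₀ - b * s₁` items is sent to a
child, the `k`-th one to the child `route k`. -/
def childSize {b : ℕ} (s s₀ s₁ n : ℕ) (route : ℕ → Fin b) (j : Fin b) : ℕ :=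
  if n ≤ s then 0
  else s₁ + ((Finset.range (n - (s₀ + b * s₁))).filter (fun k => route k = j)).card

/-- The number of items stored in the subtree rooted at a given node, in the split tree that stores
`n` items; `route u k` is the child to which node `u` sends the `k`-th item that it distributes. -/
def subtreeSize {b : ℕ} (s s₀ s₁ : ℕ) : (List (Fin b) → ℕ → Fin b) → ℕ → List (Fin b) → ℕ
  | _, n, [] => n
  | route, n, j :: u =>
      subtreeSize s s₀ s₁ (fun w => route (j :: w)) (childSize s s₀ s₁ n (route []) j) u

/-- The number of items stored in the node `u` itself. -/
def nodeItems {b : ℕ} (s s₀ s₁ : ℕ) (route : List (Fin b) → ℕ → Fin b) (n : ℕ)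
    (u : List (Fin b)) : ℕ :=
  if subtreeSize s s₀ s₁ route n u ≤ s then subtreeSize s s₀ s₁ route n u else s₀

/-- The length of the longest common prefix of two words. -/
def commonPrefixLength {b : ℕ} : List (Fin b) → List (Fin b) → ℕ
  | i :: u, j :: v => if i = j then commonPrefixLength u v + 1 else 0
  | _, _ => 0

/-- The number of edges on the path between two nodes (up to their last common ancestor, and down
again). -/
def nodeDist {b : ℕ} (u v : List (Fin b)) : ℕ :=
  (u.length - commonPrefixLength u v) + (v.length - commonPrefixLength u v)

/-- The path length: the sum over all items of the depth of the node that stores the item. -/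
def pathLength {b : ℕ} (s s₀ s₁ : ℕ) (route : List (Fin b) → ℕ → Fin b) (n : ℕ) : ℝ :=
  ∑' u : List (Fin b), (nodeItems s s₀ s₁ route n u : ℝ) * (u.length : ℝ)

/-- The Wiener index: the sum over all unordered pairs of items of the distance between the nodes
that store them. -/
def wienerIndex {b : ℕ} (s s₀ s₁ : ℕ) (route : List (Fin b) → ℕ → Fin b) (n : ℕ) : ℝ :=
  (1 / 2) * ∑' p : List (Fin b) × List (Fin b),
    (nodeItems s s₀ s₁ route n p.1 : ℝ) * (nodeItems s s₀ s₁ route n p.2 : ℝ)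
      * (nodeDist p.1 p.2 : ℝ)

/-- `V` and `J` are the split vectors of the nodes and the random choices of the items in a split
tree whose split vector has law `σ`: the nodes behave independently of each other, and at each node
`u` the split vector `V u` has law `σ` and, conditionally on `V u = v`, the choices
`J u 0, J u 1, …` are independent and equal to `i` with probability `v i`. -/
structure IsRouting {b : ℕ} {Ω : Type*} [MeasurableSpace Ω] (P : Measure Ω)
    (σ : Measure (Fin b → ℝ)) (V : List (Fin b) → Ω → (Fin b → ℝ))
    (J : List (Fin b) → ℕ → Ω → Fin b) : Prop where
  measurable_vector : ∀ u, Measurable (V u)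
  measurable_choice : ∀ u k, Measurable (J u k)
  indep : iIndepFun (fun (u : List (Fin b)) (ω : Ω) => (V u ω, fun k : ℕ => J u k ω)) P
  law : ∀ (u : List (Fin b)) (m : ℕ) (i : Fin m → Fin b) (A : Set (Fin b → ℝ)), MeasurableSet A →
    P {ω | V u ω ∈ A ∧ ∀ k : Fin m, J u k ω = i k}
      = ∫⁻ v in A, ∏ k : Fin m, ENNReal.ofReal (v (i k)) ∂σ

/-- The mean entropy `μ = -E[∑ V_j ln V_j]` of a split vector with law `σ`. -/
def meanEntropy {b : ℕ} (σ : Measure (Fin b → ℝ)) : ℝ :=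
  -∫ v, ∑ j, v j * Real.log (v j) ∂σ

/-- The function `C(v) = 1 + (1/μ) ∑ v_j ln v_j`. -/
def toll {b : ℕ} (σ : Measure (Fin b → ℝ)) (v : Fin b → ℝ) : ℝ :=
  1 + (1 / meanEntropy σ) * ∑ j, v j * Real.log (v j)

/-- The rescaled pair `((W_n - E W_n) / n², (X_n - E X_n) / n)` of the Wiener index `W_n` and the
path length `X_n` of the random split tree that stores `n` items. -/
def normalizedPair {b : ℕ} {Ω : Type*} [MeasurableSpace Ω] (P : Measure Ω) (s s₀ s₁ : ℕ)
    (J : List (Fin b) → ℕ → Ω → Fin b) (n : ℕ) (ω : Ω) : ℝ × ℝ :=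
  ((wienerIndex s s₀ s₁ (fun u k => J u k ω) n
      - ∫ ω', wienerIndex s s₀ s₁ (fun u k => J u k ω') n ∂P) / (n : ℝ) ^ 2,
   (pathLength s s₀ s₁ (fun u k => J u k ω) n
      - ∫ ω', pathLength s s₀ s₁ (fun u k => J u k ω') n ∂P) / (n : ℝ))

/-- The measure `ρ` on `ℝ²` has a bounded density of class `C^∞`. -/
def HasBoundedSmoothDensity (ρ : Measure (ℝ × ℝ)) : Prop :=
  ∃ f : ℝ × ℝ → ℝ, ContDiff ℝ ((⊤ : ℕ∞) : WithTop ℕ∞) f ∧ (∀ z, 0 ≤ f z) ∧ (∃ M : ℝ, ∀ z, f z ≤ M) ∧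
    ρ = (volume : Measure (ℝ × ℝ)).withDensity (fun z => ENNReal.ofReal (f z))

end

end SplitTree

/-! ### Asymptotically harmonic functions on the line -/

section Liouville

open Topology

variable {F : Measure ℝ} [IsProbabilityMeasure F]

/-! Let T_p(n) be the sum of the p-th powers of all subtree sizes. An item at depth d lies in d + 1
subtrees, and a pair of items lies in as many common subtrees as it has common ancestors. Hence the
path length is T_1 - n and the Wiener index is n T_1 - T_2 (`pathLength_eq`, `wienerIndex_eq`). So
(X - W, X) is the limit of the centred pair (T_2 / n², T_1 / n), and a linear change of variables
reduces the theorem to this pair.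

Splitting the tree at the root gives an affine recursion for the pair. In the limit it becomes the
fixed point equation, in law, Y₂ = ∑ V_j² Y₂^(j) + (∑ V_j² - q)/(1 - q) and Y₁ = ∑ V_j Y₁^(j) +
C(V), with q = E ∑ V_j² and independent copies of (Y₂, Y₁) (`planarCharFun_eq_integral`). It is
reached by passing to the limit in characteristic functions along a subsequence on which the
relative subtree sizes converge almost surely to V. Only weak convergence of the given sequence is
used, no moments of the limit.

This needs the limits of the tolls, hence asymptotics of the means. For T_2, a discrete maximum
principle (`nonneg_of_superharmonic`) gives E T_2 ~ n²/(1 - q). For T_1, E T_1 = n log n / μ + H(n),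
where H has bounded increments: adding one item gives a recursion with size-biased weights whose
solution is log n / μ + O(1) (`exists_abs_sub_log_le`). No asymptotics of H itself are needed. It
suffices that H(⌊cn⌋) - c H(n) = o(n) (`tendsto_floor_sub_div`). In the variable log n this says
that a bounded, asymptotically harmonic function is asymptotically translation invariant, a
Choquet-Deny statement (`tendsto_shift_sub_of_asymptotically_harmonic`) that relies on the split
vector having no atoms.

The fixed point equation gives |φ(z)| ≤ E ∏ |φ(V_j · z)| for the characteristic function φ, where
V_j acts by the dilation (s, t) ↦ (s V_j², t V_j). If |φ| = 1 somewhere off the origin, it is 1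
along a null sequence of dilates, which makes a coordinate of the limit constant; the fixed point
equation and the two nondegeneracy assumptions forbid this (`norm_planarCharFun_lt_one`). Then the
inequality bootstraps itself to decay faster than any power (`rapid_decay_of_recursion`), and
Fourier inversion produces the bounded smooth density (`hasBoundedSmoothDensity_of_rapid_decay`). -/

theorem integrable_shift_of_bounded {g : ℝ → ℝ} {B : ℝ} (hm : Measurable g)
    (hB : ∀ x, |g x| ≤ B) (x : ℝ) : Integrable (fun y => g (x + y)) F :=
  Integrable.of_bound (hm.comp (measurable_const_add x)).aestronglyMeasurable B
    (ae_of_all _ fun y => by simpa using hB (x + y))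

/-- Near-maximality propagates along the support of the step law. The value at x n is almost the
mean of the values at x n + y, none of which exceeds c asymptotically. A deficit at x n + a would
persist on a ball around a, which has positive mass, and would pull the mean below c. -/
theorem tendsto_add_support_of_asymptotically_harmonic {g : ℝ → ℝ} {B c : ℝ} (hm : Measurable g)
    (hB : ∀ x, |g x| ≤ B)
    (huc : ∀ ε > 0, ∃ δ > 0, ∃ R, ∀ x y, R ≤ x → R ≤ y → |x - y| < δ → |g x - g y| < ε)
    (hg : Tendsto (fun x => g x - ∫ y, g (x + y) ∂F) atTop (𝓝 0))
    (hc : ∀ η > 0, ∀ᶠ x in atTop, g x ≤ c + η) {a : ℝ} (ha : a ∈ F.support) {x : ℕ → ℝ}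
    (hx : Tendsto x atTop atTop) (hxc : Tendsto (fun n => g (x n)) atTop (𝓝 c)) :
    Tendsto (fun n => g (x n + a)) atTop (𝓝 c) := by
  have hxa : ∀ y : ℝ, Tendsto (fun n => x n + y) atTop atTop := fun y =>
    tendsto_atTop_add_const_right _ _ hx
  -- the positive part of `g - c` is negligible
  have hpos : Tendsto (fun n => ∫ y, max (g (x n + y) - c) 0 ∂F) atTop (𝓝 (∫ _, (0 : ℝ) ∂F)) := by
    refine tendsto_integral_of_dominated_convergence (fun _ => B + |c|) (fun n => ?_)
      (integrable_const _) (fun n => ae_of_all _ fun y => ?_) (ae_of_all _ fun y => ?_)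
    · exact (((hm.comp (measurable_const_add (x n))).sub_const c).max
        measurable_const).aestronglyMeasurable
    · have h1 := hB (x n + y)
      have h0 : 0 ≤ B := (abs_nonneg _).trans h1
      rw [Real.norm_eq_abs, abs_of_nonneg (le_max_right _ _)]
      refine max_le ?_ (by positivity)
      have := abs_le.1 h1
      have := neg_abs_le c
      linarith
    · refine (tendsto_order.2 ⟨fun b hb => Eventually.of_forall fun n => hb.trans_le
        (le_max_right _ _), fun b hb => ?_⟩)
      filter_upwards [(hxa y).eventually (hc (b / 2) (by linarith))] with n hn
      exact max_lt (by linarith) hb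
  simp only [integral_zero] at hpos
  refine tendsto_order.2 ⟨fun b hb => ?_, fun b hb => ?_⟩
  swap
  · filter_upwards [(hxa a).eventually (hc ((b - c) / 2) (by linarith))] with n hn
    linarith
  -- The upper bound is immediate from `hc`. For the lower bound, a deficit of ε at x n + a is
  -- refuted.
  set ε := c - b with hε
  have hε0 : 0 < ε := by linarith
  obtain ⟨δ, hδ, R, hR⟩ := huc (ε / 2) (by linarith)
  have hp : 0 < F.real (Metric.ball a δ) := by
    rw [measureReal_def, ENNReal.toReal_pos_iff]
    refine ⟨?_, measure_lt_top _ _⟩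
    exact (Measure.mem_support_iff_forall a).1 ha _ (Metric.ball_mem_nhds a hδ)
  set p := F.real (Metric.ball a δ) with hpdef
  have hη : 0 < ε * p / 8 := by positivity
  filter_upwards [(tendsto_order.1 hpos).2 _ hη,
    ((hg.comp hx).eventually (Metric.ball_mem_nhds 0 hη)),
    (tendsto_order.1 hxc).1 (c - ε * p / 8) (by linarith),
    hx.eventually (eventually_ge_atTop (R - a + δ))] with n h1 h2 h3 h4
  by_contra hbad
  push Not at hbad
  have hball : ∀ y ∈ Metric.ball a δ, g (x n + y) ≤ c - ε / 2 := by
    intro y hy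
    rw [Metric.mem_ball, Real.dist_eq] at hy
    have hy' := abs_lt.1 hy
    have h5 := hR (x n + y) (x n + a) (by linarith) (by linarith) (by simpa using hy)
    have := (abs_lt.1 h5).2
    linarith
  -- The ball of mass p costs the mean ε * p / 2, while positive excess, harmonicity defect and
  -- distance of g (x n) to c contribute less than ε * p / 8 each.
  have hle : ∫ y, g (x n + y) ∂F ≤
      ∫ y, (c + max (g (x n + y) - c) 0 - (Metric.ball a δ).indicator (fun _ => ε / 2) y) ∂F := by
    refine integral_mono_ae (integrable_shift_of_bounded hm hB (x n)) ?_ (ae_of_all _ fun y => ?_)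
    · refine ((integrable_const c).add ?_).sub
        ((integrable_const _).indicator Metric.isOpen_ball.measurableSet)
      exact ((integrable_shift_of_bounded hm hB (x n)).sub (integrable_const c)).pos_part
    · by_cases hy : y ∈ Metric.ball a δ
      · simp only [Set.indicator_of_mem hy]
        have := hball y hy
        have := le_max_right (g (x n + y) - c) 0
        linarith
      · simp only [Set.indicator_of_notMem hy]
        have := le_max_left (g (x n + y) - c) 0
        linarith
  rw [integral_sub, integral_add, integral_const, integral_indicator_const] at hle
  rotate_left
  · exact Metric.isOpen_ball.measurableSet
  · exact integrable_const _
  · exact ((integrable_shift_of_bounded hm hB (x n)).sub (integrable_const c)).pos_part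
  · exact (integrable_const c).add
      ((integrable_shift_of_bounded hm hB (x n)).sub (integrable_const c)).pos_part
  · exact (integrable_const _).indicator Metric.isOpen_ball.measurableSet
  simp only [probReal_univ, smul_eq_mul, one_mul] at hle
  rw [← hpdef] at hle
  simp only [Function.comp, Real.dist_eq, sub_zero] at h2
  have := (abs_lt.1 h2).2
  nlinarith

/-- The difference h - h(· + a) is again asymptotically harmonic. If its upper limit c were
positive, points where it is almost c could be shifted by a any number of times with the value
staying near c. Telescoping N shifts gives h(x) - h(x + N a) close to N c, against the boundedness
of h. -/
theorem eventually_sub_le_of_asymptotically_harmonic {h : ℝ → ℝ} {B : ℝ} (hm : Measurable h)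
    (hB : ∀ x, |h x| ≤ B)
    (huc : ∀ ε > 0, ∃ δ > 0, ∃ R, ∀ x y, R ≤ x → R ≤ y → |x - y| < δ → |h x - h y| < ε)
    (hh : Tendsto (fun x => h x - ∫ y, h (x + y) ∂F) atTop (𝓝 0)) {a : ℝ} (ha : a ∈ F.support)
    {η : ℝ} (hη : 0 < η) : ∀ᶠ x in atTop, h x - h (x + a) ≤ η := by
  set g : ℝ → ℝ := fun x => h x - h (x + a) with hgdef
  have hgm : Measurable g := hm.sub (hm.comp (measurable_add_const a))
  have hgB : ∀ x, |g x| ≤ 2 * B := fun x => by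
    have h1 := abs_le.1 (hB x)
    have h2 := abs_le.1 (hB (x + a))
    rw [abs_le]
    constructor <;> simp only [hgdef] <;> linarith
  have hguc : ∀ ε > 0, ∃ δ > 0, ∃ R, ∀ x y, R ≤ x → R ≤ y → |x - y| < δ → |g x - g y| < ε := by
    intro ε hε
    obtain ⟨δ, hδ, R, hR⟩ := huc (ε / 2) (by linarith)
    refine ⟨δ, hδ, max R (R - a), fun x y hx hy hxy => ?_⟩
    have hx' := max_le_iff.1 hx
    have hy' := max_le_iff.1 hy
    have h1 := abs_lt.1 (hR x y hx'.1 hy'.1 hxy)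
    have h2 := abs_lt.1 (hR (x + a) (y + a) (by linarith) (by linarith) (by simpa using hxy))
    rw [abs_lt]
    constructor <;> simp only [hgdef] <;> linarith
  have hgh : Tendsto (fun x => g x - ∫ y, g (x + y) ∂F) atTop (𝓝 0) := by
    have h1 := hh.sub (hh.comp (tendsto_atTop_add_const_right _ a tendsto_id))
    simp only [sub_zero] at h1
    refine h1.congr fun x => ?_
    have : ∫ y, g (x + y) ∂F = ∫ y, h (x + y) ∂F - ∫ y, h (x + a + y) ∂F := by
      rw [← integral_sub (integrable_shift_of_bounded hm hB x)
        (integrable_shift_of_bounded hm hB (x + a))]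
      refine integral_congr_ae (ae_of_all _ fun y => ?_)
      simp only [hgdef]
      ring_nf
    rw [this]
    simp only [Function.comp, id, hgdef]
    ring
  by_contra hbad
  have hbad' : ∃ᶠ x in atTop, η < g x := by
    rw [Filter.not_eventually] at hbad
    exact hbad.mono fun x hx => not_le.1 hx
  -- The infimum of the eventual upper bounds is the upper limit of g, here at least η by
  -- assumption.
  set S : Set ℝ := {c | ∀ᶠ x in atTop, g x ≤ c} with hS
  have hSne : S.Nonempty := ⟨2 * B, Eventually.of_forall fun x => (le_abs_self _).trans (hgB x)⟩
  have hSlb : ∀ c ∈ S, η ≤ c := fun c hc => by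
    obtain ⟨x, hx1, hx2⟩ := (hbad'.and_eventually hc).exists
    linarith
  set c := sInf S with hcdef
  have hcη : η ≤ c := le_csInf hSne hSlb
  have hc : ∀ ε > 0, ∀ᶠ x in atTop, g x ≤ c + ε := by
    intro ε hε
    obtain ⟨d, hd, hdc⟩ := exists_lt_of_csInf_lt hSne (show sInf S < c + ε by linarith)
    exact hd.mono fun x hx => hx.trans hdc.le
  have hfreq : ∀ ε > 0, ∃ᶠ x in atTop, c - ε < g x := by
    intro ε hε hcon
    have : c - ε ∈ S := hcon.mono fun x hx => not_lt.1 hx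
    have := csInf_le ⟨η, hSlb⟩ this
    linarith
  have hseq : ∀ n : ℕ, ∃ x : ℝ, (n : ℝ) ≤ x ∧ c - 1 / ((n : ℝ) + 1) < g x := fun n =>
    (((hfreq _ (by positivity)).and_eventually (eventually_ge_atTop (n : ℝ))).exists).imp
      fun x hx => ⟨hx.2, hx.1⟩
  choose x hxn hxg using hseq
  have hx : Tendsto x atTop atTop := tendsto_atTop_mono hxn tendsto_natCast_atTop_atTop
  have hxc : Tendsto (fun n => g (x n)) atTop (𝓝 c) := by
    refine tendsto_order.2 ⟨fun b hb => ?_, fun b hb => ?_⟩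
    · have := tendsto_one_div_add_atTop_nhds_zero_nat (𝕜 := ℝ)
      filter_upwards [(tendsto_order.1 this).2 (c - b) (by linarith)] with n hn
      have := hxg n
      linarith
    · filter_upwards [hx.eventually (hc ((b - c) / 2) (by linarith))] with n hn
      linarith
  have hiter : ∀ i : ℕ, Tendsto (fun n => g (x n + i * a)) atTop (𝓝 c) := by
    intro i
    induction i with
    | zero => simpa using hxc
    | succ i ih =>
      have := tendsto_add_support_of_asymptotically_harmonic hgm hgB hguc hgh hc ha
        (tendsto_atTop_add_const_right _ (i * a) hx) ih
      refine this.congr fun n => ?_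
      push_cast
      ring_nf
  have hsum : ∀ N : ℕ, Tendsto (fun n => h (x n) - h (x n + N * a)) atTop (𝓝 (N * c)) := by
    intro N
    induction N with
    | zero => simp
    | succ N ih =>
      have := ih.add (hiter N)
      have e : (N : ℝ) * c + c = ((N + 1 : ℕ) : ℝ) * c := by push_cast; ring
      rw [e] at this
      refine this.congr fun n => ?_
      have : x n + ((N + 1 : ℕ) : ℝ) * a = x n + N * a + a := by push_cast; ring
      rw [this]
      simp only [hgdef]
      ring
  obtain ⟨N, hN⟩ := exists_nat_gt (2 * B / c)
  have hc0 : 0 < c := by linarith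
  have h1 : (N : ℝ) * c ≤ 2 * B := by
    refine le_of_tendsto (hsum N) (Eventually.of_forall fun n => ?_)
    have h1 := abs_le.1 (hB (x n))
    have h2 := abs_le.1 (hB (x n + N * a))
    linarith
  rw [div_lt_iff₀ hc0] at hN
  linarith

/-- A bounded, asymptotically uniformly continuous function that is asymptotically harmonic with
respect to an atomless step distribution is asymptotically invariant under translations. -/
theorem tendsto_shift_sub_of_asymptotically_harmonic [NullSingletonClass F] {h : ℝ → ℝ} {B : ℝ}
    (hm : Measurable h) (hB : ∀ x, |h x| ≤ B)
    (huc : ∀ ε > 0, ∃ δ > 0, ∃ R, ∀ x y, R ≤ x → R ≤ y → |x - y| < δ → |h x - h y| < ε)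
    (hh : Tendsto (fun x => h x - ∫ y, h (x + y) ∂F) atTop (𝓝 0)) (a : ℝ) :
    Tendsto (fun x => h (x + a) - h x) atTop (𝓝 0) := by
  -- The asymptotic periods of h form a subgroup of the line.
  let S : AddSubgroup ℝ :=
    { carrier := {a | Tendsto (fun x => h (x + a) - h x) atTop (𝓝 0)}
      zero_mem' := by simp
      add_mem' := by
        intro a b ha hb
        have := (ha.comp (tendsto_atTop_add_const_right _ b tendsto_id)).add hb
        simp only [add_zero] at this
        refine this.congr fun x => ?_
        simp only [Function.comp, id]
        rw [show x + b + a = x + (a + b) by ring]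
        ring
      neg_mem' := by
        intro a ha
        have := (ha.comp (tendsto_atTop_add_const_right _ (-a) tendsto_id)).neg
        simp only [neg_zero] at this
        refine this.congr fun x => ?_
        simp }
  have hsupp : F.support ⊆ S := by
    intro a ha
    -- The one-sided estimate for h and for -h together puts every point of the support into the
    -- subgroup.
    have h1 := fun η hη => eventually_sub_le_of_asymptotically_harmonic hm hB huc hh ha (η := η) hη
    have h2 := fun η hη => eventually_sub_le_of_asymptotically_harmonic (h := fun x => -h x)
      hm.neg (by simpa using hB)
      (by
        intro ε hε
        obtain ⟨δ, hδ, R, hR⟩ := huc ε hε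
        refine ⟨δ, hδ, R, fun x y hx hy hxy => ?_⟩
        rw [neg_sub_neg, abs_sub_comm]
        exact hR x y hx hy hxy)
      (by
        have := hh.neg
        rw [neg_zero] at this
        refine this.congr fun x => ?_
        rw [integral_neg]
        ring)
      ha (η := η) hη
    change Tendsto (fun x => h (x + a) - h x) atTop (𝓝 0)
    refine tendsto_order.2 ⟨fun b hb => ?_, fun b hb => ?_⟩
    · filter_upwards [h1 (-b / 2) (by linarith)] with x hx
      linarith
    · filter_upwards [h2 (b / 2) (by linarith)] with x hx
      linarith
  -- A subgroup that is not dense is cyclic, hence countable and null for an atomless law, but it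
  -- contains the support, which has full measure.
  have hdense : Dense (S : Set ℝ) := by
    refine (AddSubgroup.dense_or_cyclic S).resolve_right ?_
    rintro ⟨d, hd⟩
    have hcount : (S : Set ℝ).Countable := by
      rw [hd, ← AddSubgroup.zmultiples_eq_closure]
      have : ((AddSubgroup.zmultiples d : AddSubgroup ℝ) : Set ℝ) = Set.range (fun n : ℤ => n • d) := by
        ext; simp [AddSubgroup.mem_zmultiples_iff]
      rw [this]
      exact Set.countable_range _
    have h0 : F (S : Set ℝ) = 0 := hcount.measure_zero F
    have h1 : F F.supportᶜ = 0 := Measure.measure_compl_support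
    have h2 : F Set.univ ≤ F F.support + F F.supportᶜ := by
      rw [← Set.union_compl_self F.support]; exact measure_union_le _ _
    rw [h1, measure_mono_null hsupp h0, measure_univ] at h2
    simp at h2
  -- Asymptotic uniform continuity carries the convergence from the dense subgroup to an arbitrary
  -- shift.
  rw [Metric.tendsto_nhds]
  intro ε hε
  obtain ⟨δ, hδ, R, hR⟩ := huc (ε / 2) (by linarith)
  obtain ⟨a', ha'S, ha'⟩ := Metric.dense_iff.1 hdense a δ hδ
  rw [Metric.mem_ball, Real.dist_eq] at ha'S
  have hS' : Tendsto (fun x => h (x + a') - h x) atTop (𝓝 0) := ha'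
  filter_upwards [hS'.eventually (Metric.ball_mem_nhds 0 (half_pos hε)),
    eventually_ge_atTop (R - a), eventually_ge_atTop (R - a')] with x h1 h2 h3
  have h4 := hR (x + a) (x + a') (by linarith) (by linarith)
    (by rw [abs_sub_comm] at ha'S; simpa using ha'S)
  rw [Real.dist_eq, sub_zero] at h1
  rw [Real.dist_eq, sub_zero]
  have := abs_lt.1 h1
  have := abs_lt.1 h4
  rw [abs_lt]
  constructor <;> linarith

end Liouville

/-! ### Decay of functions satisfying a multiplicative recursion -/

section Decay

open Topology

/-- The gauge `max (√|s|) |t|`, which is homogeneous for the dilations `(s, t) ↦ (s w², t w)`. -/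
noncomputable def gauge₂ (z : ℝ × ℝ) : ℝ := max (√|z.1|) |z.2|

/-- The dilation `(s, t) ↦ (s w², t w)`. -/
def dilate₂ (w : ℝ) (z : ℝ × ℝ) : ℝ × ℝ := (z.1 * w ^ 2, z.2 * w)

theorem continuous_gauge₂ : Continuous gauge₂ := by
  unfold gauge₂
  fun_prop

theorem continuous_dilate₂ (z : ℝ × ℝ) : Continuous fun w => dilate₂ w z := by
  unfold dilate₂
  fun_prop

theorem gauge₂_dilate₂ {w : ℝ} (hw : 0 ≤ w) (z : ℝ × ℝ) :
    gauge₂ (dilate₂ w z) = w * gauge₂ z := by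
  unfold gauge₂ dilate₂
  rw [mul_max_of_nonneg _ _ hw, abs_mul, abs_mul, abs_of_nonneg hw, abs_of_nonneg (sq_nonneg w),
    Real.sqrt_mul (abs_nonneg _), Real.sqrt_sq hw]
  ring_nf

theorem gauge₂_nonneg (z : ℝ × ℝ) : 0 ≤ gauge₂ z := le_max_of_le_right (abs_nonneg _)

theorem isCompact_gauge₂_le (R : ℝ) : IsCompact {z | gauge₂ z ≤ R} := by
  refine IsCompact.of_isClosed_subset
    ((isCompact_Icc (a := -(R ^ 2)) (b := R ^ 2)).prod (isCompact_Icc (a := -R) (b := R)))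
    (isClosed_le continuous_gauge₂ continuous_const) ?_
  intro z hz
  obtain ⟨h1, h2⟩ := max_le_iff.1 (show max (√|z.1|) |z.2| ≤ R from hz)
  have hR : 0 ≤ R := (abs_nonneg _).trans h2
  rw [Real.sqrt_le_left hR] at h1
  exact ⟨abs_le.1 h1, abs_le.1 h2⟩

variable {b : ℕ} {σ : Measure (Fin b → ℝ)} [IsProbabilityMeasure σ]

theorem exists_one_div_le_of_mem_stdSimplex {v : Fin b → ℝ} (hv : v ∈ stdSimplex ℝ (Fin b)) :
    ∃ j, 1 / (b : ℝ) ≤ v j := by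
  by_contra! hcon
  have hb : 0 < b := by
    rcases Nat.eq_zero_or_pos b with h | h
    · subst h
      simpa using hv.2
    · exact h
  have : ∑ j, v j < ∑ _j : Fin b, 1 / (b : ℝ) :=
    Finset.sum_lt_sum_of_nonempty ⟨⟨0, hb⟩, Finset.mem_univ _⟩ fun j _ => hcon j
  rw [hv.2] at this
  simp [hb.ne'] at this

theorem prod_le_of_mem_unitInterval {ι : Type*} [Fintype ι] {f : ι → ℝ} (h0 : ∀ i, 0 ≤ f i)
    (h1 : ∀ i, f i ≤ 1) (j : ι) : ∏ i, f i ≤ f j := by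
  classical
  rw [← Finset.mul_prod_erase _ _ (Finset.mem_univ j)]
  exact mul_le_of_le_one_right (h0 j) (Finset.prod_le_one (fun i _ => h0 i) fun i _ => h1 i)

theorem prod_le_mul_of_mem_unitInterval {ι : Type*} [Fintype ι] {f : ι → ℝ} (h0 : ∀ i, 0 ≤ f i)
    (h1 : ∀ i, f i ≤ 1) {j k : ι} (hjk : j ≠ k) : ∏ i, f i ≤ f j * f k := by
  classical
  rw [← Finset.mul_prod_erase _ _ (Finset.mem_univ j),
    ← Finset.mul_prod_erase _ _ (Finset.mem_erase.2 ⟨hjk.symm, Finset.mem_univ k⟩)]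
  refine mul_le_mul_of_nonneg_left ?_ (h0 j)
  exact mul_le_of_le_one_right (h0 k) (Finset.prod_le_one (fun i _ => h0 i) fun i _ => h1 i)

/-- On the compact shell 1 ≤ gauge ≤ b the maximum is below some c < 1. If c were reached further
out, a point z of least gauge with ψ z ≥ c would have gauge above b. Some coordinate of the split
vector is at least 1/b and below 1, so one dilate of z has gauge at least 1 but smaller than that of
z, and there ψ < c. Hence the product is almost surely below c, and so is its mean, which bounds ψ
z. -/
theorem exists_lt_one_bound_of_recursion {ψ : ℝ × ℝ → ℝ} (hψc : Continuous ψ)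
    (h0 : ∀ z, 0 ≤ ψ z) (h1 : ∀ z, ψ z ≤ 1) (hlt : ∀ z, z ≠ 0 → ψ z < 1) (hb : 2 ≤ b)
    (hσ : ∀ᵐ v ∂σ, v ∈ stdSimplex ℝ (Fin b)) (hσ1 : ∀ᵐ v ∂σ, ∀ j, 0 < v j ∧ v j < 1)
    (hrec : ∀ z, ψ z ≤ ∫ v, ∏ j, ψ (dilate₂ (v j) z) ∂σ) :
    ∃ c < 1, ∀ z, 1 ≤ gauge₂ z → ψ z ≤ c := by
  have hb0 : (0 : ℝ) < b := by positivity
  have hb1 : (1 : ℝ) ≤ b := by exact_mod_cast (by omega : 1 ≤ b)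
  have hK : IsCompact ({z | gauge₂ z ≤ b} ∩ {z | 1 ≤ gauge₂ z}) :=
    (isCompact_gauge₂_le b).inter_right (isClosed_le continuous_const continuous_gauge₂)
  have hne : ({z | gauge₂ z ≤ b} ∩ {z | 1 ≤ gauge₂ z}).Nonempty :=
    ⟨(0, 1), by simp [gauge₂, hb1]⟩
  obtain ⟨z₀, hz₀, hmax⟩ := hK.exists_isMaxOn hne hψc.continuousOn
  have hz₀0 : z₀ ≠ 0 := by
    rintro rfl
    have : (1 : ℝ) ≤ gauge₂ 0 := hz₀.2
    norm_num [gauge₂] at this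
  obtain ⟨c, hc1, hc2⟩ := exists_between (hlt z₀ hz₀0)
  refine ⟨c, hc2, ?_⟩
  by_contra! hcon
  obtain ⟨z₁, hz₁, hz₁c⟩ := hcon
  have hA : IsCompact ({z | gauge₂ z ≤ gauge₂ z₁} ∩ {z | 1 ≤ gauge₂ z ∧ c ≤ ψ z}) :=
    (isCompact_gauge₂_le _).inter_right
      ((isClosed_le continuous_const continuous_gauge₂).inter (isClosed_le continuous_const hψc))
  obtain ⟨z, hz, hmin⟩ := hA.exists_isMinOn ⟨z₁, le_refl (gauge₂ z₁), hz₁, hz₁c.le⟩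
    continuous_gauge₂.continuousOn
  have hzb : b < gauge₂ z := by
    by_contra! hle
    have : ψ z ≤ ψ z₀ := hmax ⟨hle, hz.2.1⟩
    linarith [hz.2.2]
  have hsmall : ∀ y, 1 ≤ gauge₂ y → gauge₂ y < gauge₂ z → ψ y < c := by
    intro y hy1 hy2
    by_contra! hle
    have : gauge₂ z ≤ gauge₂ y := hmin ⟨hy2.le.trans hz.1, hy1, hle⟩
    linarith
  have hprod : ∀ᵐ v ∂σ, ∏ j, ψ (dilate₂ (v j) z) < c := by
    filter_upwards [hσ, hσ1] with v hv hv1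
    obtain ⟨j, hj⟩ := exists_one_div_le_of_mem_stdSimplex hv
    refine (prod_le_of_mem_unitInterval (fun i => h0 _) (fun i => h1 _) j).trans_lt ?_
    have hg := gauge₂_dilate₂ (hv1 j).1.le z
    have hz0 : 0 < gauge₂ z := hb0.trans hzb
    refine hsmall _ ?_ ?_
    · rw [hg]
      calc (1 : ℝ) = 1 / b * b := by field_simp
        _ ≤ v j * gauge₂ z := mul_le_mul hj hzb.le hb0.le (hv1 j).1.le
    · rw [hg]
      exact mul_lt_of_lt_one_left hz0 (hv1 j).2
  have hintg : Integrable (fun v : Fin b → ℝ => ∏ j, ψ (dilate₂ (v j) z)) σ := by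
    refine Integrable.of_bound (C := 1) (Continuous.aestronglyMeasurable ?_) (ae_of_all _ fun v => ?_)
    · exact continuous_finsetProd _ fun j _ =>
        hψc.comp ((continuous_dilate₂ z).comp (continuous_apply j))
    · rw [Real.norm_eq_abs, abs_of_nonneg (Finset.prod_nonneg fun i _ => h0 _)]
      exact Finset.prod_le_one (fun i _ => h0 _) fun i _ => h1 _
  have hpos : 0 < ∫ v, (c - ∏ j, ψ (dilate₂ (v j) z)) ∂σ := by
    rw [integral_pos_iff_support_of_nonneg_ae]
    · have : (Function.support fun v => c - ∏ j, ψ (dilate₂ (v j) z)) ∈ ae σ := by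
        filter_upwards [hprod] with v hv
        exact (sub_pos.2 hv).ne'
      rw [measure_congr (eventuallyEq_univ.2 this), measure_univ]
      exact one_pos
    · filter_upwards [hprod] with v hv
      exact (sub_pos.2 hv).le
    · exact (integrable_const c).sub hintg
  rw [integral_sub (integrable_const c) hintg] at hpos
  simp only [integral_const, probReal_univ, smul_eq_mul, one_mul] at hpos
  linarith [hrec z, hz.2.2]

/-- Rapid decay: a function with values in `[0, 1]` that is less than `1` away from the origin
and bounded by the mean of the product of its dilates decays faster than any polynomial. -/
theorem rapid_decay_of_recursion {ψ : ℝ × ℝ → ℝ} (hψc : Continuous ψ)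
    (h0 : ∀ z, 0 ≤ ψ z) (h1 : ∀ z, ψ z ≤ 1) (hlt : ∀ z, z ≠ 0 → ψ z < 1) (hb : 2 ≤ b)
    (hσ : ∀ᵐ v ∂σ, v ∈ stdSimplex ℝ (Fin b)) (hσ1 : ∀ᵐ v ∂σ, ∀ j, 0 < v j ∧ v j < 1)
    (hrec : ∀ z, ψ z ≤ ∫ v, ∏ j, ψ (dilate₂ (v j) z) ∂σ) (k : ℕ) :
    ∃ C, ∀ z, ψ z * gauge₂ z ^ k ≤ C := by
  obtain ⟨c, hc1, hc⟩ := exists_lt_one_bound_of_recursion hψc h0 h1 hlt hb hσ hσ1 hrec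
  have hb0 : (0 : ℝ) < b := by positivity
  -- The supremum of ψ outside a gauge ball is monotone and inherits the recursion, which becomes
  -- one-dimensional.
  set M : ℝ → ℝ := fun r => sSup (ψ '' {z | r ≤ gauge₂ z}) with hM
  have hbdd : ∀ r, BddAbove (ψ '' {z | r ≤ gauge₂ z}) := fun r =>
    ⟨1, by rintro _ ⟨z, -, rfl⟩; exact h1 z⟩
  have hne : ∀ r, (ψ '' {z | r ≤ gauge₂ z}).Nonempty := fun r =>
    ⟨_, ⟨(0, r), by simp [gauge₂, le_abs_self], rfl⟩⟩
  have hψM : ∀ z r, r ≤ gauge₂ z → ψ z ≤ M r := fun z r hr => le_csSup (hbdd r) ⟨z, hr, rfl⟩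
  have hMle : ∀ r a, (∀ z, r ≤ gauge₂ z → ψ z ≤ a) → M r ≤ a := fun r a ha =>
    csSup_le (hne r) (by rintro _ ⟨z, hz, rfl⟩; exact ha z hz)
  have hM0 : ∀ r, 0 ≤ M r := fun r => by
    obtain ⟨z, hz⟩ : ∃ z, r ≤ gauge₂ z := ⟨(0, r), by simp [gauge₂, le_abs_self]⟩
    exact (h0 z).trans (hψM z r hz)
  have hM1 : ∀ r, M r ≤ 1 := fun r => hMle r 1 fun z _ => h1 z
  have hanti : Antitone M := fun r r' hr => hMle _ _ fun z hz => hψM z r (hr.trans hz)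
  have hMm : Measurable M := hanti.measurable
  have hMint : ∀ r, Integrable (fun v : Fin b → ℝ => ∏ j, M (r * v j)) σ := fun r => by
    refine Integrable.of_bound (C := 1) (Measurable.aestronglyMeasurable ?_) (ae_of_all _ fun v => ?_)
    · fun_prop
    · rw [Real.norm_eq_abs, abs_of_nonneg (Finset.prod_nonneg fun i _ => hM0 _)]
      exact Finset.prod_le_one (fun i _ => hM0 _) fun i _ => hM1 _
  have hψint : ∀ z, Integrable (fun v : Fin b → ℝ => ∏ j, ψ (dilate₂ (v j) z)) σ := fun z => by
    refine Integrable.of_bound (C := 1) (Continuous.aestronglyMeasurable ?_) (ae_of_all _ fun v => ?_)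
    · exact continuous_finsetProd _ fun j _ =>
        hψc.comp ((continuous_dilate₂ z).comp (continuous_apply j))
    · rw [Real.norm_eq_abs, abs_of_nonneg (Finset.prod_nonneg fun i _ => h0 _)]
      exact Finset.prod_le_one (fun i _ => h0 _) fun i _ => h1 _
  have hMrec : ∀ r, M r ≤ ∫ v, ∏ j, M (r * v j) ∂σ := by
    intro r
    refine hMle _ _ fun z hz => (hrec z).trans ?_
    refine integral_mono_ae (hψint z) (hMint r) ?_
    filter_upwards [hσ1] with v hv
    refine Finset.prod_le_prod (fun i _ => h0 _) fun i _ => hψM _ _ ?_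
    rw [gauge₂_dilate₂ (hv i).1.le, mul_comm r]
    exact mul_le_mul_of_nonneg_left hz (hv i).1.le
  obtain ⟨l, hl⟩ : ∃ l, Tendsto M atTop (𝓝 l) :=
    ⟨_, tendsto_atTop_ciInf hanti ⟨0, by rintro _ ⟨r, rfl⟩; exact hM0 r⟩⟩
  have hl0 : 0 ≤ l := ge_of_tendsto' hl hM0
  have hlc : l ≤ c := le_of_tendsto hl <| by
    filter_upwards [eventually_ge_atTop 1] with r hr
    exact hMle _ _ fun z hz => hc z (hr.trans hz)
  have hlb : Tendsto (fun r => ∫ v, ∏ j, M (r * v j) ∂σ) atTop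
      (𝓝 (∫ _v : Fin b → ℝ, ∏ _j : Fin b, l ∂σ)) := by
    refine tendsto_integral_filter_of_dominated_convergence (fun _ => 1)
      (Eventually.of_forall fun r => (hMint r).aestronglyMeasurable)
      (Eventually.of_forall fun r => ae_of_all _ fun v => ?_) (integrable_const _) ?_
    · rw [Real.norm_eq_abs, abs_of_nonneg (Finset.prod_nonneg fun i _ => hM0 _)]
      exact Finset.prod_le_one (fun i _ => hM0 _) fun i _ => hM1 _
    · filter_upwards [hσ1] with v hv
      exact tendsto_finsetProd _ fun j _ => hl.comp (tendsto_id.atTop_mul_const (hv j).1)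
  -- Every dilated radius tends to infinity, so the recursion passes to the limit l. Since l ≤ c < 1
  -- and b ≥ 2, this leaves only l = 0.
  have hll : l ≤ l ^ b := by
    have := le_of_tendsto_of_tendsto' hl hlb hMrec
    simpa using this
  have hlz : l = 0 := by
    have h2 : l ^ b ≤ l ^ 2 := pow_le_pow_of_le_one hl0 (hlc.trans hc1.le) hb
    nlinarith
  rw [hlz] at hl
  have hε : Tendsto (fun r => ∫ v, ∑ j, M (r * v j) ∂σ) atTop
      (𝓝 (∫ _v : Fin b → ℝ, ∑ _j : Fin b, (0 : ℝ) ∂σ)) := by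
    refine tendsto_integral_filter_of_dominated_convergence (fun _ => b)
      (Eventually.of_forall fun r => Measurable.aestronglyMeasurable (by fun_prop))
      (Eventually.of_forall fun r => ae_of_all _ fun v => ?_) (integrable_const _) ?_
    · rw [Real.norm_eq_abs, abs_of_nonneg (Finset.sum_nonneg fun i _ => hM0 _)]
      exact (Finset.sum_le_sum fun i _ => hM1 _).trans (by simp)
    · filter_upwards [hσ1] with v hv
      exact tendsto_finsetSum _ fun j _ => hl.comp (tendsto_id.atTop_mul_const (hv j).1)
  simp only [Finset.sum_const_zero, integral_zero] at hε
  -- Two of the b ≥ 2 factors are kept: the one of a coordinate at least 1/b is bounded by M (r /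
  -- b), another one by the sum, whose mean vanishes as r grows.
  have hstep : ∀ r, 0 ≤ r → M r ≤ M (r / b) * ∫ v, ∑ j, M (r * v j) ∂σ := by
    intro r hr
    refine (hMrec r).trans ?_
    rw [← integral_const_mul]
    refine integral_mono_ae (hMint r) ?_ ?_
    · refine Integrable.of_bound (C := b) (Measurable.aestronglyMeasurable (by fun_prop))
        (ae_of_all _ fun v => ?_)
      have hs0 : 0 ≤ ∑ j, M (r * v j) := Finset.sum_nonneg fun i _ => hM0 _
      have hs1 : ∑ j, M (r * v j) ≤ b := (Finset.sum_le_sum fun i _ => hM1 _).trans (by simp)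
      rw [Real.norm_eq_abs, abs_of_nonneg (mul_nonneg (hM0 _) hs0)]
      exact (mul_le_of_le_one_left hs0 (hM1 _)).trans hs1
    · filter_upwards [hσ, hσ1] with v hv hv1
      obtain ⟨j, hj⟩ := exists_one_div_le_of_mem_stdSimplex hv
      obtain ⟨i, hi⟩ : ∃ i : Fin b, j ≠ i := by
        have : Nontrivial (Fin b) := Fin.nontrivial_iff_two_le.2 hb
        obtain ⟨i, hi⟩ := exists_ne j
        exact ⟨i, hi.symm⟩
      refine (prod_le_mul_of_mem_unitInterval (fun i => hM0 _) (fun i => hM1 _) hi).trans ?_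
      refine mul_le_mul (hanti ?_) ?_ (hM0 _) (hM0 _)
      · rw [div_eq_mul_one_div]
        exact mul_le_mul_of_nonneg_left hj hr
      · exact Finset.single_le_sum (f := fun i => M (r * v i)) (fun i _ => hM0 _)
          (Finset.mem_univ i)
  obtain ⟨r₀, hr₀⟩ := eventually_atTop.1
    ((tendsto_order.1 hε).2 (1 / (b : ℝ) ^ k) (by positivity))
  set R := max r₀ 1 with hR
  have hR1 : 1 ≤ R := le_max_right _ _
  -- Beyond R the gain per step is at most 1 / b ^ k, which is exactly the loss of r ^ k when r is
  -- divided by b. So M r * r ^ k does not grow from one scale to the next.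
  have key : ∀ n : ℕ, ∀ r, 0 ≤ r → r ≤ R * b ^ n → M r * r ^ k ≤ R ^ k := by
    intro n
    induction n with
    | zero =>
      intro r hr hrR
      rw [pow_zero, mul_one] at hrR
      calc M r * r ^ k ≤ 1 * R ^ k :=
            mul_le_mul (hM1 r) (pow_le_pow_left₀ hr hrR k) (by positivity) zero_le_one
        _ = R ^ k := one_mul _
    | succ n ih =>
      intro r hr hrR
      rcases le_or_gt r R with h | h
      · calc M r * r ^ k ≤ 1 * R ^ k :=
              mul_le_mul (hM1 r) (pow_le_pow_left₀ hr h k) (by positivity) zero_le_one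
          _ = R ^ k := one_mul _
      · have h2 := hr₀ r ((le_max_left _ _).trans h.le)
        have h3 : M r ≤ M (r / b) * (1 / (b : ℝ) ^ k) :=
          (hstep r hr).trans (mul_le_mul_of_nonneg_left h2.le (hM0 _))
        have h4 := ih (r / b) (by positivity) (by
          rw [div_le_iff₀ hb0, mul_assoc, ← pow_succ]
          exact hrR)
        calc M r * r ^ k ≤ M (r / b) * (1 / (b : ℝ) ^ k) * r ^ k :=
              mul_le_mul_of_nonneg_right h3 (by positivity)
          _ = M (r / b) * (r / b) ^ k := by rw [div_pow]; ring
          _ ≤ R ^ k := h4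
  refine ⟨R ^ k, fun z => ?_⟩
  have hb1 : (1 : ℝ) < b := by exact_mod_cast (by omega : 1 < b)
  obtain ⟨n, hn⟩ := pow_unbounded_of_one_lt (gauge₂ z) hb1
  have hg := gauge₂_nonneg z
  refine (mul_le_mul_of_nonneg_right (hψM z _ le_rfl) (by positivity)).trans
    (key n _ hg (hn.le.trans ?_))
  exact le_mul_of_one_le_left (by positivity) hR1

end Decay

/-! ### Characteristic functions of planar laws with a multiplicative recursion -/

section PlanarCharFun

open Topology

/-- The characteristic function of a measure on the plane. -/
noncomputable def planarCharFun (ρ : Measure (ℝ × ℝ)) (z : ℝ × ℝ) : ℂ :=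
  ∫ y, Complex.exp (((z.1 * y.1 + z.2 * y.2 : ℝ) : ℂ) * Complex.I) ∂ρ

theorem norm_exp_ofReal_mul_I_le (x : ℝ) : ‖Complex.exp ((x : ℂ) * Complex.I)‖ ≤ 1 :=
  (Complex.norm_exp_ofReal_mul_I x).le

variable {ρ : Measure (ℝ × ℝ)}

theorem norm_planarCharFun_le [IsProbabilityMeasure ρ] (z : ℝ × ℝ) : ‖planarCharFun ρ z‖ ≤ 1 := by
  have := norm_integral_le_of_norm_le_const (μ := ρ)
    (ae_of_all _ fun y : ℝ × ℝ => norm_exp_ofReal_mul_I_le (z.1 * y.1 + z.2 * y.2))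
  simpa [planarCharFun] using this

theorem continuous_planarCharFun [IsProbabilityMeasure ρ] : Continuous (planarCharFun ρ) := by
  unfold planarCharFun
  refine continuous_of_dominated (bound := fun _ => 1) (fun z => ?_) (fun z => ?_)
    (integrable_const _) (ae_of_all _ fun y => ?_)
  · exact Continuous.aestronglyMeasurable (by fun_prop)
  · exact ae_of_all _ fun y => norm_exp_ofReal_mul_I_le _
  · fun_prop

/-- A mean of unit vectors has norm one only if the vectors are almost surely equal, by strict
convexity of the disc. -/
theorem ae_exp_eq_of_norm_planarCharFun_eq_one [IsProbabilityMeasure ρ] {z : ℝ × ℝ} (hz : ‖planarCharFun ρ z‖ = 1) :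
    ∀ᵐ y ∂ρ, Complex.exp (((z.1 * y.1 + z.2 * y.2 : ℝ) : ℂ) * Complex.I) = planarCharFun ρ z := by
  rcases ae_eq_const_or_norm_integral_lt_of_norm_le_const (μ := ρ) (C := 1)
    (ae_of_all _ fun y : ℝ × ℝ => norm_exp_ofReal_mul_I_le (z.1 * y.1 + z.2 * y.2)) with h | h
  · filter_upwards [h] with y hy
    rw [hy, Function.const_apply, average_eq_integral]
    rfl
  · rw [probReal_univ, one_mul] at h
    exact absurd hz h.ne

/-- If the modulus of the characteristic function is `1` along a null sequence, then the
corresponding linear combinations of the differences to some point vanish eventually. -/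
theorem exists_ae_eventually_eq_zero [IsProbabilityMeasure ρ] {w : ℕ → ℝ × ℝ} (hw : Tendsto w atTop (𝓝 0))
    (h1 : ∀ k, ‖planarCharFun ρ (w k)‖ = 1) :
    ∃ y₀ : ℝ × ℝ, ∀ᵐ y ∂ρ, ∀ᶠ k in atTop,
      (w k).1 * (y.1 - y₀.1) + (w k).2 * (y.2 - y₀.2) = 0 := by
  have hae := ae_all_iff.2 fun k => ae_exp_eq_of_norm_planarCharFun_eq_one (h1 k)
  obtain ⟨y₀, hy₀⟩ := hae.exists
  refine ⟨y₀, ?_⟩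
  filter_upwards [hae] with y hy
  have hlim : Tendsto (fun k => (w k).1 * (y.1 - y₀.1) + (w k).2 * (y.2 - y₀.2)) atTop (𝓝 0) := by
    have h2 : Tendsto (fun k => (w k).1) atTop (𝓝 0) := (continuous_fst.tendsto 0).comp hw
    have h3 : Tendsto (fun k => (w k).2) atTop (𝓝 0) := (continuous_snd.tendsto 0).comp hw
    simpa using (h2.mul_const (y.1 - y₀.1)).add (h3.mul_const (y.2 - y₀.2))
  -- The phases at y and at y₀ agree modulo 2π, and for fixed y their difference tends to zero, so
  -- it eventually vanishes exactly.
  filter_upwards [hlim.eventually (Metric.ball_mem_nhds 0 (show (0 : ℝ) < 2 * Real.pi by positivity))]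
    with k hk
  set x := (w k).1 * (y.1 - y₀.1) + (w k).2 * (y.2 - y₀.2) with hx
  rw [Real.dist_eq, sub_zero] at hk
  have hexp := (hy k).trans (hy₀ k).symm
  obtain ⟨n, hn⟩ := Complex.exp_eq_exp_iff_exists_int.1 hexp
  have hxn : x = n * (2 * Real.pi) := by
    have h5 : ((x : ℝ) : ℂ) * Complex.I = ((n * (2 * Real.pi) : ℝ) : ℂ) * Complex.I := by
      have : ((x : ℝ) : ℂ) * Complex.I
          = (((w k).1 * y.1 + (w k).2 * y.2 : ℝ) : ℂ) * Complex.I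
            - (((w k).1 * y₀.1 + (w k).2 * y₀.2 : ℝ) : ℂ) * Complex.I := by
        rw [hx]; push_cast; ring
      rw [this, hn]
      push_cast
      ring
    exact_mod_cast mul_right_cancel₀ Complex.I_ne_zero h5
  have hn0 : n = 0 := by
    rw [hxn, abs_mul, abs_of_pos (show (0 : ℝ) < 2 * Real.pi by positivity)] at hk
    have : |(n : ℝ)| < 1 := by
      have hp : (0 : ℝ) < 2 * Real.pi := by positivity
      nlinarith
    have : |n| < 1 := by exact_mod_cast this
    exact Int.abs_lt_one_iff.1 this
  rw [hxn, hn0]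
  simp

variable {b : ℕ} {σ : Measure (Fin b → ℝ)} {β γ : (Fin b → ℝ) → ℝ}

/-- A random variable whose characteristic function is that of a constant is almost surely
equal to this constant. -/
theorem ae_eq_const_of_charFun {α : Type*} [MeasurableSpace α] {m : Measure α}
    [IsProbabilityMeasure m] {f : α → ℝ} (hf : Measurable f) {c : ℝ}
    (h : ∀ t : ℝ, ∫ x, Complex.exp (((t * f x : ℝ) : ℂ) * Complex.I) ∂m
      = Complex.exp (((t * c : ℝ) : ℂ) * Complex.I)) : ∀ᵐ x ∂m, f x = c := by
  have : IsProbabilityMeasure (m.map f) := Measure.isProbabilityMeasure_map hf.aemeasurable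
  have hmap : m.map f = Measure.dirac c := by
    refine Measure.ext_of_charFun (funext fun t => ?_)
    rw [charFun_dirac, charFun_apply_real, integral_map hf.aemeasurable
      (Continuous.aestronglyMeasurable (by fun_prop))]
    have := h t
    push_cast at this
    rw [this]
    simp [mul_comm]
  have h1 : ∀ᵐ y ∂(m.map f), y = c := by
    rw [hmap, ae_dirac_eq]
    simp
  exact ae_of_ae_map hf.aemeasurable h1

theorem norm_integrand_eq (z : ℝ × ℝ) (v : Fin b → ℝ) :
    ‖Complex.exp (((z.1 * β v + z.2 * γ v : ℝ) : ℂ) * Complex.I) *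
      ∏ j, planarCharFun ρ (dilate₂ (v j) z)‖ = ∏ j, ‖planarCharFun ρ (dilate₂ (v j) z)‖ := by
  rw [norm_mul, Complex.norm_exp_ofReal_mul_I, one_mul, norm_prod]

theorem norm_planarCharFun_le_integral
    (hfix : ∀ z : ℝ × ℝ, planarCharFun ρ z
      = ∫ v, Complex.exp (((z.1 * β v + z.2 * γ v : ℝ) : ℂ) * Complex.I) *
          ∏ j, planarCharFun ρ (dilate₂ (v j) z) ∂σ) (z : ℝ × ℝ) :
    ‖planarCharFun ρ z‖ ≤ ∫ v, ∏ j, ‖planarCharFun ρ (dilate₂ (v j) z)‖ ∂σ := by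
  rw [hfix z]
  refine (norm_integral_le_integral_norm _).trans (le_of_eq ?_)
  exact integral_congr_ae (ae_of_all _ fun v => norm_integrand_eq z v)

theorem integrable_prod_norm_planarCharFun [IsProbabilityMeasure ρ] [IsProbabilityMeasure σ] (z : ℝ × ℝ) :
    Integrable (fun v : Fin b → ℝ => ∏ j, ‖planarCharFun ρ (dilate₂ (v j) z)‖) σ := by
  refine Integrable.of_bound (C := 1) (Continuous.aestronglyMeasurable ?_) (ae_of_all _ fun v => ?_)
  · exact continuous_finsetProd _ fun j _ => (continuous_planarCharFun.comp
      ((continuous_dilate₂ z).comp (continuous_apply j))).norm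
  · rw [Real.norm_eq_abs, abs_of_nonneg (Finset.prod_nonneg fun i _ => norm_nonneg _)]
    exact Finset.prod_le_one (fun i _ => norm_nonneg _) fun i _ => norm_planarCharFun_le _

/-- The modulus at z is bounded by the mean of a product of factors at most 1. If it is 1, the
product is almost surely 1, and so is each factor. -/
theorem ae_norm_dilate_eq_one [IsProbabilityMeasure ρ] [IsProbabilityMeasure σ]
    (hfix : ∀ z : ℝ × ℝ, planarCharFun ρ z
      = ∫ v, Complex.exp (((z.1 * β v + z.2 * γ v : ℝ) : ℂ) * Complex.I) *
          ∏ j, planarCharFun ρ (dilate₂ (v j) z) ∂σ) {z : ℝ × ℝ} (hz : ‖planarCharFun ρ z‖ = 1) :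
    ∀ᵐ v ∂σ, ∀ j, ‖planarCharFun ρ (dilate₂ (v j) z)‖ = 1 := by
  have hintg := integrable_prod_norm_planarCharFun (ρ := ρ) (σ := σ) z
  have h1 : ∀ v : Fin b → ℝ, ∏ j, ‖planarCharFun ρ (dilate₂ (v j) z)‖ ≤ 1 := fun v =>
    Finset.prod_le_one (fun i _ => norm_nonneg _) fun i _ => norm_planarCharFun_le _
  have h2 : ∫ v, (1 - ∏ j, ‖planarCharFun ρ (dilate₂ (v j) z)‖) ∂σ = 0 := by
    refine le_antisymm ?_ (integral_nonneg fun v => sub_nonneg.2 (h1 v))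
    rw [integral_sub (integrable_const _) hintg]
    have := norm_planarCharFun_le_integral hfix z
    simp only [integral_const, probReal_univ, smul_eq_mul, mul_one]
    linarith
  rw [integral_eq_zero_iff_of_nonneg (fun v => sub_nonneg.2 (h1 v))
    ((integrable_const _).sub hintg)] at h2
  filter_upwards [h2] with v hv j
  refine le_antisymm (norm_planarCharFun_le _) ?_
  have h3 : ∏ j, ‖planarCharFun ρ (dilate₂ (v j) z)‖ = 1 := by
    have : 1 - ∏ j, ‖planarCharFun ρ (dilate₂ (v j) z)‖ = 0 := hv
    linarith
  rw [← h3]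
  exact prod_le_of_mem_unitInterval (fun i => norm_nonneg _) (fun i => norm_planarCharFun_le _) j

/-- The property of having modulus one passes to almost every random dilate. A fixed coordinate is
at most some κ < 1 with positive probability, so repeated dilation shrinks the point geometrically.
-/
theorem exists_null_sequence_dilates [IsProbabilityMeasure ρ] [IsProbabilityMeasure σ] (hb : 2 ≤ b) (hσ1 : ∀ᵐ v ∂σ, ∀ j, 0 < v j ∧ v j < 1)
    (hfix : ∀ z : ℝ × ℝ, planarCharFun ρ z
      = ∫ v, Complex.exp (((z.1 * β v + z.2 * γ v : ℝ) : ℂ) * Complex.I) *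
          ∏ j, planarCharFun ρ (dilate₂ (v j) z) ∂σ) {z : ℝ × ℝ} (hz : ‖planarCharFun ρ z‖ = 1) :
    ∃ w : ℕ → ℝ, (∀ k, 0 < w k) ∧ Tendsto w atTop (𝓝 0) ∧
      ∀ k, ‖planarCharFun ρ (dilate₂ (w k) z)‖ = 1 := by
  let j₀ : Fin b := ⟨0, by omega⟩
  obtain ⟨κ, hκ1, hκ⟩ : ∃ κ : ℝ, κ < 1 ∧ ∃ᵐ v ∂σ, v j₀ ≤ κ := by
    by_contra! hcon
    have h1 : ∀ k : ℕ, ∀ᵐ v ∂σ, 1 - 1 / ((k : ℝ) + 1) < v j₀ := fun k => by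
      have := hcon (1 - 1 / ((k : ℝ) + 1)) (by
        have : (0 : ℝ) < 1 / ((k : ℝ) + 1) := by positivity
        linarith)
      simpa only [Filter.not_frequently, not_le] using this
    obtain ⟨v, hv1, hv⟩ := (hσ1.and (ae_all_iff.2 h1)).exists
    have h2 : (1 : ℝ) ≤ v j₀ := by
      have h3 := (tendsto_one_div_add_atTop_nhds_zero_nat (𝕜 := ℝ)).const_sub 1
      rw [sub_zero] at h3
      exact le_of_tendsto' h3 fun k => (hv k).le
    exact absurd h2 (not_le.2 (hv1 j₀).2)
  have hκ0 : 0 < κ := by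
    obtain ⟨v, hv1, hv2⟩ := (hκ.and_eventually hσ1).exists
    exact (hv2 j₀).1.trans_le hv1
  have key : ∀ k : ℕ, ∃ w : ℝ, 0 < w ∧ w ≤ κ ^ k ∧ ‖planarCharFun ρ (dilate₂ w z)‖ = 1 := by
    intro k
    induction k with
    | zero => exact ⟨1, one_pos, by simp, by simpa [dilate₂] using hz⟩
    | succ k ih =>
      obtain ⟨w, hw0, hwk, hw⟩ := ih
      obtain ⟨v, hv, hv1, hv2⟩ :=
        (hκ.and_eventually (hσ1.and (ae_norm_dilate_eq_one hfix hw))).exists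
      refine ⟨w * v j₀, mul_pos hw0 (hv1 j₀).1, ?_, ?_⟩
      · rw [pow_succ]
        exact mul_le_mul hwk hv (hv1 j₀).1.le (by positivity)
      · have := hv2 j₀
        have e : dilate₂ (v j₀) (dilate₂ w z) = dilate₂ (w * v j₀) z := by
          simp only [dilate₂]
          ext <;> simp <;> ring
        rwa [e] at this
  choose w hw0 hwk hw using key
  exact ⟨w, hw0, squeeze_zero (fun k => (hw0 k).le) hwk
    (tendsto_pow_atTop_nhds_zero_of_lt_one hκ0.le hκ1), hw⟩

/-- Under the two non-degeneracy conditions, the characteristic function has modulus less than `1`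
away from the origin. -/
theorem norm_planarCharFun_lt_one [IsProbabilityMeasure ρ] [IsProbabilityMeasure σ] (hb : 2 ≤ b) (hσ : ∀ᵐ v ∂σ, v ∈ stdSimplex ℝ (Fin b))
    (hσ1 : ∀ᵐ v ∂σ, ∀ j, 0 < v j ∧ v j < 1)
    (hβ : Measurable β) (hγ : Measurable γ)
    (hfix : ∀ z : ℝ × ℝ, planarCharFun ρ z
      = ∫ v, Complex.exp (((z.1 * β v + z.2 * γ v : ℝ) : ℂ) * Complex.I) *
          ∏ j, planarCharFun ρ (dilate₂ (v j) z) ∂σ)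
    (hndγ : ¬ ∀ᵐ v ∂σ, γ v = 0)
    (hndβ : ∀ c : ℝ, ¬ ∀ᵐ v ∂σ, β v + c * ∑ j, v j ^ 2 = c) {z : ℝ × ℝ} (hz : z ≠ 0) :
    ‖planarCharFun ρ z‖ < 1 := by
  refine lt_of_le_of_ne (norm_planarCharFun_le z) fun hz1 => ?_
  obtain ⟨w, hw0, hw, hw1⟩ := exists_null_sequence_dilates hb hσ1 hfix hz1
  have hwz : Tendsto (fun k => dilate₂ (w k) z) atTop (𝓝 0) := by
    have := ((continuous_dilate₂ z).tendsto 0).comp hw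
    have e : dilate₂ 0 z = 0 := by ext <;> simp [dilate₂]
    rwa [e] at this
  obtain ⟨y₀, hy₀⟩ := exists_ae_eventually_eq_zero hwz hw1
  -- Along the dilates the first coordinate of z carries w², the second only w. If z.2 ≠ 0, the
  -- second dominates and forces the second marginal of ρ to be constant; otherwise the first
  -- marginal is constant.
  by_cases ht : z.2 = 0
  · have hs : z.1 ≠ 0 := fun hs => hz (Prod.ext hs ht)
    have hconst : ∀ᵐ y ∂ρ, y.1 = y₀.1 := by
      filter_upwards [hy₀] with y hy
      obtain ⟨k, hk⟩ := hy.exists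
      simp only [dilate₂, ht, zero_mul, add_zero, mul_eq_zero, pow_eq_zero_iff two_ne_zero, hs,
        (hw0 k).ne', false_or] at hk
      linarith
    have hcf : ∀ s : ℝ, planarCharFun ρ (s, 0) = Complex.exp (((s * y₀.1 : ℝ) : ℂ) * Complex.I) := by
      intro s
      unfold planarCharFun
      rw [integral_congr_ae (g := fun _ => Complex.exp (((s * y₀.1 : ℝ) : ℂ) * Complex.I))]
      · simp
      · filter_upwards [hconst] with y hy
        simp [hy]
    -- With the first marginal equal to the constant c, the fixed point equation reads c = β(V) + c
    -- ∑ V_j² almost surely.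
    refine hndβ y₀.1 (ae_eq_const_of_charFun (f := fun v => β v + y₀.1 * ∑ j, v j ^ 2)
      (by fun_prop) fun t => ?_)
    have := hfix (t, 0)
    rw [hcf] at this
    rw [this]
    refine integral_congr_ae (ae_of_all _ fun v => ?_)
    simp only [dilate₂, zero_mul, add_zero, hcf]
    rw [← Complex.exp_sum, ← Complex.exp_add]
    congr 1
    push_cast
    rw [← Finset.sum_mul, ← Finset.sum_mul, ← Finset.mul_sum]
    ring
  · have hconst : ∀ᵐ y ∂ρ, y.2 = y₀.2 := by
      filter_upwards [hy₀] with y hy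
      -- One factor w k > 0 is cancelled, after which the remaining w k sends the first term to
      -- zero.
      have h1 : ∀ᶠ k in atTop, z.1 * w k * (y.1 - y₀.1) + z.2 * (y.2 - y₀.2) = 0 := by
        filter_upwards [hy] with k hk
        have : w k * (z.1 * w k * (y.1 - y₀.1) + z.2 * (y.2 - y₀.2)) = 0 := by
          rw [← hk]
          simp only [dilate₂]
          ring
        exact (mul_eq_zero.1 this).resolve_left (hw0 k).ne'
      have h2 : Tendsto (fun k => z.1 * w k * (y.1 - y₀.1) + z.2 * (y.2 - y₀.2)) atTop
          (𝓝 (z.1 * 0 * (y.1 - y₀.1) + z.2 * (y.2 - y₀.2))) :=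
        ((hw.const_mul z.1).mul_const _).add_const _
      have h3 := tendsto_nhds_unique h2 (tendsto_const_nhds.congr' (h1.mono fun k hk => hk.symm))
      simp only [mul_zero, zero_mul, zero_add, mul_eq_zero, ht, false_or] at h3
      linarith
    have hcf : ∀ t : ℝ, planarCharFun ρ (0, t) = Complex.exp (((t * y₀.2 : ℝ) : ℂ) * Complex.I) := by
      intro s
      unfold planarCharFun
      rw [integral_congr_ae (g := fun _ => Complex.exp (((s * y₀.2 : ℝ) : ℂ) * Complex.I))]
      · simp
      · filter_upwards [hconst] with y hy
        simp [hy]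
    refine hndγ (ae_eq_const_of_charFun hγ fun t => ?_)
    have := hfix (0, t)
    rw [hcf] at this
    -- Since ∑ V_j = 1, the constant second marginal cancels from the fixed point equation and only
    -- γ(V) = 0 remains.
    have h4 : ∫ v, Complex.exp (((t * γ v : ℝ) : ℂ) * Complex.I) *
        Complex.exp (((t * y₀.2 : ℝ) : ℂ) * Complex.I) ∂σ
          = Complex.exp (((t * y₀.2 : ℝ) : ℂ) * Complex.I) := by
      refine Eq.trans (integral_congr_ae ?_) this.symm
      filter_upwards [hσ] with v hv
      simp only [dilate₂, zero_mul, zero_add, hcf]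
      rw [← Complex.exp_sum]
      congr 2
      push_cast
      rw [← Finset.sum_mul, ← Finset.sum_mul, ← Finset.mul_sum]
      have : (∑ j, (v j : ℂ)) = 1 := by exact_mod_cast hv.2
      rw [this]
      ring
    rw [integral_mul_const] at h4
    have := mul_eq_right₀ (Complex.exp_ne_zero _) |>.1 h4
    rw [this]
    simp

end PlanarCharFun

/-! ### Smooth densities from rapidly decaying characteristic functions -/

section Density

open Topology FourierTransform SchwartzMap
open scoped ContDiff RealInnerProductSpace

variable {E : Type*} [NormedAddCommGroup E] [InnerProductSpace ℝ E] [FiniteDimensional ℝ E]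
  [MeasurableSpace E] [BorelSpace E]

/-- A test function pairs with a finite measure as with the inverse Fourier transform of the
Fourier transform of the measure. -/
theorem integral_schwartz_eq_integral_mul_fourier {ρ : Measure E} [IsFiniteMeasure ρ]
    (hintg : Integrable (fun ξ : E => ∫ x, 𝐞 ⟪x, ξ⟫ • (1 : ℂ) ∂ρ)) (h : 𝓢(E, ℂ)) :
    ∫ x, h x ∂ρ = ∫ x, h x * 𝓕 (fun ξ : E => ∫ x, 𝐞 ⟪x, ξ⟫ • (1 : ℂ) ∂ρ) x := by
  have hL : Continuous fun p : E × E => innerₗ E p.1 p.2 := continuous_inner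
  -- Writing h as the Fourier transform of its inverse transform moves the transform onto ρ. A
  -- second application of the same duality below moves it back onto the integrable transform of ρ.
  have h1 := VectorFourier.integral_fourierIntegral_smul_eq_flip (μ := (volume : Measure E)) (ν := ρ)
    (L := innerₗ E) (f := (𝓕⁻ h : 𝓢(E, ℂ))) (g := fun _ => (1 : ℂ)) Real.continuous_fourierChar hL
    (𝓕⁻ h : 𝓢(E, ℂ)).integrable (integrable_const _)
  have h2 : ∀ ξ, VectorFourier.fourierIntegral 𝐞 volume (innerₗ E) ((𝓕⁻ h : 𝓢(E, ℂ)) : E → ℂ) ξ = h ξ := by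
    intro ξ
    have : (𝓕 (𝓕⁻ h : 𝓢(E, ℂ)) : 𝓢(E, ℂ)) = h := FourierTransform.fourier_fourierInv_eq h
    conv_rhs => rw [← this]
    rfl
  simp only [h2, smul_eq_mul, mul_one] at h1
  rw [h1]
  have h3 : ∀ x, ((𝓕⁻ h : 𝓢(E, ℂ)) : E → ℂ) x = 𝓕 (h : E → ℂ) (-x) := fun x => by
    rw [fourierInv_coe]
    exact Real.fourierInv_eq_fourier_neg _ _
  simp only [h3]
  -- The reflection turns the inverse transform of h into its transform and reverses the sign in the
  -- transform of ρ to the stated one.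
  rw [← integral_neg_eq_self]
  simp only [neg_neg]
  have h4 := VectorFourier.integral_fourierIntegral_smul_eq_flip (μ := (volume : Measure E))
    (ν := (volume : Measure E)) (L := innerₗ E) (f := (h : E → ℂ))
    (g := fun ξ : E => ∫ x, 𝐞 ⟪x, ξ⟫ • (1 : ℂ) ∂ρ) Real.continuous_fourierChar hL
    h.integrable hintg
  rw [flip_innerₗ] at h4
  simp only [smul_eq_mul] at h4
  refine Eq.trans (integral_congr_ae (ae_of_all _ fun x => ?_)) h4
  simp only
  congr 1
  simp only [VectorFourier.fourierIntegral, LinearMap.flip_apply, map_neg,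
    innerₗ_apply_apply, neg_neg, real_inner_comm]

/-- Every open set is the support of a smooth g with values in [0, 1], and 1 - (1 - g)^n increases
to its indicator. For a bounded open set these functions are compactly supported test functions.
Exhaustion by balls and the π-system of open sets do the rest. -/
theorem measure_eq_of_integral_contDiff_eq {μ ν : Measure E} [IsFiniteMeasure μ]
    [IsFiniteMeasureOnCompacts ν]
    (h : ∀ g : E → ℝ, ContDiff ℝ ∞ g → HasCompactSupport g → ∫ x, g x ∂μ = ∫ x, g x ∂ν) :
    μ = ν := by
  have hbdd : ∀ s : Set E, IsOpen s → Bornology.IsBounded s → μ s = ν s := by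
    intro s hs hsb
    obtain ⟨g, hgs, hgc, hgr⟩ := hs.exists_contDiff_support_eq (n := ⊤)
    have hg01 : ∀ x, 0 ≤ g x ∧ g x ≤ 1 := fun x => hgr ⟨x, rfl⟩
    have hνs : ν s < ⊤ := (measure_mono subset_closure).trans_lt
      hsb.isCompact_closure.measure_lt_top
    have hlim : ∀ m : Measure E, m s < ⊤ →
        Tendsto (fun n : ℕ => ∫ x, (1 - (1 - g x) ^ n) ∂m) atTop (𝓝 (m.real s)) := by
      intro m hm
      rw [← integral_indicator_one hs.measurableSet]
      refine tendsto_integral_of_dominated_convergence (s.indicator 1)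
        (fun n => Continuous.aestronglyMeasurable ?_) ?_ (fun n => ae_of_all _ fun x => ?_)
        (ae_of_all _ fun x => ?_)
      · have := hgc.continuous
        fun_prop
      · exact (integrable_indicator_iff hs.measurableSet).2 (integrableOn_const hm.ne)
      · by_cases hx : x ∈ s
        · rw [Set.indicator_of_mem hx, Real.norm_eq_abs, Pi.one_apply]
          have h1 : 0 ≤ (1 - g x) ^ n := pow_nonneg (by linarith [(hg01 x).2]) n
          have h2 : (1 - g x) ^ n ≤ 1 := pow_le_one₀ (by linarith [(hg01 x).2])
            (by linarith [(hg01 x).1])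
          rw [abs_of_nonneg] <;> linarith
        · have : g x = 0 := by
            rw [← hgs] at hx
            simpa using hx
          simp [this, hx]
      · by_cases hx : x ∈ s
        · have hgx : 0 < g x := lt_of_le_of_ne (hg01 x).1 (Ne.symm (by rw [← hgs] at hx; exact hx))
          have := tendsto_pow_atTop_nhds_zero_of_lt_one (r := 1 - g x)
            (by linarith [(hg01 x).2]) (by linarith)
          simpa [hx] using this.const_sub 1
        · have : g x = 0 := by
            rw [← hgs] at hx
            simpa using hx
          simp [this, hx]
    have hreal : μ.real s = ν.real s := by
      refine tendsto_nhds_unique (hlim μ (measure_lt_top _ _)) ((hlim ν hνs).congr fun n => ?_)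
      refine (h _ ?_ ?_).symm
      · fun_prop
      · refine HasCompactSupport.of_support_subset_isCompact hsb.isCompact_closure ?_
        intro x hx
        refine subset_closure ?_
        rw [← hgs]
        intro hgx
        exact hx (by simp [hgx])
    exact (ENNReal.toReal_eq_toReal_iff' (measure_ne_top _ _) hνs.ne).1 hreal
  have hopen : ∀ s : Set E, IsOpen s → μ s = ν s := by
    intro s hs
    have hmono : Monotone fun n : ℕ => s ∩ Metric.ball (0 : E) n := fun n m hnm =>
      Set.inter_subset_inter_right _ (Metric.ball_subset_ball (by exact_mod_cast hnm))
    have hU : ⋃ n : ℕ, s ∩ Metric.ball (0 : E) n = s := by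
      rw [← Set.inter_iUnion, Metric.iUnion_ball_nat, Set.inter_univ]
    have h1 := tendsto_measure_iUnion_atTop (μ := μ) hmono
    have h2 := tendsto_measure_iUnion_atTop (μ := ν) hmono
    rw [hU] at h1 h2
    refine tendsto_nhds_unique h1 (h2.congr fun n => ?_)
    exact (hbdd _ (hs.inter Metric.isOpen_ball)
      (Metric.isBounded_ball.subset Set.inter_subset_right)).symm
  refine ext_of_generate_finite _ BorelSpace.measurable_eq
    isPiSystem_isOpen (fun s hs => hopen s hs) (hopen _ isOpen_univ)

/-- The density is the real part of the Fourier transform of the characteristic function. Moments of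
the latter give smoothness, its L¹ norm gives the bound, and pairing with test functions identifies
the measure. -/
theorem exists_smooth_density {ρ : Measure E} [IsFiniteMeasure ρ]
    (hintg : ∀ k : ℕ, Integrable (fun ξ : E => ‖ξ‖ ^ k * ‖∫ x, 𝐞 ⟪x, ξ⟫ • (1 : ℂ) ∂ρ‖))
    (hm : AEStronglyMeasurable (fun ξ : E => ∫ x, 𝐞 ⟪x, ξ⟫ • (1 : ℂ) ∂ρ) volume) :
    ∃ f : E → ℝ, ContDiff ℝ ∞ f ∧ (∀ x, 0 ≤ f x) ∧ (∃ M, ∀ x, f x ≤ M) ∧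
      ρ = volume.withDensity fun x => ENNReal.ofReal (f x) := by
  set Φ : E → ℂ := fun ξ => ∫ x, 𝐞 ⟪x, ξ⟫ • (1 : ℂ) ∂ρ with hΦ
  have hΦint : Integrable Φ := by
    rw [← integrable_norm_iff hm]
    simpa using hintg 0
  have hsm : ContDiff ℝ ∞ (𝓕 Φ) := by
    have := Real.contDiff_fourier (f := Φ) (N := ⊤) fun n _ => hintg n
    exact this
  have hcont : Continuous (𝓕 Φ) := hsm.continuous
  set f : E → ℝ := fun x => (𝓕 Φ x).re with hf
  have hfsm : ContDiff ℝ ∞ f := Complex.reCLM.contDiff.comp hsm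
  have hpair : ∀ g : E → ℝ, ContDiff ℝ ∞ g → HasCompactSupport g →
      ∫ x, g x ∂ρ = ∫ x, g x * f x := by
    intro g hg hgc
    have hgs : HasCompactSupport fun x => (g x : ℂ) := hgc.comp_left (g := Complex.ofReal) rfl
    have : ∫ x, (g x : ℂ) ∂ρ = ∫ x, (g x : ℂ) * 𝓕 Φ x :=
      integral_schwartz_eq_integral_mul_fourier hΦint
        (hgs.toSchwartzMap (Complex.ofRealCLM.contDiff.comp hg))
    have hre := congrArg Complex.re this
    rw [integral_complex_ofReal, Complex.ofReal_re] at hre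
    rw [hre, ← RCLike.re_eq_complex_re, ← integral_re]
    · refine integral_congr_ae (ae_of_all _ fun x => ?_)
      simp [hf, hΦ]
    · refine Continuous.integrable_of_hasCompactSupport ?_ hgs.mul_right
      have := hg.continuous
      exact (Complex.continuous_ofReal.comp this).mul hcont
  -- Were f negative at a point, a bump function supported where f < 0 would have negative integral
  -- against the positive measure ρ.
  have hpos : ∀ x, 0 ≤ f x := by
    intro x₀
    by_contra! hneg
    obtain ⟨δ, hδ, hball⟩ := Metric.eventually_nhds_iff_ball.1
      ((hfsm.continuous.tendsto x₀).eventually (gt_mem_nhds hneg))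
    let φ : ContDiffBump x₀ := ⟨δ / 2, δ, by linarith, by linarith⟩
    have h1 := hpair φ φ.contDiff φ.hasCompactSupport
    have h2 : 0 ≤ ∫ x, φ x ∂ρ := integral_nonneg fun x => φ.nonneg
    have h3 : 0 < ∫ x, φ x * (-f x) := by
      refine Continuous.integral_pos_of_hasCompactSupport_nonneg_nonzero
        (φ.continuous.mul hfsm.continuous.neg) φ.hasCompactSupport.mul_right (fun x => ?_)
        (x := x₀) ?_
      · by_cases hx : x ∈ Metric.ball x₀ δ
        · exact mul_nonneg φ.nonneg (by linarith [hball x hx])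
        · have : φ x = 0 := by
            rw [← Function.notMem_support, φ.support_eq]
            exact hx
          simp [this]
      · have : φ x₀ = 1 := φ.one_of_mem_closedBall (by simpa [φ] using (half_pos hδ).le)
        rw [this]
        simpa using hneg.ne
    simp only [mul_neg, integral_neg] at h3
    linarith
  refine ⟨f, hfsm, hpos, ⟨∫ ξ, ‖Φ ξ‖, fun x => ?_⟩, ?_⟩
  · exact (Complex.re_le_norm _).trans (VectorFourier.norm_fourierIntegral_le_integral_norm _ _ _ _ _)
  · have hfm : Measurable fun x => ENNReal.ofReal (f x) := hfsm.continuous.measurable.ennreal_ofReal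
    have : IsLocallyFiniteMeasure (volume.withDensity fun x => ENNReal.ofReal (f x)) :=
      IsLocallyFiniteMeasure.withDensity_ofReal hfsm.continuous
    refine measure_eq_of_integral_contDiff_eq fun g hg hgc => ?_
    rw [hpair g hg hgc, integral_withDensity_eq_integral_toReal_smul hfm (by simp)]
    refine integral_congr_ae (ae_of_all _ fun x => ?_)
    simp [ENNReal.toReal_ofReal (hpos x), mul_comm]

/-- Fourier inversion is applied on the complex plane, since the product ℝ × ℝ carries the supremum
norm and no inner product; the resulting density is transported back. -/
theorem hasBoundedSmoothDensity_of_rapid_decay {ρ : Measure (ℝ × ℝ)} [IsProbabilityMeasure ρ]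
    (h : ∀ k : ℕ, ∃ C, ∀ z, ‖z‖ ^ k * ‖planarCharFun ρ z‖ ≤ C) :
    SplitTree.HasBoundedSmoothDensity ρ := by
  set e := Complex.measurableEquivRealProd with he
  have hem : Measurable e.symm := e.symm.measurable
  set ρ' : Measure ℂ := ρ.map e.symm with hρ'
  have : IsProbabilityMeasure ρ' := Measure.isProbabilityMeasure_map hem.aemeasurable
  have hΦ : ∀ ξ : ℂ, ∫ x, 𝐞 ⟪x, ξ⟫ • (1 : ℂ) ∂ρ'
      = planarCharFun ρ (2 * Real.pi * ξ.re, 2 * Real.pi * ξ.im) := by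
    intro ξ
    rw [hρ', integral_map hem.aemeasurable]
    · unfold planarCharFun
      refine integral_congr_ae (ae_of_all _ fun y => ?_)
      simp only [Circle.smul_def, Real.fourierChar_apply, smul_eq_mul, mul_one, he,
        Complex.measurableEquivRealProd_symm_apply, Complex.inner, Complex.mul_re, Complex.conj_re,
        Complex.conj_im]
      congr 2
      push_cast
      ring
    · refine Continuous.aestronglyMeasurable ?_
      simp only [Circle.smul_def]
      have := Real.continuous_fourierChar
      fun_prop
  have hcont : Continuous fun ξ : ℂ => planarCharFun ρ (2 * Real.pi * ξ.re, 2 * Real.pi * ξ.im) :=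
    continuous_planarCharFun.comp (by fun_prop)
  -- The factor 2π of the Fourier normalisation exceeds the loss between the Euclidean and the
  -- supremum norm.
  have hnorm : ∀ ξ : ℂ, ‖ξ‖ ≤ ‖((2 * Real.pi * ξ.re, 2 * Real.pi * ξ.im) : ℝ × ℝ)‖ := by
    intro ξ
    have h1 := Complex.norm_le_abs_re_add_abs_im ξ
    have h2 := norm_fst_le ((2 * Real.pi * ξ.re, 2 * Real.pi * ξ.im) : ℝ × ℝ)
    have h3 := norm_snd_le ((2 * Real.pi * ξ.re, 2 * Real.pi * ξ.im) : ℝ × ℝ)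
    have hpi : (0 : ℝ) < 2 * Real.pi := by positivity
    simp only [Real.norm_eq_abs, abs_mul (2 * Real.pi), abs_of_pos hpi] at h2 h3
    have := Real.pi_gt_three
    nlinarith [abs_nonneg ξ.re, abs_nonneg ξ.im]
  have hintg : ∀ k : ℕ, Integrable fun ξ : ℂ => ‖ξ‖ ^ k * ‖∫ x, 𝐞 ⟪x, ξ⟫ • (1 : ℂ) ∂ρ'‖ := by
    intro k
    simp only [hΦ]
    obtain ⟨C₁, hC₁⟩ := h k
    -- Three extra powers suffice for integrability, the plane having real dimension 2.
    obtain ⟨C₂, hC₂⟩ := h (k + 3)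
    have hdom : Integrable fun ξ : ℂ => (4 * (C₁ + C₂)) * (1 + ‖ξ‖) ^ (-(3 : ℝ)) :=
      (integrable_one_add_norm (by norm_num [Complex.finrank_real_complex])).const_mul _
    refine hdom.mono' (by fun_prop) (ae_of_all _ fun ξ => ?_)
    set r := ‖ξ‖ with hr
    set z : ℝ × ℝ := (2 * Real.pi * ξ.re, 2 * Real.pi * ξ.im) with hz
    have hr0 : 0 ≤ r := norm_nonneg _
    have hrz : r ≤ ‖z‖ := hnorm ξ
    have h1 : r ^ k * ‖planarCharFun ρ z‖ ≤ C₁ :=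
      (mul_le_mul_of_nonneg_right (pow_le_pow_left₀ hr0 hrz k) (norm_nonneg _)).trans (hC₁ z)
    have h2 : r ^ (k + 3) * ‖planarCharFun ρ z‖ ≤ C₂ :=
      (mul_le_mul_of_nonneg_right (pow_le_pow_left₀ hr0 hrz _) (norm_nonneg _)).trans (hC₂ z)
    have hp : (0 : ℝ) < (1 + r) ^ 3 := by positivity
    rw [Real.rpow_neg (by positivity), show ((3 : ℝ)) = ((3 : ℕ) : ℝ) by norm_num,
      Real.rpow_natCast, ← div_eq_mul_inv, le_div_iff₀ hp, Real.norm_of_nonneg (by positivity)]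
    have h3 : (1 + r) ^ 3 ≤ 4 * (1 + r ^ 3) := by nlinarith [mul_nonneg hr0 (sq_nonneg (r - 1)), sq_nonneg (r - 1)]
    calc r ^ k * ‖planarCharFun ρ z‖ * (1 + r) ^ 3
        ≤ r ^ k * ‖planarCharFun ρ z‖ * (4 * (1 + r ^ 3)) :=
          mul_le_mul_of_nonneg_left h3 (by positivity)
      _ = 4 * (r ^ k * ‖planarCharFun ρ z‖ + r ^ (k + 3) * ‖planarCharFun ρ z‖) := by ring
      _ ≤ 4 * (C₁ + C₂) := by linarith
  obtain ⟨f, hf, hf0, ⟨M, hM⟩, hfρ⟩ := exists_smooth_density hintg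
    (by simp only [hΦ]; exact hcont.aestronglyMeasurable)
  refine ⟨fun z => f (Complex.equivRealProdCLM.symm z),
    hf.comp Complex.equivRealProdCLM.symm.contDiff, fun z => hf0 _, ⟨M, fun z => hM _⟩, ?_⟩
  have hback : ρ = ρ'.map e := by
    rw [hρ', Measure.map_map e.measurable hem]
    simp
  refine Measure.ext fun A hA => ?_
  rw [hback, Measure.map_apply e.measurable hA, hfρ, withDensity_apply _ (e.measurable hA),
    withDensity_apply _ hA,
    ← Complex.volume_preserving_equiv_real_prod.setLIntegral_comp_preimage_emb
      e.measurableEmbedding]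
  refine setLIntegral_congr_fun (e.measurable hA) fun x _ => ?_
  congr 2

end Density

namespace SplitTree

/-! ### Path length and Wiener index through sums of subtree sizes -/

section Combinatorics

variable {b s s₀ s₁ : ℕ}

/-- The sum of the `p`-th powers of the subtree sizes of all nodes of depth `d`. -/
def levelSum (p s s₀ s₁ : ℕ) : ℕ → (List (Fin b) → ℕ → Fin b) → ℕ → ℕ
  | 0, _, n => n ^ p
  | d + 1, r, n => ∑ j, levelSum p s s₀ s₁ d (fun w => r (j :: w)) (childSize s s₀ s₁ n (r []) j)

/-- The sum of the `p`-th powers of the subtree sizes of all nodes. -/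
noncomputable def powerSum (p s s₀ s₁ : ℕ) (r : List (Fin b) → ℕ → Fin b) (n : ℕ) : ℝ≥0∞ :=
  ∑' d, (levelSum p s s₀ s₁ d r n : ℝ≥0∞)

theorem childSize_of_le {n : ℕ} (hn : n ≤ s) (c : ℕ → Fin b) (j : Fin b) :
    childSize s s₀ s₁ n c j = 0 := if_pos hn

theorem sum_childSize (hs₁ : s₀ + b * s₁ ≤ s + 1) {n : ℕ} (hn : s < n) (c : ℕ → Fin b) :
    ∑ j, childSize s s₀ s₁ n c j + s₀ = n := by
  have h1 : ∀ j, childSize s s₀ s₁ n c j = s₁ +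
      ((Finset.range (n - (s₀ + b * s₁))).filter (fun k => c k = j)).card := fun j =>
    if_neg (not_le.2 hn)
  simp only [h1, Finset.sum_add_distrib]
  have h2 := Finset.card_eq_sum_card_fiberwise (f := c) (s := Finset.range (n - (s₀ + b * s₁)))
    (t := Finset.univ) (by simp [Set.MapsTo])
  rw [← h2]
  simp
  -- The subtraction does not truncate, because s₀ + b * s₁ ≤ s + 1 ≤ n.
  omega

theorem childSize_le (hs₁ : s₀ + b * s₁ ≤ s + 1) (n : ℕ) (c : ℕ → Fin b) (j : Fin b) :
    childSize s s₀ s₁ n c j ≤ n := by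
  rcases le_or_gt n s with hn | hn
  · rw [childSize_of_le hn]
    exact Nat.zero_le _
  · have h1 := sum_childSize hs₁ hn c
    have h2 : childSize s s₀ s₁ n c j ≤ ∑ j, childSize s s₀ s₁ n c j :=
      Finset.single_le_sum (fun _ _ => Nat.zero_le _) (Finset.mem_univ j)
    omega

theorem subtreeSize_zero (u : List (Fin b)) (r : List (Fin b) → ℕ → Fin b) :
    subtreeSize s s₀ s₁ r 0 u = 0 := by
  induction u generalizing r with
  | nil => rfl
  | cons j u ih =>
    rw [subtreeSize, childSize_of_le (Nat.zero_le _)]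
    exact ih _

theorem levelSum_zero {p : ℕ} (hp : p ≠ 0) (d : ℕ) (r : List (Fin b) → ℕ → Fin b) :
    levelSum p s s₀ s₁ d r 0 = 0 := by
  induction d generalizing r with
  | zero => simp [levelSum, hp]
  | succ d ih => simp [levelSum, childSize_of_le (Nat.zero_le s), ih]

theorem subtreeSize_eq_zero_of_levelSum_eq_zero {d : ℕ} {r : List (Fin b) → ℕ → Fin b} {n : ℕ}
    (h : levelSum 1 s s₀ s₁ d r n = 0) {u : List (Fin b)} (hu : d ≤ u.length) :
    subtreeSize s s₀ s₁ r n u = 0 := by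
  induction d generalizing r n u with
  | zero =>
    simp only [levelSum, pow_one] at h
    rw [h, subtreeSize_zero]
  | succ d ih =>
    cases u with
    | nil => simp at hu
    | cons j u =>
      simp only [levelSum, Finset.sum_eq_zero_iff, Finset.mem_univ, true_implies] at h
      rw [subtreeSize]
      exact ih (h j) (by simpa using hu)

theorem powerSum_eq (p : ℕ) (r : List (Fin b) → ℕ → Fin b) (n : ℕ) :
    powerSum p s s₀ s₁ r n = (n : ℝ≥0∞) ^ p +
      ∑ j, powerSum p s s₀ s₁ (fun w => r (j :: w)) (childSize s s₀ s₁ n (r []) j) := by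
  unfold powerSum
  rw [tsum_eq_zero_add' ENNReal.summable, ← Summable.tsum_finsetSum fun _ _ => ENNReal.summable]
  simp [levelSum]

theorem powerSum_zero {p : ℕ} (hp : p ≠ 0) (r : List (Fin b) → ℕ → Fin b) :
    powerSum p s s₀ s₁ r 0 = 0 := by
  simp [powerSum, levelSum_zero hp]

theorem powerSum_of_le {p : ℕ} (hp : p ≠ 0) (r : List (Fin b) → ℕ → Fin b) {n : ℕ} (hn : n ≤ s) :
    powerSum p s s₀ s₁ r n = (n : ℝ≥0∞) ^ p := by
  rw [powerSum_eq]
  simp [childSize_of_le hn, powerSum_zero hp]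

theorem tsum_list_eq (f : List (Fin b) → ℝ≥0∞) :
    ∑' u, f u = f [] + ∑ j, ∑' u, f (j :: u) := by
  let e : Unit ⊕ (Fin b × List (Fin b)) ≃ List (Fin b) :=
    { toFun := Sum.elim (fun _ => []) fun p => p.1 :: p.2
      invFun := fun u => match u with
        | [] => Sum.inl ()
        | j :: u => Sum.inr (j, u)
      left_inv := by rintro (_ | ⟨j, u⟩) <;> rfl
      right_inv := by rintro (_ | ⟨j, u⟩) <;> rfl }
  rw [← e.tsum_eq, Summable.tsum_sum ENNReal.summable ENNReal.summable, ENNReal.tsum_prod',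
    tsum_fintype, tsum_fintype]
  simp [e]

theorem nodeDist_cons_self (i : Fin b) (u v : List (Fin b)) :
    nodeDist (i :: u) (i :: v) = nodeDist u v := by
  simp [nodeDist, commonPrefixLength]

theorem nodeDist_cons_of_ne {i j : Fin b} (hij : i ≠ j) (u v : List (Fin b)) :
    nodeDist (i :: u) (j :: v) = (u.length + 1) + (v.length + 1) := by
  simp [nodeDist, commonPrefixLength, hij]

theorem nodeDist_nil_cons (j : Fin b) (v : List (Fin b)) :
    nodeDist [] (j :: v) = v.length + 1 := by
  simp [nodeDist, commonPrefixLength]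

theorem nodeDist_cons_nil (j : Fin b) (v : List (Fin b)) :
    nodeDist (j :: v) [] = v.length + 1 := by
  simp [nodeDist, commonPrefixLength]

theorem tsum_mul_add_one (f : List (Fin b) → ℝ≥0∞) :
    ∑' u, f u * ((u.length : ℝ≥0∞) + 1) = ∑' u, f u * (u.length : ℝ≥0∞) + ∑' u, f u := by
  rw [← ENNReal.tsum_add]
  simp only [mul_add, mul_one]

theorem tsum_tsum_mul_dist (f g : List (Fin b) → ℝ≥0∞) :
    ∑' u, ∑' v, f u * g v * (((u.length : ℝ≥0∞) + 1) + ((v.length : ℝ≥0∞) + 1))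
      = (∑' u, f u * ((u.length : ℝ≥0∞) + 1)) * ∑' v, g v
        + (∑' u, f u) * ∑' v, g v * ((v.length : ℝ≥0∞) + 1) := by
  have h1 : ∀ u v : List (Fin b), f u * g v * (((u.length : ℝ≥0∞) + 1) + ((v.length : ℝ≥0∞) + 1))
      = (f u * ((u.length : ℝ≥0∞) + 1)) * g v + f u * (g v * ((v.length : ℝ≥0∞) + 1)) := by
    intro u v; ring
  simp only [h1, ENNReal.tsum_add, ENNReal.tsum_mul_left, ENNReal.tsum_mul_right]

/-- In a finite tree, the total number of items, the path length and the Wiener index are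
determined by the sums of the powers of the subtree sizes. -/
theorem tsum_identities (hs₁ : s₀ + b * s₁ ≤ s + 1) (d : ℕ) :
    ∀ (r : List (Fin b) → ℕ → Fin b) (n : ℕ),
      (∀ u : List (Fin b), d ≤ u.length → subtreeSize s s₀ s₁ r n u = 0) →
      (∑' u, (nodeItems s s₀ s₁ r n u : ℝ≥0∞) = n) ∧ powerSum 1 s s₀ s₁ r n ≠ ⊤ ∧
      (∑' u, (nodeItems s s₀ s₁ r n u : ℝ≥0∞) * (u.length : ℝ≥0∞) + n = powerSum 1 s s₀ s₁ r n) ∧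
      (∑' u, ∑' v, (nodeItems s s₀ s₁ r n u : ℝ≥0∞) * (nodeItems s s₀ s₁ r n v : ℝ≥0∞)
          * (nodeDist u v : ℝ≥0∞) + 2 * powerSum 2 s s₀ s₁ r n
        = 2 * (n * powerSum 1 s s₀ s₁ r n)) := by
  induction d with
  | zero =>
    intro r n h
    have hn : n = 0 := h [] (Nat.zero_le _)
    subst hn
    simp [nodeItems, subtreeSize_zero, powerSum_zero]
  | succ d ih =>
    intro r n h
    set I : Fin b → ℕ := childSize s s₀ s₁ n (r []) with hI
    set R : Fin b → List (Fin b) → ℕ → Fin b := fun j w => r (j :: w) with hR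
    have hsub : ∀ j, _ := fun j => ih (R j) (I j) fun u hu => h (j :: u) (by simpa using hu)
    set n₀ : ℕ := nodeItems s s₀ s₁ r n [] with hn₀
    have hitems : ∀ j u, nodeItems s s₀ s₁ r n (j :: u) = nodeItems s s₀ s₁ (R j) (I j) u :=
      fun j u => rfl
    have hsum : n₀ + ∑ j, I j = n := by
      rcases le_or_gt n s with hn | hn
      · have : n₀ = n := by
          exact if_pos hn
        simp [this, hI, childSize_of_le hn]
      · have : n₀ = s₀ := by
          exact if_neg (not_le.2 hn)
        rw [this, add_comm]
        exact sum_childSize hs₁ hn _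
    have hsum' : (n₀ : ℝ≥0∞) + ∑ j, (I j : ℝ≥0∞) = n := by exact_mod_cast congrArg Nat.cast hsum
    choose hA hB hC hD using hsub
    have hT1 := powerSum_eq (s := s) (s₀ := s₀) (s₁ := s₁) 1 r n
    have hT2 := powerSum_eq (s := s) (s₀ := s₀) (s₁ := s₁) 2 r n
    rw [pow_one] at hT1
    have hE : ∀ j, ∑' u, (nodeItems s s₀ s₁ (R j) (I j) u : ℝ≥0∞) * ((u.length : ℝ≥0∞) + 1)
        = powerSum 1 s s₀ s₁ (R j) (I j) := fun j => by
      rw [tsum_mul_add_one, hA, hC]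
    refine ⟨?_, ?_, ?_, ?_⟩
    · rw [tsum_list_eq]
      simp only [hitems, hA]
      exact hsum'
    · rw [hT1]
      exact ENNReal.add_ne_top.2 ⟨ENNReal.natCast_ne_top n, ENNReal.sum_ne_top.2 fun j _ => hB j⟩
    · rw [tsum_list_eq, hT1]
      simp only [hitems, List.length_nil, Nat.cast_zero, mul_zero, zero_add, List.length_cons,
        Nat.cast_add, Nat.cast_one, hE]
      rw [add_comm]
    · set t1 : Fin b → ℝ≥0∞ := fun j => powerSum 1 s s₀ s₁ (R j) (I j) with ht1
      set t2 : Fin b → ℝ≥0∞ := fun j => powerSum 2 s s₀ s₁ (R j) (I j) with ht2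
      set w : Fin b → ℝ≥0∞ := fun j => ∑' u, ∑' v, (nodeItems s s₀ s₁ (R j) (I j) u : ℝ≥0∞) *
        (nodeItems s s₀ s₁ (R j) (I j) v : ℝ≥0∞) * (nodeDist u v : ℝ≥0∞) with hw
      have hD' : ∀ j, w j + 2 * t2 j = 2 * (I j * t1 j) := hD
      -- Finiteness allows w to be added on both sides and cancelled, which replaces subtraction in
      -- the extended nonnegative reals.
      have hwfin : ∀ j, w j ≠ ⊤ := fun j => by
        have : w j + 2 * t2 j ≠ ⊤ := by
          rw [hD']
          exact ENNReal.mul_ne_top (by simp) (ENNReal.mul_ne_top (ENNReal.natCast_ne_top _) (hB j))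
        exact (ENNReal.add_ne_top.1 this).1
      have hnil : ∑' v, (n₀ : ℝ≥0∞) * (nodeItems s s₀ s₁ r n v : ℝ≥0∞) * (nodeDist [] v : ℝ≥0∞)
          = n₀ * ∑ j, t1 j := by
        rw [tsum_list_eq]
        simp only [hitems, nodeDist_nil_cons, mul_assoc, Nat.cast_add, Nat.cast_one,
          ENNReal.tsum_mul_left, hE]
        simp [nodeDist, commonPrefixLength, ht1, Finset.mul_sum]
      set D : Fin b → Fin b → ℝ≥0∞ := fun i j => ∑' u, ∑' v,
        (nodeItems s s₀ s₁ (R i) (I i) u : ℝ≥0∞) * (nodeItems s s₀ s₁ (R j) (I j) v : ℝ≥0∞) *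
          (nodeDist (i :: u) (j :: v) : ℝ≥0∞) with hDdef
      have hDs : ∀ i, D i i = w i := fun i => by simp only [hDdef, nodeDist_cons_self, hw]
      have hDne : ∀ i j, i ≠ j → D i j = t1 i * I j + I i * t1 j := fun i j hij => by
        simp only [hDdef, nodeDist_cons_of_ne hij, Nat.cast_add, Nat.cast_one]
        rw [tsum_tsum_mul_dist, hE, hE, hA, hA]
      have hcons : ∀ i, ∑' u, ∑' v, (nodeItems s s₀ s₁ r n (i :: u) : ℝ≥0∞) *
          (nodeItems s s₀ s₁ r n v : ℝ≥0∞) * (nodeDist (i :: u) v : ℝ≥0∞)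
          = n₀ * t1 i + ∑ j, D i j := by
        intro i
        have h1 : ∀ u : List (Fin b), ∑' v, (nodeItems s s₀ s₁ r n (i :: u) : ℝ≥0∞) *
            (nodeItems s s₀ s₁ r n v : ℝ≥0∞) * (nodeDist (i :: u) v : ℝ≥0∞)
            = n₀ * ((nodeItems s s₀ s₁ (R i) (I i) u : ℝ≥0∞) * ((u.length : ℝ≥0∞) + 1))
              + ∑ j, ∑' v, (nodeItems s s₀ s₁ (R i) (I i) u : ℝ≥0∞) *
                (nodeItems s s₀ s₁ (R j) (I j) v : ℝ≥0∞) * (nodeDist (i :: u) (j :: v) : ℝ≥0∞) := by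
          intro u
          rw [tsum_list_eq]
          simp only [hitems, nodeDist_cons_nil, Nat.cast_add, Nat.cast_one, ← hn₀]
          ring
        simp only [h1, ENNReal.tsum_add, ENNReal.tsum_mul_left, hE]
        rw [Summable.tsum_finsetSum fun _ _ => ENNReal.summable]
      rw [tsum_list_eq]
      simp only [hcons, ← hn₀, hnil]
      -- Items in different child subtrees are joined through the root, so their distance is the sum
      -- of both depths. The diagonal blocks lack these terms, and 2 * (I i * t1 i) is what is
      -- missing there.
      have hDI : ∑ i, ∑ j, D i j + ∑ i, 2 * (I i * t1 i)
          = ∑ i, w i + 2 * ((∑ i, (I i : ℝ≥0∞)) * ∑ i, t1 i) := by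
        have h1 : ∀ i, ∑ j, D i j + 2 * (I i * t1 i) = w i + ∑ j, (t1 i * I j + I i * t1 j) := by
          intro i
          rw [← Finset.add_sum_erase _ _ (Finset.mem_univ i),
            ← Finset.add_sum_erase _ (fun j => t1 i * (I j : ℝ≥0∞) + I i * t1 j) (Finset.mem_univ i),
            hDs, Finset.sum_congr rfl fun j hj => hDne i j (Finset.ne_of_mem_erase hj).symm]
          ring
        rw [← Finset.sum_add_distrib]
        simp only [h1]
        rw [Finset.sum_add_distrib]
        congr 1
        simp only [Finset.sum_add_distrib, ← Finset.mul_sum, ← Finset.sum_mul]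
        ring
      rw [← ENNReal.add_right_inj (ENNReal.sum_ne_top.2 fun j _ => hwfin j : ∑ j, w j ≠ ⊤)]
      have hDsum : ∑ j, w j + 2 * ∑ j, t2 j = ∑ j, 2 * (I j * t1 j) := by
        rw [Finset.mul_sum, ← Finset.sum_add_distrib]
        exact Finset.sum_congr rfl fun j _ => hD' j
      rw [hT1, hT2, Finset.sum_add_distrib]
      change ∑ j, w j + (n₀ * ∑ j, t1 j + (∑ j, n₀ * t1 j + ∑ i, ∑ j, D i j)
        + 2 * ((n : ℝ≥0∞) ^ 2 + ∑ j, t2 j)) = ∑ j, w j + 2 * (n * (n + ∑ j, t1 j))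
      calc _ = 2 * (n₀ * ∑ j, t1 j) + 2 * (n : ℝ≥0∞) ^ 2
            + (∑ i, ∑ j, D i j + (∑ j, w j + 2 * ∑ j, t2 j)) := by
              rw [← Finset.mul_sum]; ring
        _ = ∑ j, w j + 2 * (n * n + (n₀ + ∑ j, (I j : ℝ≥0∞)) * ∑ j, t1 j) := by
              rw [hDsum, hDI]; ring
        _ = _ := by rw [hsum']; ring

theorem levelSum_two_le (hs₁ : s₀ + b * s₁ ≤ s + 1) (d : ℕ) (r : List (Fin b) → ℕ → Fin b) (n : ℕ) :
    levelSum 2 s s₀ s₁ d r n ≤ n * levelSum 1 s s₀ s₁ d r n := by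
  induction d generalizing r n with
  | zero => simp [levelSum, sq]
  | succ d ih =>
    simp only [levelSum, Finset.mul_sum]
    exact Finset.sum_le_sum fun j _ => (ih _ _).trans
      (Nat.mul_le_mul_right _ (childSize_le hs₁ n _ j))

/-- No subtree is larger than the whole tree, so one factor of each square is at most n;
integrability of the quadratic sum follows from that of the linear one. -/
theorem powerSum_two_le (hs₁ : s₀ + b * s₁ ≤ s + 1) (r : List (Fin b) → ℕ → Fin b) (n : ℕ) :
    powerSum 2 s s₀ s₁ r n ≤ n * powerSum 1 s s₀ s₁ r n := by
  unfold powerSum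
  rw [← ENNReal.tsum_mul_left]
  exact ENNReal.tsum_le_tsum fun d => by exact_mod_cast levelSum_two_le hs₁ d r n

/-- The terms of a convergent series tend to zero, and a natural number below 1 is 0. So a finite
sum of subtree sizes means a tree of finite height, as the induction in `tsum_identities` requires.
-/
theorem exists_levelSum_eq_zero {r : List (Fin b) → ℕ → Fin b} {n : ℕ}
    (h : powerSum 1 s s₀ s₁ r n ≠ ⊤) : ∃ d, levelSum 1 s s₀ s₁ d r n = 0 := by
  have h1 := (ENNReal.tendsto_cofinite_zero_of_tsum_ne_top h)
  rw [Nat.cofinite_eq_atTop] at h1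
  obtain ⟨d, hd⟩ := ((ENNReal.tendsto_nhds_zero.1 h1) (1 / 2) (by simp)).exists
  refine ⟨d, ?_⟩
  by_contra hne
  have h2 : (1 : ℝ≥0∞) ≤ levelSum 1 s s₀ s₁ d r n := by
    exact_mod_cast Nat.one_le_iff_ne_zero.2 hne
  have h3 := h2.trans hd
  rw [one_div] at h3
  exact absurd h3 (not_le.2 ENNReal.one_half_lt_one)

theorem pathLength_eq (hs₁ : s₀ + b * s₁ ≤ s + 1) {r : List (Fin b) → ℕ → Fin b} {n : ℕ}
    (h : powerSum 1 s s₀ s₁ r n ≠ ⊤) :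
    pathLength s s₀ s₁ r n = (powerSum 1 s s₀ s₁ r n).toReal - n := by
  obtain ⟨d, hd⟩ := exists_levelSum_eq_zero h
  obtain ⟨-, -, h1, -⟩ := tsum_identities hs₁ d r n fun u hu =>
    subtreeSize_eq_zero_of_levelSum_eq_zero hd hu
  have h2 : ∑' u, (nodeItems s s₀ s₁ r n u : ℝ≥0∞) * (u.length : ℝ≥0∞) ≠ ⊤ := by
    rw [← h1] at h
    exact (ENNReal.add_ne_top.1 h).1
  rw [← h1, ENNReal.toReal_add h2 (ENNReal.natCast_ne_top n), ENNReal.toReal_natCast,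
    add_sub_cancel_right, ENNReal.tsum_toReal_eq]
  · simp [pathLength]
  · exact fun u => ENNReal.mul_ne_top (ENNReal.natCast_ne_top _) (ENNReal.natCast_ne_top _)

theorem wienerIndex_eq (hs₁ : s₀ + b * s₁ ≤ s + 1) {r : List (Fin b) → ℕ → Fin b} {n : ℕ}
    (h : powerSum 1 s s₀ s₁ r n ≠ ⊤) :
    wienerIndex s s₀ s₁ r n
      = n * (powerSum 1 s s₀ s₁ r n).toReal - (powerSum 2 s s₀ s₁ r n).toReal := by
  obtain ⟨d, hd⟩ := exists_levelSum_eq_zero h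
  obtain ⟨-, -, -, h1⟩ := tsum_identities hs₁ d r n fun u hu =>
    subtreeSize_eq_zero_of_levelSum_eq_zero hd hu
  rw [← ENNReal.tsum_prod' (f := fun p : List (Fin b) × List (Fin b) =>
    (nodeItems s s₀ s₁ r n p.1 : ℝ≥0∞) * (nodeItems s s₀ s₁ r n p.2 : ℝ≥0∞)
      * (nodeDist p.1 p.2 : ℝ≥0∞))] at h1
  have h3 : 2 * (n * powerSum 1 s s₀ s₁ r n) ≠ ⊤ :=
    ENNReal.mul_ne_top (by simp) (ENNReal.mul_ne_top (ENNReal.natCast_ne_top _) h)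
  have h4 := h3
  rw [← h1] at h4
  have h5 := congrArg ENNReal.toReal h1
  rw [ENNReal.toReal_add (ENNReal.add_ne_top.1 h4).1 (ENNReal.add_ne_top.1 h4).2,
    ENNReal.tsum_toReal_eq] at h5
  · simp only [ENNReal.toReal_mul, ENNReal.toReal_natCast, ENNReal.toReal_ofNat] at h5
    unfold wienerIndex
    linarith
  · exact fun u => ENNReal.mul_ne_top (ENNReal.mul_ne_top (ENNReal.natCast_ne_top _)
      (ENNReal.natCast_ne_top _)) (ENNReal.natCast_ne_top _)

end Combinatorics

end SplitTree

/-! ### Independence of blocks and laws of sequences. -/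

/-- Disjoint blocks of an independent family are independent. -/
theorem iIndepFun_sigma_blocks {Ω ι 𝓧 : Type*} {κ : ι → Type*} [MeasurableSpace Ω]
    [MeasurableSpace 𝓧] {P : Measure Ω} {X : (Σ i, κ i) → Ω → 𝓧} (hX : ∀ p, Measurable (X p))
    (h : iIndepFun X P) : iIndepFun (fun i ω (j : κ i) => X ⟨i, j⟩ ω) P := by
  have := h.isProbabilityMeasure
  have : ∀ p, IsProbabilityMeasure (P.map (X p)) := fun p =>
    Measure.isProbabilityMeasure_map (hX p).aemeasurable
  rw [iIndepFun_iff_map_fun_eq_infinitePi_map (by fun_prop)]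
  -- Independence means a product law, and currying turns the product over all pairs into a product
  -- of block products.
  have h1 : P.map (fun ω i (j : κ i) => X ⟨i, j⟩ ω)
      = (P.map fun ω p => X p ω).map (MeasurableEquiv.piCurry fun i (_ : κ i) => 𝓧) := by
    rw [Measure.map_map (MeasurableEquiv.measurable _) (by fun_prop)]
    rfl
  rw [h1, (iIndepFun_iff_map_fun_eq_infinitePi_map hX).1 h,
    Measure.infinitePi_map_piCurry fun i (j : κ i) => P.map (X ⟨i, j⟩)]
  congr 1
  funext i
  rw [(iIndepFun_iff_map_fun_eq_infinitePi_map (by fun_prop)).1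
    (h.precomp (g := fun j : κ i => (⟨i, j⟩ : Σ i, κ i)) sigma_mk_injective)]

/-- Two finite measures on sequences in a finite set that agree on cylinders are equal. -/
theorem measure_sequence_ext {α : Type*} [Fintype α] [MeasurableSpace α]
    [MeasurableSingletonClass α] {μ ν : Measure (ℕ → α)} [IsFiniteMeasure μ] [IsFiniteMeasure ν]
    (h : ∀ (m : ℕ) (i : Fin m → α), μ {x | ∀ k : Fin m, x k = i k} = ν {x | ∀ k : Fin m, x k = i k}) :
    μ = ν := by
  have h1 : ∀ m : ℕ, μ.map (fun x (k : Fin m) => x k) = ν.map (fun x (k : Fin m) => x k) := by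
    intro m
    have hm : Measurable fun (x : ℕ → α) (k : Fin m) => x k := by fun_prop
    refine Measure.ext_of_singleton fun i => ?_
    rw [Measure.map_apply hm (measurableSet_singleton i),
      Measure.map_apply hm (measurableSet_singleton i)]
    have : (fun (x : ℕ → α) (k : Fin m) => x k) ⁻¹' {i} = {x | ∀ k : Fin m, x k = i k} := by
      ext x; simp [funext_iff]
    rw [this, h]
  -- Every finite set of coordinates lies in an initial segment, so the cylinders determine all
  -- finite marginals.
  refine IsProjectiveLimit.unique (P := fun I : Finset ℕ => ν.map I.restrict) (fun I => ?_)
    (fun I => rfl)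
  obtain ⟨m, hm⟩ : ∃ m, ∀ k ∈ I, k < m := ⟨I.sup id + 1, fun k hk =>
    Nat.lt_succ_of_le (Finset.le_sup (f := id) hk)⟩
  let g : (Fin m → α) → (I → α) := fun y k => y ⟨k, hm k k.2⟩
  have hg : Measurable g := by fun_prop
  have e : (I.restrict : (ℕ → α) → (I → α)) = g ∘ fun x (k : Fin m) => x k := rfl
  change μ.map I.restrict = ν.map I.restrict
  rw [e, ← Measure.map_map hg (by fun_prop), ← Measure.map_map hg (by fun_prop), h1]

/-! ### Self-similarity of the routing and the conditional law of the choices at a node. -/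

namespace SplitTree

namespace IsRouting

set_option linter.unusedSectionVars false

variable {b : ℕ} {Ω : Type*} [MeasurableSpace Ω] {P : Measure Ω} [IsProbabilityMeasure P]
  {σ : Measure (Fin b → ℝ)} [IsProbabilityMeasure σ] {V : List (Fin b) → Ω → (Fin b → ℝ)}
  {J : List (Fin b) → ℕ → Ω → Fin b}

section Blocks

theorem measurable_choices (hJ : IsRouting P σ V J) (u : List (Fin b)) :
    Measurable fun ω k => J u k ω :=
  measurable_pi_lambda _ fun k => hJ.measurable_choice u k

theorem measurable_route (hJ : IsRouting P σ V J) : Measurable fun ω u k => J u k ω :=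
  measurable_pi_lambda _ fun u => hJ.measurable_choices u

theorem measurable_subroute (hJ : IsRouting P σ V J) (j : Fin b) :
    Measurable fun ω (u : List (Fin b)) k => J (j :: u) k ω :=
  measurable_pi_lambda _ fun u => hJ.measurable_choices (j :: u)

theorem iIndepFun_choices (hJ : IsRouting P σ V J) :
    iIndepFun (fun (u : List (Fin b)) ω k => J u k ω) P :=
  hJ.indep.comp (fun _ => Prod.snd) fun _ => measurable_snd

theorem map_choices (hJ : IsRouting P σ V J) (u v : List (Fin b)) :
    P.map (fun ω k => J u k ω) = P.map (fun ω k => J v k ω) := by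
  have : ∀ u, IsProbabilityMeasure (P.map (fun ω k => J u k ω)) := fun u =>
    Measure.isProbabilityMeasure_map (hJ.measurable_choices u).aemeasurable
  refine measure_sequence_ext fun m i => ?_
  have hm : MeasurableSet {x : ℕ → Fin b | ∀ k : Fin m, x k = i k} := by
    have : {x : ℕ → Fin b | ∀ k : Fin m, x k = i k} = ⋂ k : Fin m, {x | x k = i k} := by
      ext; simp
    rw [this]
    exact MeasurableSet.iInter fun k => measurable_pi_apply _ (measurableSet_singleton _)
  have h1 : ∀ u, P.map (fun ω k => J u k ω) {x | ∀ k : Fin m, x k = i k}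
      = ∫⁻ v, ∏ k : Fin m, ENNReal.ofReal (v (i k)) ∂σ := fun u => by
    rw [Measure.map_apply (hJ.measurable_choices u) hm]
    simpa using hJ.law u m i Set.univ MeasurableSet.univ
  rw [h1, h1]

/-- Both sides are product laws with equal factors. This is the self-similarity of the split tree:
each subtree of the root is driven by choices distributed like those of the whole tree. -/
theorem map_subroute (hJ : IsRouting P σ V J) (j : Fin b) :
    P.map (fun ω (u : List (Fin b)) k => J (j :: u) k ω) = P.map (fun ω u k => J u k ω) := by
  rw [(iIndepFun_iff_map_fun_eq_infinitePi_map hJ.measurable_choices).1 hJ.iIndepFun_choices,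
    (iIndepFun_iff_map_fun_eq_infinitePi_map fun u => hJ.measurable_choices (j :: u)).1
      (hJ.iIndepFun_choices.precomp (g := fun u => j :: u) fun u v h => (List.cons.inj h).2)]
  congr 1
  funext u
  exact hJ.map_choices _ _

/-- The choices at the root and the routes in the subtrees are independent. -/
theorem iIndepFun_root_subroutes (hJ : IsRouting P σ V J) {β : Option (Fin b) → Type*}
    [∀ o, MeasurableSpace (β o)] (g : (ℕ → Fin b) → β none)
    (h : ∀ j : Fin b, (List (Fin b) → ℕ → Fin b) → β (some j)) (hg : Measurable g)
    (hh : ∀ j, Measurable (h j)) :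
    iIndepFun (fun (o : Option (Fin b)) (ω : Ω) => (match o with
      | none => g fun k => J [] k ω
      | some j => h j fun u k => J (j :: u) k ω : β o)) P := by
  -- The nodes are partitioned into the root (index `none`) and the b subtrees below it (index `some
  -- j`), each subtree being a copy of the set of all words.
  let κ : Option (Fin b) → Type := fun o => o.elim Unit fun _ => List (Fin b)
  let f : (Σ o, κ o) → List (Fin b) := fun p => match p with
    | ⟨none, _⟩ => []
    | ⟨some j, u⟩ => j :: u
  have hf : Function.Injective f := by
    rintro ⟨_ | i, u⟩ ⟨_ | j, v⟩ huv
    · rfl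
    · simp [f] at huv
    · simp [f] at huv
    · obtain ⟨rfl, h2⟩ := List.cons.inj huv
      have : u = v := h2
      rw [this]
  have h1 := iIndepFun_sigma_blocks (κ := κ) (X := fun p ω k => J (f p) k ω)
    (fun p => hJ.measurable_choices (f p)) (hJ.iIndepFun_choices.precomp hf)
  let G : ∀ o, (κ o → ℕ → Fin b) → β o := fun o => match o with
    | none => fun y => g (y ())
    | some j => fun y => h j y
  have h2 := h1.comp G fun o => by
    cases o with
    | none => exact hg.comp (measurable_pi_apply (() : κ none))
    | some j => exact hh j
  refine h2.congr fun o => ae_of_all _ fun ω => ?_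
  cases o <;> rfl

theorem indepFun_root_subroute (hJ : IsRouting P σ V J) (j : Fin b) :
    IndepFun (fun ω k => J [] k ω) (fun ω (u : List (Fin b)) k => J (j :: u) k ω) P := by
  have h1 := hJ.iIndepFun_root_subroutes (β := fun _ => List (Fin b) → ℕ → Fin b) (fun c _ => c)
    (fun _ r => r) (by fun_prop) fun _ => measurable_id
  have h2 := h1.indepFun (i := none) (j := some j) (by simp)
  have hm : Measurable fun r : List (Fin b) → ℕ → Fin b => r [] := measurable_pi_apply _
  exact h2.comp hm measurable_id

/-- Mean of a function of the choices at the root and of the route in one subtree. -/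
theorem lintegral_root_subroute (hJ : IsRouting P σ V J) (j : Fin b)
    {N : (ℕ → Fin b) → ℕ} (hN : Measurable N) {F : ℕ → (List (Fin b) → ℕ → Fin b) → ℝ≥0∞}
    (hF : ∀ n, Measurable (F n)) :
    ∫⁻ ω, F (N fun k => J [] k ω) (fun u k => J (j :: u) k ω) ∂P
      = ∫⁻ ω, (∫⁻ ω', F (N fun k => J [] k ω) (fun u k => J u k ω') ∂P) ∂P := by
  have hind := hJ.indepFun_root_subroute j
  have hF2 : Measurable fun p : ℕ × (List (Fin b) → ℕ → Fin b) => F p.1 p.2 :=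
    measurable_from_prod_countable_right hF
  have hm0 := hJ.measurable_choices []
  have hmj := hJ.measurable_subroute j
  have hind2 := hind.comp hN measurable_id
  have hmap := (indepFun_iff_map_prod_eq_prod_map_map (hN.comp hm0).aemeasurable
    hmj.aemeasurable).1 hind2
  have e1 : ∫⁻ ω, F (N fun k => J [] k ω) (fun u k => J (j :: u) k ω) ∂P
      = ∫⁻ p, F p.1 p.2 ∂(P.map fun ω => (N fun k => J [] k ω, fun (u : List (Fin b)) k => J (j :: u) k ω)) := by
    exact (lintegral_map hF2 ((hN.comp hm0).prodMk hmj)).symm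
  rw [e1]
  have e2 : P.map (fun ω => (N fun k => J [] k ω, fun (u : List (Fin b)) k => J (j :: u) k ω))
    = (P.map (fun ω => N fun k => J [] k ω)).prod (P.map fun ω u k => J u k ω) := by
    rw [← hJ.map_subroute j]
    exact hmap
  have : IsProbabilityMeasure (P.map fun ω u k => J u k ω) :=
    Measure.isProbabilityMeasure_map hJ.measurable_route.aemeasurable
  have hNm : Measurable fun ω => N fun k => J [] k ω := hN.comp hm0
  rw [e2, lintegral_prod _ hF2.aemeasurable, lintegral_map hF2.lintegral_prod_right' hNm]
  refine lintegral_congr fun ω => ?_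
  rw [lintegral_map (hF _) hJ.measurable_route]

/-- Mean of a product of a function of the choices at the root and of functions of the routes in
the subtrees. -/
theorem integral_root_mul_prod_subroutes (hJ : IsRouting P σ V J) {g : (ℕ → Fin b) → ℂ}
    {h : Fin b → (List (Fin b) → ℕ → Fin b) → ℂ} (hg : Measurable g) (hh : ∀ j, Measurable (h j)) :
    ∫ ω, g (fun k => J [] k ω) * ∏ j, h j (fun u k => J (j :: u) k ω) ∂P
      = (∫ ω, g (fun k => J [] k ω) ∂P) * ∏ j, ∫ ω, h j (fun u k => J u k ω) ∂P := by
  have h1 := hJ.iIndepFun_root_subroutes (β := fun _ => ℂ) g h hg hh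
  have h2 := h1.integral_fun_prod_eq_prod_integral fun o => by
    cases o with
    | none => exact (hg.comp (hJ.measurable_choices [])).aestronglyMeasurable
    | some j => exact ((hh j).comp (hJ.measurable_subroute j)).aestronglyMeasurable
  simp only [Fintype.prod_option] at h2
  rw [h2]
  congr 1
  refine Finset.prod_congr rfl fun j _ => ?_
  have e1 := integral_map (μ := P) (hJ.measurable_subroute j).aemeasurable
    (hh j).aestronglyMeasurable
  have e2 := integral_map (μ := P) hJ.measurable_route.aemeasurable
    (hh j).aestronglyMeasurable
  rw [hJ.map_subroute j] at e1
  exact e1.symm.trans e2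

end Blocks

section Root

/-- The law of the split vector on the event that the first choices are prescribed. -/
theorem map_restrict_vector (hJ : IsRouting P σ V J) (u : List (Fin b)) (m : ℕ)
    (i : Fin m → Fin b) :
    (P.restrict {ω | ∀ k : Fin m, J u k ω = i k}).map (V u)
      = σ.withDensity fun v => ∏ k : Fin m, ENNReal.ofReal (v (i k)) := by
  refine Measure.ext fun A hA => ?_
  rw [Measure.map_apply (hJ.measurable_vector u) hA,
    Measure.restrict_apply (hJ.measurable_vector u hA), withDensity_apply _ hA,
    ← hJ.law u m i A hA]
  rfl

theorem map_vector (hJ : IsRouting P σ V J) (u : List (Fin b)) : P.map (V u) = σ := by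
  have := hJ.map_restrict_vector u 0 Fin.elim0
  simpa using this

theorem ae_vector (hJ : IsRouting P σ V J) (u : List (Fin b)) {p : (Fin b → ℝ) → Prop}
    (hp : ∀ᵐ v ∂σ, p v) : ∀ᵐ ω ∂P, p (V u ω) := by
  rw [← hJ.map_vector u] at hp
  exact ae_of_ae_map (hJ.measurable_vector u).aemeasurable hp

theorem integral_vector (hJ : IsRouting P σ V J) (u : List (Fin b)) {g : (Fin b → ℝ) → ℝ}
    (hg : AEStronglyMeasurable g σ) : ∫ ω, g (V u ω) ∂P = ∫ v, g v ∂σ := by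
  rw [← hJ.map_vector u] at hg ⊢
  exact (integral_map (hJ.measurable_vector u).aemeasurable hg).symm

theorem measurableSet_choices_eq (hJ : IsRouting P σ V J) (u : List (Fin b)) (m : ℕ)
    (i : Fin m → Fin b) : MeasurableSet {ω | ∀ k : Fin m, J u k ω = i k} := by
  have : {ω | ∀ k : Fin m, J u k ω = i k} = ⋂ k : Fin m, {ω | J u k ω = i k} := by ext; simp
  rw [this]
  exact MeasurableSet.iInter fun k => hJ.measurable_choice u k (measurableSet_singleton _)

theorem setIntegral_vector (hJ : IsRouting P σ V J) (hσ : ∀ᵐ v ∂σ, v ∈ stdSimplex ℝ (Fin b))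
    (u : List (Fin b)) (m : ℕ) (i : Fin m → Fin b) {g : (Fin b → ℝ) → ℝ} (hg : Measurable g) :
    ∫ ω in {ω | ∀ k : Fin m, J u k ω = i k}, g (V u ω) ∂P
      = ∫ v, (∏ k : Fin m, v (i k)) * g v ∂σ := by
  rw [← integral_map (hJ.measurable_vector u).aemeasurable hg.aestronglyMeasurable,
    hJ.map_restrict_vector, integral_withDensity_eq_integral_toReal_smul (by fun_prop)]
  · refine integral_congr_ae ?_
    filter_upwards [hσ] with v hv
    simp only [ENNReal.toReal_prod, smul_eq_mul]
    congr 1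
    exact Finset.prod_congr rfl fun k _ => ENNReal.toReal_ofReal (hv.1 _)
  · exact ae_of_all _ fun v => ENNReal.prod_lt_top fun k _ => ENNReal.ofReal_lt_top

theorem integral_eq_sum_choices (hJ : IsRouting P σ V J) (u : List (Fin b)) (m : ℕ) {f : Ω → ℝ}
    (hf : Integrable f P) :
    ∫ ω, f ω ∂P = ∑ i : Fin m → Fin b, ∫ ω in {ω | ∀ k : Fin m, J u k ω = i k}, f ω ∂P := by
  rw [← integral_iUnion_fintype (fun i => hJ.measurableSet_choices_eq u m i) ?_
    fun i => hf.integrableOn]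
  · have : ⋃ i : Fin m → Fin b, {ω | ∀ k : Fin m, J u k ω = i k} = Set.univ := by
      ext ω
      simp only [Set.mem_iUnion, Set.mem_ofPred_eq, Set.mem_univ, iff_true]
      exact ⟨fun k => J u k ω, fun k => rfl⟩
    rw [this, setIntegral_univ]
  · intro i i' hne
    refine Set.disjoint_left.2 fun ω h1 h2 => hne (funext fun k => ?_)
    exact (h1 k).symm.trans (h2 k)

/-- Given the split vector and the first `m` choices, the next choice is `j` with probability
`V_j`. -/
theorem integral_choice_eq (hJ : IsRouting P σ V J) (hσ : ∀ᵐ v ∂σ, v ∈ stdSimplex ℝ (Fin b))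
    (u : List (Fin b)) (m : ℕ) (j : Fin b) {g : (Fin b → ℝ) → (Fin m → Fin b) → ℝ}
    (hg : ∀ i, Measurable fun v => g v i) {C : ℝ}
    (hC : ∀ v ∈ stdSimplex ℝ (Fin b), ∀ i, |g v i| ≤ C) :
    ∫ ω, g (V u ω) (fun k => J u k ω) * (if J u m ω = j then 1 else 0) ∂P
      = ∫ ω, g (V u ω) (fun k => J u k ω) * V u ω j ∂P := by
  have hgm : Measurable fun ω => g (V u ω) (fun k : Fin m => J u k ω) := by
    have h1 : Measurable fun p : (Fin b → ℝ) × (Fin m → Fin b) => g p.1 p.2 :=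
      measurable_from_prod_countable_left hg
    exact h1.comp ((hJ.measurable_vector u).prodMk
      (measurable_pi_lambda _ fun k => hJ.measurable_choice u k))
  have hind : Measurable fun ω => (if J u m ω = j then (1 : ℝ) else 0) :=
    Measurable.ite (hJ.measurable_choice u m (measurableSet_singleton j)) measurable_const
      measurable_const
  have hVm : Measurable fun ω => V u ω j := (measurable_pi_apply j).comp (hJ.measurable_vector u)
  have hVs := hJ.ae_vector u hσ
  have hint1 : Integrable (fun ω => g (V u ω) (fun k => J u k ω) * (if J u m ω = j then 1 else 0)) P := by
    refine Integrable.of_bound (C := C) (hgm.mul hind).aestronglyMeasurable ?_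
    filter_upwards [hVs] with ω hω
    have := hC _ hω fun k => J u k ω
    rw [norm_mul, Real.norm_eq_abs]
    split_ifs
    · simpa using this
    · simpa using (abs_nonneg _).trans this
  have hint2 : Integrable (fun ω => g (V u ω) (fun k => J u k ω) * V u ω j) P := by
    refine Integrable.of_bound (C := C) (hgm.mul hVm).aestronglyMeasurable ?_
    filter_upwards [hVs] with ω hω
    have := hC _ hω fun k => J u k ω
    rw [norm_mul, Real.norm_eq_abs, Real.norm_eq_abs, abs_of_nonneg (hω.1 j)]
    have h1 : V u ω j ≤ 1 := (mem_Icc_of_mem_stdSimplex hω j).2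
    exact (mul_le_of_le_one_right (abs_nonneg _) h1).trans this
  rw [hJ.integral_eq_sum_choices u m hint1, hJ.integral_eq_sum_choices u m hint2]
  refine Finset.sum_congr rfl fun i _ => ?_
  -- The indicator of the next choice lengthens the prescribed word by j, and the law of the choices
  -- then supplies the extra factor v j.
  have e1 : ∫ ω in {ω | ∀ k : Fin m, J u k ω = i k},
      g (V u ω) (fun k => J u k ω) * (if J u m ω = j then 1 else 0) ∂P
      = ∫ ω in {ω | ∀ k : Fin (m + 1), J u k ω = (Fin.snoc i j : Fin (m + 1) → Fin b) k},
          g (V u ω) i ∂P := by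
    rw [← integral_indicator (hJ.measurableSet_choices_eq u m i),
      ← integral_indicator (hJ.measurableSet_choices_eq u (m + 1) _)]
    refine integral_congr_ae (ae_of_all _ fun ω => ?_)
    simp only [Set.indicator_apply, Set.mem_ofPred_eq, Fin.forall_fin_succ', Fin.snoc_castSucc,
      Fin.snoc_last, Fin.val_castSucc, Fin.val_last]
    by_cases h1 : ∀ k : Fin m, J u k ω = i k
    · have h2 : (fun k : Fin m => J u k ω) = i := funext h1
      by_cases h3 : J u m ω = j
      · simp [h1, h3]
      · simp [h3]
    · simp [h1]
  have e2 : ∫ ω in {ω | ∀ k : Fin m, J u k ω = i k}, g (V u ω) (fun k => J u k ω) * V u ω j ∂P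
      = ∫ ω in {ω | ∀ k : Fin m, J u k ω = i k}, g (V u ω) i * V u ω j ∂P := by
    refine setIntegral_congr_fun (hJ.measurableSet_choices_eq u m i) fun ω hω => ?_
    have h2 : (fun k : Fin m => J u k ω) = i := funext hω
    simp only [h2]
  rw [e1, e2, hJ.setIntegral_vector hσ u _ _ (hg i),
    hJ.setIntegral_vector hσ u m i (g := fun v => g v i * v j) ((hg i).mul (measurable_pi_apply j))]
  refine integral_congr_ae (ae_of_all _ fun v => ?_)
  simp only [Fin.prod_univ_castSucc, Fin.snoc_castSucc, Fin.snoc_last]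
  ring

end Root

end IsRouting

end SplitTree

/-! ### Sizes of the subtrees of the root. -/

namespace SplitTree

/-- The properties of the sizes `I n j` of the subtrees of the root of a split tree with `n` items
that determine the asymptotics of means: `V` is the split vector of the root. -/
structure SizeModel {b : ℕ} {Ω : Type*} [MeasurableSpace Ω] (P : Measure Ω) (s s₀ : ℕ) (K : ℝ)
    (V : Ω → Fin b → ℝ) (I : ℕ → Fin b → Ω → ℕ) : Prop where
  measurable_vector : Measurable V
  measurable_size : ∀ n j, Measurable (I n j)
  mem_simplex : ∀ᵐ ω ∂P, V ω ∈ stdSimplex ℝ (Fin b)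
  pos_lt_one : ∀ᵐ ω ∂P, ∀ j, 0 < V ω j ∧ V ω j < 1
  null_singleton : ∀ j (x : ℝ), P {ω | V ω j = x} = 0
  size_le : ∀ n j ω, I n j ω ≤ n
  sum_size : ∀ n ω, s < n → ∑ j, I n j ω + s₀ = n
  K_nonneg : 0 ≤ K
  mean_dist : ∀ n j, ∫ ω, |(I n j ω : ℝ) - n * V ω j| ∂P ≤ √n + K
  self_le : ∀ n, s < n → ∑ j, P.real {ω | I n j ω = n} ≤ ∫ ω, ∑ j, V ω j ^ 2 ∂P
  increment : ∀ n, s < n → ∀ j (f : ℕ → ℝ), ∫ ω, f (I (n + 1) j ω) ∂P - ∫ ω, f (I n j ω) ∂P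
    = ∫ ω, (f (I n j ω + 1) - f (I n j ω)) * V ω j ∂P

theorem measurable_filter_card {b : ℕ} (m : ℕ) (j : Fin b) :
    Measurable fun c : ℕ → Fin b => ((Finset.range m).filter fun k => c k = j).card := by
  simp only [Finset.card_filter]
  exact Finset.measurable_sum _ fun k _ => Measurable.ite
    ((measurableSet_singleton j).preimage (measurable_pi_apply k)) measurable_const measurable_const

theorem measurable_childSize {b : ℕ} (s s₀ s₁ n : ℕ) (j : Fin b) :
    Measurable fun c : ℕ → Fin b => childSize s s₀ s₁ n c j := by
  unfold childSize
  split_ifs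
  · exact measurable_const
  · exact (measurable_filter_card _ j).const_add s₁

namespace IsRouting

set_option linter.unusedSectionVars false

variable {b : ℕ} {Ω : Type*} [MeasurableSpace Ω] {P : Measure Ω} [IsProbabilityMeasure P]
  {σ : Measure (Fin b → ℝ)} [IsProbabilityMeasure σ] {V : List (Fin b) → Ω → (Fin b → ℝ)}
  {J : List (Fin b) → ℕ → Ω → Fin b}

theorem card_filter_range_succ (c : ℕ → Fin b) (m : ℕ) (j : Fin b) :
    ((Finset.range (m + 1)).filter fun k => c k = j).card
      = ((Finset.range m).filter fun k => c k = j).card + if c m = j then 1 else 0 := by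
  simp only [Finset.card_filter, Finset.sum_range_succ]

theorem card_filter_range_eq (c : ℕ → Fin b) (m : ℕ) (j : Fin b) :
    ((Finset.range m).filter fun k => c k = j).card
      = ∑ k : Fin m, if c k = j then 1 else 0 := by
  rw [Finset.card_filter, Finset.sum_range]

/-- The quadratic deviation of the number of items sent to the `j`-th child. -/
theorem integral_sq_card_sub_le (hJ : IsRouting P σ V J) (hσ : ∀ᵐ v ∂σ, v ∈ stdSimplex ℝ (Fin b))
    (j : Fin b) (m : ℕ) :
    ∫ ω, ((((Finset.range m).filter fun k => J [] k ω = j).card : ℝ) - m * V [] ω j) ^ 2 ∂P ≤ m := by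
  have hVs := hJ.ae_vector [] hσ
  have hVm : Measurable fun ω => V [] ω j := (measurable_pi_apply j).comp (hJ.measurable_vector [])
  have hcm : ∀ m : ℕ, Measurable fun ω => (((Finset.range m).filter fun k => J [] k ω = j).card : ℝ) :=
    fun m => measurable_from_nat.comp ((measurable_filter_card m j).comp (hJ.measurable_choices []))
  have hYm : ∀ m : ℕ, Measurable fun ω =>
      (((Finset.range m).filter fun k => J [] k ω = j).card : ℝ) - m * V [] ω j :=
    fun m => (hcm m).sub (hVm.const_mul _)
  have hYb : ∀ m : ℕ, ∀ᵐ ω ∂P,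
      |(((Finset.range m).filter fun k => J [] k ω = j).card : ℝ) - m * V [] ω j| ≤ m := by
    intro m
    filter_upwards [hVs] with ω hω
    have h1 := mem_Icc_of_mem_stdSimplex hω j
    have h2 : (((Finset.range m).filter fun k => J [] k ω = j).card : ℝ) ≤ m := by
      exact_mod_cast (Finset.card_filter_le _ _).trans (Finset.card_range m).le
    have h3 : (0 : ℝ) ≤ (((Finset.range m).filter fun k => J [] k ω = j).card : ℝ) := by positivity
    have h4 : (m : ℝ) * V [] ω j ≤ m := mul_le_of_le_one_right (by positivity) h1.2
    have h5 : (0 : ℝ) ≤ m * V [] ω j := mul_nonneg (by positivity) h1.1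
    rw [abs_le]
    constructor <;> linarith
  induction m with
  | zero => simp
  | succ m ih =>
    set Y : Ω → ℝ := fun ω => (((Finset.range m).filter fun k => J [] k ω = j).card : ℝ) - m * V [] ω j
      with hY
    set ξ : Ω → ℝ := fun ω => if J [] m ω = j then 1 else 0 with hξ
    have hξm : Measurable ξ := Measurable.ite
      (hJ.measurable_choice [] m (measurableSet_singleton j)) measurable_const measurable_const
    have hξ01 : ∀ ω, 0 ≤ ξ ω ∧ ξ ω ≤ 1 := fun ω => by
      simp only [hξ]; split_ifs <;> norm_num
    have hYint : Integrable Y P := Integrable.of_bound (hYm m).aestronglyMeasurable m (hYb m)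
    have hY2 : Integrable (fun ω => Y ω ^ 2) P := by
      refine Integrable.of_bound ((hYm m).pow_const 2).aestronglyMeasurable ((m : ℝ) ^ 2) ?_
      filter_upwards [hYb m] with ω hω
      rw [norm_pow]
      exact pow_le_pow_left₀ (norm_nonneg _) hω 2
    have hYξ : Integrable (fun ω => Y ω * ξ ω) P := by
      refine hYint.mono ((hYm m).mul hξm).aestronglyMeasurable (ae_of_all _ fun ω => ?_)
      rw [norm_mul, Real.norm_of_nonneg (hξ01 ω).1]
      exact mul_le_of_le_one_right (norm_nonneg _) (hξ01 ω).2
    have hYV : Integrable (fun ω => Y ω * V [] ω j) P := by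
      refine hYint.mono ((hYm m).mul hVm).aestronglyMeasurable ?_
      filter_upwards [hVs] with ω hω
      have h1 := mem_Icc_of_mem_stdSimplex hω j
      rw [norm_mul, Real.norm_of_nonneg h1.1]
      exact mul_le_of_le_one_right (norm_nonneg _) h1.2
    -- Given the split vector and the past, the next indicator has mean V_j, so the increments of
    -- the deviation are orthogonal to it and the variance grows by at most 1 per item.
    have horth : ∫ ω, Y ω * ξ ω ∂P = ∫ ω, Y ω * V [] ω j ∂P := by
      have := hJ.integral_choice_eq hσ [] m j
        (g := fun v i => ((∑ k : Fin m, if i k = j then 1 else 0 : ℕ) : ℝ) - m * v j)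
        (fun i => by fun_prop) (C := m) (fun v hv i => by
          have h1 := mem_Icc_of_mem_stdSimplex hv j
          have h2 : ((∑ k : Fin m, if i k = j then 1 else 0 : ℕ) : ℝ) ≤ m := by
            have : (∑ k : Fin m, if i k = j then 1 else 0 : ℕ) ≤ ∑ _k : Fin m, 1 :=
              Finset.sum_le_sum fun k _ => by split_ifs <;> simp
            simp only [Finset.sum_const, Finset.card_univ, Fintype.card_fin, smul_eq_mul,
              mul_one] at this
            exact_mod_cast this
          have h3 : (0 : ℝ) ≤ ((∑ k : Fin m, if i k = j then 1 else 0 : ℕ) : ℝ) := by positivity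
          have h4 : (m : ℝ) * v j ≤ m := mul_le_of_le_one_right (by positivity) h1.2
          have h5 : (0 : ℝ) ≤ m * v j := mul_nonneg (by positivity) h1.1
          rw [abs_le]
          constructor <;> linarith)
      have hcard : ∀ ω, (∑ k : Fin m, if J [] k ω = j then 1 else 0 : ℕ)
          = ((Finset.range m).filter fun k => J [] k ω = j).card := fun ω =>
        (card_filter_range_eq (fun k => J [] k ω) m j).symm
      simp only [hcard] at this
      exact this
    have hle : ∀ᵐ ω ∂P, ((((Finset.range (m + 1)).filter fun k => J [] k ω = j).card : ℝ)
        - ((m + 1 : ℕ) : ℝ) * V [] ω j) ^ 2 ≤ Y ω ^ 2 + 2 * (Y ω * ξ ω) - 2 * (Y ω * V [] ω j) + 1 := by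
      filter_upwards [hVs] with ω hω
      have h1 := mem_Icc_of_mem_stdSimplex hω j
      have e : (((Finset.range (m + 1)).filter fun k => J [] k ω = j).card : ℝ)
          - ((m + 1 : ℕ) : ℝ) * V [] ω j = Y ω + (ξ ω - V [] ω j) := by
        rw [card_filter_range_succ fun k => J [] k ω]
        simp only [hY, hξ]
        push_cast
        ring
      rw [e]
      have h2 : (ξ ω - V [] ω j) ^ 2 ≤ 1 := by
        rw [sq_le_one_iff_abs_le_one, abs_le]
        have := hξ01 ω
        constructor <;> linarith [h1.1, h1.2]
      nlinarith
    refine (integral_mono_ae ?_ ?_ hle).trans ?_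
    · refine Integrable.of_bound ((hYm (m + 1)).pow_const 2).aestronglyMeasurable
        (((m + 1 : ℕ) : ℝ) ^ 2) ?_
      filter_upwards [hYb (m + 1)] with ω hω
      rw [norm_pow]
      exact pow_le_pow_left₀ (norm_nonneg _) hω 2
    · exact ((hY2.add (hYξ.const_mul 2)).sub (hYV.const_mul 2)).add (integrable_const 1)
    · have hi1 : Integrable (fun ω => Y ω ^ 2 + 2 * (Y ω * ξ ω)) P := hY2.add (hYξ.const_mul 2)
      have hi2 : Integrable (fun ω => Y ω ^ 2 + 2 * (Y ω * ξ ω) - 2 * (Y ω * V [] ω j)) P :=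
        hi1.sub (hYV.const_mul 2)
      rw [integral_add hi2 (integrable_const 1), integral_sub hi1 (hYV.const_mul 2),
        integral_add hY2 (hYξ.const_mul 2), integral_const_mul, integral_const_mul, horth]
      simp only [integral_const, probReal_univ, smul_eq_mul, mul_one]
      push_cast
      linarith

/-- The quadratic bound is turned into a first moment by |Y| ≤ Y² / (2√m) + √m / 2, whose two terms
balance at the scale √m. -/
theorem integral_abs_card_sub_le (hJ : IsRouting P σ V J) (hσ : ∀ᵐ v ∂σ, v ∈ stdSimplex ℝ (Fin b))
    (j : Fin b) (m : ℕ) :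
    ∫ ω, |(((Finset.range m).filter fun k => J [] k ω = j).card : ℝ) - m * V [] ω j| ∂P ≤ √m := by
  rcases Nat.eq_zero_or_pos m with rfl | hm
  · simp
  have hm' : (0 : ℝ) < √m := Real.sqrt_pos.2 (by exact_mod_cast hm)
  have hVs := hJ.ae_vector [] hσ
  set Y : Ω → ℝ := fun ω => (((Finset.range m).filter fun k => J [] k ω = j).card : ℝ) - m * V [] ω j
    with hY
  have hYm : Measurable Y :=
    (measurable_from_nat.comp ((measurable_filter_card m j).comp (hJ.measurable_choices []))).sub
      (((measurable_pi_apply j).comp (hJ.measurable_vector [])).const_mul _)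
  have hYb : ∀ᵐ ω ∂P, |Y ω| ≤ m := by
    filter_upwards [hVs] with ω hω
    have h1 := mem_Icc_of_mem_stdSimplex hω j
    have h2 : (((Finset.range m).filter fun k => J [] k ω = j).card : ℝ) ≤ m := by
      exact_mod_cast (Finset.card_filter_le _ _).trans (Finset.card_range m).le
    have h3 : (0 : ℝ) ≤ (((Finset.range m).filter fun k => J [] k ω = j).card : ℝ) := by positivity
    have h4 : (m : ℝ) * V [] ω j ≤ m := mul_le_of_le_one_right (by positivity) h1.2
    have h5 : (0 : ℝ) ≤ m * V [] ω j := mul_nonneg (by positivity) h1.1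
    rw [abs_le]
    constructor <;> linarith
  have hYint : Integrable Y P := Integrable.of_bound hYm.aestronglyMeasurable m hYb
  have hY2 : Integrable (fun ω => Y ω ^ 2) P := by
    refine Integrable.of_bound (hYm.pow_const 2).aestronglyMeasurable ((m : ℝ) ^ 2) ?_
    filter_upwards [hYb] with ω hω
    rw [norm_pow]
    exact pow_le_pow_left₀ (norm_nonneg _) hω 2
  have hpt : ∀ ω, |Y ω| ≤ Y ω ^ 2 / (2 * √m) + √m / 2 := fun ω => by
    rw [div_add_div _ _ (by positivity) two_ne_zero, le_div_iff₀ (by positivity), ← sq_abs]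
    nlinarith [sq_nonneg (|Y ω| - √m)]
  calc ∫ ω, |Y ω| ∂P ≤ ∫ ω, (Y ω ^ 2 / (2 * √m) + √m / 2) ∂P :=
        integral_mono hYint.abs ((hY2.div_const _).add (integrable_const _)) hpt
    _ = (∫ ω, Y ω ^ 2 ∂P) / (2 * √m) + √m / 2 := by
        rw [integral_add (hY2.div_const _) (integrable_const _), integral_div]
        simp
    _ ≤ (m : ℝ) / (2 * √m) + √m / 2 := by
        gcongr
        exact hJ.integral_sq_card_sub_le hσ j m
    _ = √m := by
        have : (m : ℝ) = √m * √m := (Real.mul_self_sqrt (by positivity)).symm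
        rw [this]
        field_simp
        rw [Real.sqrt_sq hm'.le]
        ring

/-- The subtree sizes at the root of a split tree. -/
theorem sizeModel (hJ : IsRouting P σ V J) (hσ : ∀ᵐ v ∂σ, v ∈ stdSimplex ℝ (Fin b))
    (hdens : ∀ j : Fin b, σ.map (fun v => v j) ≪ (volume : Measure ℝ)) (hb : 2 ≤ b)
    {s s₀ s₁ : ℕ} (hs : 1 ≤ s) (hs₁ : s₀ + b * s₁ ≤ s + 1) :
    SizeModel P s s₀ ((s + s₁ + (s₀ + b * s₁) : ℕ) : ℝ) (V [])
      (fun n j ω => childSize s s₀ s₁ n (fun k => J [] k ω) j) := by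
  have hVs := hJ.ae_vector [] hσ
  have hnull : ∀ j (x : ℝ), σ {v | v j = x} = 0 := fun j x => by
    have h1 := hdens j (Real.volume_singleton (a := x))
    rwa [Measure.map_apply (measurable_pi_apply j) (measurableSet_singleton x)] at h1
  have hnullP : ∀ j (x : ℝ), P {ω | V [] ω j = x} = 0 := fun j x => by
    have h1 := hnull j x
    have hm : MeasurableSet {v : Fin b → ℝ | v j = x} :=
      (measurableSet_singleton x).preimage (measurable_pi_apply j)
    rw [← hJ.map_vector [], Measure.map_apply (hJ.measurable_vector []) hm] at h1
    exact h1
  have hVm : ∀ j, Measurable fun ω => V [] ω j := fun j =>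
    (measurable_pi_apply j).comp (hJ.measurable_vector [])
  have hIm : ∀ n j, Measurable fun ω => childSize s s₀ s₁ n (fun k => J [] k ω) j := fun n j =>
    (measurable_childSize s s₀ s₁ n j).comp (hJ.measurable_choices [])
  refine
    { measurable_vector := hJ.measurable_vector []
      measurable_size := hIm
      mem_simplex := hVs
      pos_lt_one := ?_
      null_singleton := hnullP
      size_le := fun n j ω => childSize_le hs₁ n _ j
      sum_size := fun n ω hn => sum_childSize hs₁ hn _
      K_nonneg := by positivity
      mean_dist := fun n j => ?_
      self_le := fun n hn => ?_
      increment := fun n hn j f => ?_ }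
  · have h1 : ∀ᵐ ω ∂P, ∀ j, V [] ω j ≠ 0 ∧ V [] ω j ≠ 1 :=
      ae_all_iff.2 fun j => (measure_eq_zero_iff_ae_notMem.1 (hnullP j 0)).and
        (measure_eq_zero_iff_ae_notMem.1 (hnullP j 1))
    filter_upwards [hVs, h1] with ω hω h2 j
    have h3 := mem_Icc_of_mem_stdSimplex hω j
    exact ⟨lt_of_le_of_ne h3.1 (h2 j).1.symm, lt_of_le_of_ne h3.2 (h2 j).2⟩
  · rcases le_or_gt n s with hn | hn
    · have h1 : ∫ ω, |((childSize s s₀ s₁ n (fun k => J [] k ω) j : ℕ) : ℝ) - n * V [] ω j| ∂P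
          ≤ ∫ _ω, (s : ℝ) ∂P := by
        refine integral_mono_of_nonneg (ae_of_all _ fun ω => abs_nonneg _) (integrable_const _) ?_
        filter_upwards [hVs] with ω hω
        have h3 := mem_Icc_of_mem_stdSimplex hω j
        rw [childSize_of_le hn, Nat.cast_zero, zero_sub, abs_neg, abs_of_nonneg
          (mul_nonneg (by positivity) h3.1)]
        calc (n : ℝ) * V [] ω j ≤ n := mul_le_of_le_one_right (by positivity) h3.2
          _ ≤ s := by exact_mod_cast hn
      refine h1.trans ?_
      simp only [integral_const, probReal_univ, smul_eq_mul, one_mul]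
      have := Real.sqrt_nonneg (n : ℝ)
      push_cast
      have : (0 : ℝ) ≤ s₁ + (s₀ + b * s₁) := by positivity
      linarith
    -- Only m items are routed at random. The s₁ fixed items and the difference between m and n cost
    -- a constant, collected in K.
    · set m := n - (s₀ + b * s₁) with hm
      have hmn : m + (s₀ + b * s₁) = n := by omega
      have hmn' : (m : ℝ) + (s₀ + b * s₁) = n := by exact_mod_cast congrArg (Nat.cast (R := ℝ)) hmn
      have hI : ∀ ω, childSize s s₀ s₁ n (fun k => J [] k ω) j = s₁ +
          ((Finset.range m).filter fun k => J [] k ω = j).card := fun ω => if_neg (not_le.2 hn)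
      have hYm : Measurable fun ω =>
          (((Finset.range m).filter fun k => J [] k ω = j).card : ℝ) - m * V [] ω j :=
        (measurable_from_nat.comp ((measurable_filter_card m j).comp
          (hJ.measurable_choices []))).sub ((hVm j).const_mul _)
      have hYint : Integrable (fun ω =>
          |(((Finset.range m).filter fun k => J [] k ω = j).card : ℝ) - m * V [] ω j|) P := by
        refine Integrable.of_bound hYm.abs.aestronglyMeasurable ((m : ℝ) + m) ?_
        filter_upwards [hVs] with ω hω
        have h3 := mem_Icc_of_mem_stdSimplex hω j
        rw [Real.norm_eq_abs, abs_abs]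
        refine (abs_sub _ _).trans (add_le_add ?_ ?_)
        · rw [abs_of_nonneg (by positivity)]
          exact_mod_cast (Finset.card_filter_le _ _).trans (Finset.card_range m).le
        · rw [abs_of_nonneg (mul_nonneg (by positivity) h3.1)]
          exact mul_le_of_le_one_right (by positivity) h3.2
      have h1 : ∫ ω, |((childSize s s₀ s₁ n (fun k => J [] k ω) j : ℕ) : ℝ) - n * V [] ω j| ∂P
          ≤ ∫ ω, (|(((Finset.range m).filter fun k => J [] k ω = j).card : ℝ) - m * V [] ω j|
            + ((s₁ : ℝ) + (s₀ + b * s₁))) ∂P := by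
        refine integral_mono_of_nonneg (ae_of_all _ fun ω => abs_nonneg _)
          (hYint.add (integrable_const _)) ?_
        filter_upwards [hVs] with ω hω
        have h3 := mem_Icc_of_mem_stdSimplex hω j
        rw [hI, ← hmn']
        push_cast
        have e : ((s₁ : ℝ) + (((Finset.range m).filter fun k => J [] k ω = j).card : ℝ))
            - (m + (s₀ + b * s₁)) * V [] ω j
            = ((((Finset.range m).filter fun k => J [] k ω = j).card : ℝ) - m * V [] ω j)
              + (s₁ - (s₀ + b * s₁) * V [] ω j) := by ring
        rw [e]
        refine (abs_add_le _ _).trans (add_le_add_right ?_ _)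
        have h4 : (0 : ℝ) ≤ s₀ + b * s₁ := by positivity
        have h5 : ((s₀ : ℝ) + b * s₁) * V [] ω j ≤ s₀ + b * s₁ := mul_le_of_le_one_right h4 h3.2
        have h6 : (0 : ℝ) ≤ (s₀ + b * s₁) * V [] ω j := mul_nonneg h4 h3.1
        have h7 : (0 : ℝ) ≤ s₁ := by positivity
        rw [abs_le]
        constructor <;> linarith
      refine h1.trans ?_
      rw [integral_add hYint (integrable_const _)]
      simp only [integral_const, probReal_univ, smul_eq_mul, one_mul]
      have h8 := hJ.integral_abs_card_sub_le hσ j m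
      have h9 : √(m : ℝ) ≤ √n := Real.sqrt_le_sqrt (by exact_mod_cast (by omega : m ≤ n))
      push_cast
      have : (0 : ℝ) ≤ s := by positivity
      linarith
  · have hI : ∀ ω j, childSize s s₀ s₁ n (fun k => J [] k ω) j = s₁ +
        ((Finset.range (n - (s₀ + b * s₁))).filter fun k => J [] k ω = j).card :=
      fun ω j => if_neg (not_le.2 hn)
    have h1 : ∀ j, P.real {ω | childSize s s₀ s₁ n (fun k => J [] k ω) j = n}
        ≤ ∫ ω, V [] ω j ^ 2 ∂P := by
      intro j
      -- A child can receive all n items only if s₀ = s₁ = 0, by counting with b ≥ 2. Then all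
      -- choices equal j, in particular the first two, which exist because n > s ≥ 1. This event has
      -- probability E V_j².
      have hsub : {ω | childSize s s₀ s₁ n (fun k => J [] k ω) j = n}
          ⊆ {ω | ∀ k : Fin 2, J [] k ω = j} := by
        intro ω hω
        have hω' : s₁ + ((Finset.range (n - (s₀ + b * s₁))).filter fun k => J [] k ω = j).card = n := by
          rw [← hI]; exact hω
        have hle := (Finset.card_filter_le (Finset.range (n - (s₀ + b * s₁)))
          fun k => J [] k ω = j)
        rw [Finset.card_range] at hle
        have hbs : 2 * s₁ ≤ b * s₁ := Nat.mul_le_mul_right _ hb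
        have hs1 : s₁ = 0 := by omega
        subst hs1
        have hs0 : s₀ = 0 := by omega
        subst hs0
        simp only [mul_zero, add_zero, Nat.sub_zero, zero_add] at hω'
        have hall := Finset.card_filter_eq_iff.1 (hω'.trans (Finset.card_range n).symm)
        intro k
        exact hall (k : ℕ) (Finset.mem_range.2 (by omega))
      refine (measureReal_mono hsub).trans (le_of_eq ?_)
      have h2 := hJ.setIntegral_vector hσ [] 2 (fun _ => j) (g := fun _ => 1) measurable_const
      simp only [setIntegral_const, smul_eq_mul, mul_one, Finset.prod_const, Finset.card_univ,
        Fintype.card_fin] at h2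
      rw [h2]
      exact (hJ.integral_vector [] (g := fun v => v j ^ 2)
        (Measurable.aestronglyMeasurable (by fun_prop))).symm
    rw [integral_finsetSum]
    · exact Finset.sum_le_sum fun j _ => h1 j
    · intro j _
      refine Integrable.of_bound ((hVm j).pow_const 2).aestronglyMeasurable 1 ?_
      filter_upwards [hVs] with ω hω
      have h3 := mem_Icc_of_mem_stdSimplex hω j
      rw [norm_pow, Real.norm_of_nonneg h3.1]
      exact pow_le_one₀ h3.1 h3.2
  -- Coupling: with one more item the same choices are used, followed by the choice with index m.
  -- Since n > s, both n and n + 1 are in the branching case.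
  · set m := n - (s₀ + b * s₁) with hm
    have hI : ∀ ω, childSize s s₀ s₁ n (fun k => J [] k ω) j = s₁ +
        ((Finset.range m).filter fun k => J [] k ω = j).card := fun ω => if_neg (not_le.2 hn)
    have hI' : ∀ ω, childSize s s₀ s₁ (n + 1) (fun k => J [] k ω) j =
        childSize s s₀ s₁ n (fun k => J [] k ω) j + if J [] m ω = j then 1 else 0 := by
      intro ω
      have h1 : childSize s s₀ s₁ (n + 1) (fun k => J [] k ω) j = s₁ +
          ((Finset.range (n + 1 - (s₀ + b * s₁))).filter fun k => J [] k ω = j).card :=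
        if_neg (not_le.2 (by omega))
      rw [h1, hI, show n + 1 - (s₀ + b * s₁) = m + 1 by omega,
        card_filter_range_succ fun k => J [] k ω]
      ring
    have hfint : ∀ n', Integrable (fun ω => f (childSize s s₀ s₁ n' (fun k => J [] k ω) j)) P := by
      intro n'
      refine Integrable.of_bound (measurable_from_nat.comp (hIm n' j)).aestronglyMeasurable
        (∑ k ∈ Finset.range (n' + 1), |f k|) (ae_of_all _ fun ω => ?_)
      exact Finset.single_le_sum (f := fun k => |f k|) (fun k _ => abs_nonneg _)
        (Finset.mem_range.2 (Nat.lt_succ_of_le (childSize_le hs₁ n' _ j)))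
    rw [← integral_sub (hfint _) (hfint _)]
    let g : (Fin m → Fin b) → ℝ := fun i => f (s₁ + (∑ k : Fin m, if i k = j then 1 else 0) + 1)
      - f (s₁ + ∑ k : Fin m, if i k = j then 1 else 0)
    have hg : ∀ ω, g (fun k => J [] k ω) = f (childSize s s₀ s₁ n (fun k => J [] k ω) j + 1)
        - f (childSize s s₀ s₁ n (fun k => J [] k ω) j) := fun ω => by
      simp only [g, hI, card_filter_range_eq fun k => J [] k ω]
    have key := hJ.integral_choice_eq hσ [] m j (g := fun _ i => g i) (fun i => measurable_const)
      (C := ∑ i, |g i|) fun v _ i =>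
        Finset.single_le_sum (f := fun i => |g i|) (fun _ _ => abs_nonneg _) (Finset.mem_univ i)
    simp only [hg] at key
    rw [← key]
    refine integral_congr_ae (ae_of_all _ fun ω => ?_)
    simp only [hI']
    split_ifs <;> simp

end IsRouting

end SplitTree

/-! ### Finiteness of the means and their recursion. -/

namespace SplitTree

section Measurability

variable {b : ℕ} (s s₀ s₁ : ℕ)

theorem measurable_levelSum (p d n : ℕ) :
    Measurable fun r : List (Fin b) → ℕ → Fin b => levelSum p s s₀ s₁ d r n := by
  induction d generalizing n with
  | zero => exact measurable_const
  | succ d ih =>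
    simp only [levelSum]
    refine Finset.measurable_sum _ fun j _ => ?_
    -- The child size is itself random, so joint measurability is needed; it is free in a countable
    -- coordinate.
    have h1 : Measurable fun q : ℕ × (List (Fin b) → ℕ → Fin b) => levelSum p s s₀ s₁ d q.2 q.1 :=
      measurable_from_prod_countable_right ih
    have h2 : Measurable fun r : List (Fin b) → ℕ → Fin b => childSize s s₀ s₁ n (r []) j :=
      (measurable_childSize s s₀ s₁ n j).comp (measurable_pi_apply [])
    have h3 : Measurable fun (r : List (Fin b) → ℕ → Fin b) (w : List (Fin b)) => r (j :: w) :=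
      measurable_pi_lambda _ fun w => measurable_pi_apply (j :: w)
    exact h1.comp (h2.prodMk h3)

theorem measurable_powerSum (p n : ℕ) :
    Measurable fun r : List (Fin b) → ℕ → Fin b => powerSum p s s₀ s₁ r n :=
  Measurable.tsum fun d => measurable_from_nat.comp (measurable_levelSum s s₀ s₁ p d n)

end Measurability

namespace SizeModel

set_option linter.unusedSectionVars false

variable {b : ℕ} {Ω : Type*} [MeasurableSpace Ω] {P : Measure Ω} [IsProbabilityMeasure P]
  {s s₀ : ℕ} {K : ℝ} {V : Ω → Fin b → ℝ} {I : ℕ → Fin b → Ω → ℕ}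

theorem measurable_coord (hM : SizeModel P s s₀ K V I) (j : Fin b) : Measurable fun ω => V ω j :=
  (measurable_pi_apply j).comp hM.measurable_vector

theorem integrable_sq (hM : SizeModel P s s₀ K V I) : Integrable (fun ω => ∑ j, V ω j ^ 2) P := by
  refine integrable_finsetSum _ fun j _ => Integrable.of_bound
    ((hM.measurable_coord j).pow_const 2).aestronglyMeasurable 1 ?_
  filter_upwards [hM.mem_simplex] with ω hω
  have h3 := mem_Icc_of_mem_stdSimplex hω j
  rw [norm_pow, Real.norm_of_nonneg h3.1]
  exact pow_le_one₀ h3.1 h3.2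

theorem integral_sq_nonneg (_hM : SizeModel P s s₀ K V I) : 0 ≤ ∫ ω, ∑ j, V ω j ^ 2 ∂P :=
  integral_nonneg fun _ => Finset.sum_nonneg fun _ _ => sq_nonneg _

/-- Squaring strictly lowers each coordinate in (0, 1). The gap between this mean and 1 absorbs the
event that a child keeps all items, and it is the constant in the quadratic asymptotics. -/
theorem integral_sq_lt_one (hM : SizeModel P s s₀ K V I) : ∫ ω, ∑ j, V ω j ^ 2 ∂P < 1 := by
  have hpos : 0 < ∫ ω, (1 - ∑ j, V ω j ^ 2) ∂P := by
    have hae : ∀ᵐ ω ∂P, 0 < 1 - ∑ j, V ω j ^ 2 := by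
      filter_upwards [hM.mem_simplex, hM.pos_lt_one] with ω hω h1
      have hne : (Finset.univ : Finset (Fin b)).Nonempty := by
        by_contra hcon
        rw [Finset.not_nonempty_iff_eq_empty] at hcon
        have := hω.2
        rw [hcon] at this
        simp at this
      have h2 : ∑ j, V ω j ^ 2 < ∑ j, V ω j := Finset.sum_lt_sum_of_nonempty hne fun j _ => by
        have := h1 j
        nlinarith
      rw [hω.2] at h2
      linarith
    rw [integral_pos_iff_support_of_nonneg_ae]
    · have : (Function.support fun ω => 1 - ∑ j, V ω j ^ 2) ∈ ae P := by
        filter_upwards [hae] with ω hω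
        exact hω.ne'
      rw [measure_congr (eventuallyEq_univ.2 this), measure_univ]
      exact one_pos
    · filter_upwards [hae] with ω hω
      exact hω.le
    · exact (integrable_const 1).sub hM.integrable_sq
  rw [integral_sub (integrable_const 1) hM.integrable_sq] at hpos
  simp only [integral_const, probReal_univ, smul_eq_mul, mul_one] at hpos
  linarith

end SizeModel

namespace IsRouting

set_option linter.unusedSectionVars false

variable {b : ℕ} {Ω : Type*} [MeasurableSpace Ω] {P : Measure Ω} [IsProbabilityMeasure P]
  {σ : Measure (Fin b → ℝ)} [IsProbabilityMeasure σ] {V : List (Fin b) → Ω → (Fin b → ℝ)}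
  {J : List (Fin b) → ℕ → Ω → Fin b} {s s₀ s₁ : ℕ} {K : ℝ}

theorem lintegral_levelSum_succ (hJ : IsRouting P σ V J) (p d n : ℕ) :
    ∫⁻ ω, (levelSum p s s₀ s₁ (d + 1) (fun u k => J u k ω) n : ℝ≥0∞) ∂P
      = ∑ j, ∫⁻ ω, (∫⁻ ω', (levelSum p s s₀ s₁ d (fun u k => J u k ω')
          (childSize s s₀ s₁ n (fun k => J [] k ω) j) : ℝ≥0∞) ∂P) ∂P := by
  have hm : ∀ k, Measurable fun r : List (Fin b) → ℕ → Fin b =>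
      (levelSum p s s₀ s₁ d r k : ℝ≥0∞) := fun k =>
    measurable_from_nat.comp (measurable_levelSum s s₀ s₁ p d k)
  have h2 : Measurable fun q : ℕ × (List (Fin b) → ℕ → Fin b) =>
      (levelSum p s s₀ s₁ d q.2 q.1 : ℝ≥0∞) := measurable_from_prod_countable_right hm
  simp only [levelSum, Nat.cast_sum]
  rw [lintegral_finsetSum]
  · exact Finset.sum_congr rfl fun j _ => hJ.lintegral_root_subroute j
      (N := fun c => childSize s s₀ s₁ n c j) (measurable_childSize s s₀ s₁ n j)
      (F := fun k r => (levelSum p s s₀ s₁ d r k : ℝ≥0∞)) hm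
  · intro j _
    exact h2.comp (((measurable_childSize s s₀ s₁ n j).comp (hJ.measurable_choices [])).prodMk
      (hJ.measurable_subroute j))

theorem lintegral_powerSum_eq (hJ : IsRouting P σ V J) (p n : ℕ) :
    ∫⁻ ω, powerSum p s s₀ s₁ (fun u k => J u k ω) n ∂P
      = (n : ℝ≥0∞) ^ p + ∑ j, ∫⁻ ω, (∫⁻ ω', powerSum p s s₀ s₁ (fun u k => J u k ω')
          (childSize s s₀ s₁ n (fun k => J [] k ω) j) ∂P) ∂P := by
  have hm : ∀ k, Measurable fun r : List (Fin b) → ℕ → Fin b => powerSum p s s₀ s₁ r k :=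
    measurable_powerSum s s₀ s₁ p
  have h2 : Measurable fun q : ℕ × (List (Fin b) → ℕ → Fin b) => powerSum p s s₀ s₁ q.2 q.1 :=
    measurable_from_prod_countable_right hm
  have h1 : ∀ ω, powerSum p s s₀ s₁ (fun u k => J u k ω) n = (n : ℝ≥0∞) ^ p +
      ∑ j, powerSum p s s₀ s₁ (fun u k => J (j :: u) k ω)
        (childSize s s₀ s₁ n (fun k => J [] k ω) j) := fun ω =>
    powerSum_eq p (fun u k => J u k ω) n
  simp only [h1]
  rw [lintegral_add_left measurable_const, lintegral_const, measure_univ, mul_one,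
    lintegral_finsetSum]
  · congr 1
    exact Finset.sum_congr rfl fun j _ => hJ.lintegral_root_subroute j
      (N := fun c => childSize s s₀ s₁ n c j) (measurable_childSize s s₀ s₁ n j)
      (F := fun k r => powerSum p s s₀ s₁ r k) hm
  · intro j _
    exact h2.comp (((measurable_childSize s s₀ s₁ n j).comp (hJ.measurable_choices [])).prodMk
      (hJ.measurable_subroute j))

/-- The mean of the sum of all subtree sizes is finite. -/
theorem lintegral_powerSum_one_lt_top (hJ : IsRouting P σ V J)
    (hM : SizeModel P s s₀ K (V []) (fun n j ω => childSize s s₀ s₁ n (fun k => J [] k ω) j))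
    (n : ℕ) : ∫⁻ ω, powerSum 1 s s₀ s₁ (fun u k => J u k ω) n ∂P < ⊤ := by
  set e : ℕ → ℕ → ℝ≥0∞ := fun d n =>
    ∫⁻ ω, (levelSum 1 s s₀ s₁ d (fun u k => J u k ω) n : ℝ≥0∞) ∂P with he
  have hT : ∀ n, ∫⁻ ω, powerSum 1 s s₀ s₁ (fun u k => J u k ω) n ∂P = ∑' d, e d n := by
    intro n
    simp only [powerSum]
    rw [lintegral_tsum]
    exact fun d => (measurable_from_nat.comp ((measurable_levelSum s s₀ s₁ 1 d n).comp
      hJ.measurable_route)).aemeasurable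
  -- A child may again have size n, so the recursion does not close by induction on n alone.
  -- Truncating at depth D avoids solving an inequality for a quantity not yet known to be finite;
  -- the bound must not depend on D.
  have key : ∀ n, ∃ C : ℝ, 0 ≤ C ∧ ∀ D, ∑ d ∈ Finset.range D, e d n ≤ ENNReal.ofReal C := by
    intro n
    induction n using Nat.strong_induction_on with
    | _ n ih =>
      rcases le_or_gt n s with hn | hn
      · refine ⟨n, by positivity, fun D => ?_⟩
        refine (ENNReal.sum_le_tsum _).trans ?_
        rw [← hT]
        simp [powerSum_of_le one_ne_zero _ hn]
      · choose! C hC0 hC using ih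
        set q := ∫ ω, ∑ j, V [] ω j ^ 2 ∂P with hq
        have hq0 : 0 ≤ q := hM.integral_sq_nonneg
        have hq1 : q < 1 := hM.integral_sq_lt_one
        -- The contribution of the root and of all strictly smaller children is at most A, a child
        -- of full size contributes with weight at most q, and A / (1 - q) is the fixed point of x ↦
        -- A + q x.
        set A : ℝ := n + b * ∑ k ∈ Finset.range n, C k with hA
        have hC' : 0 ≤ ∑ k ∈ Finset.range n, C k :=
          Finset.sum_nonneg fun k hk => hC0 k (Finset.mem_range.1 hk)
        have hA0 : 0 ≤ A := by positivity
        refine ⟨A / (1 - q), div_nonneg hA0 (by linarith), fun D => ?_⟩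
        induction D with
        | zero => simp
        | succ D ihD =>
          rw [Finset.sum_range_succ']
          have h0 : e 0 n = n := by simp [he, levelSum]
          have h1 : ∑ d ∈ Finset.range D, e (d + 1) n
              = ∑ j, ∫⁻ ω, ∑ d ∈ Finset.range D,
                  e d (childSize s s₀ s₁ n (fun k => J [] k ω) j) ∂P := by
            simp only [he, hJ.lintegral_levelSum_succ]
            rw [Finset.sum_comm]
            refine Finset.sum_congr rfl fun j _ => ?_
            rw [lintegral_finsetSum]
            intro d _
            exact (measurable_from_nat (f := fun k =>
              ∫⁻ ω', (levelSum 1 s s₀ s₁ d (fun u k => J u k ω') k : ℝ≥0∞) ∂P)).comp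
              (hM.measurable_size n j)
          have h2 : ∀ j ω, ∑ d ∈ Finset.range D, e d (childSize s s₀ s₁ n (fun k => J [] k ω) j)
              ≤ ENNReal.ofReal (∑ k ∈ Finset.range n, C k)
                + Set.indicator {ω | childSize s s₀ s₁ n (fun k => J [] k ω) j = n}
                  (fun _ => ENNReal.ofReal (A / (1 - q))) ω := by
            intro j ω
            by_cases hω : childSize s s₀ s₁ n (fun k => J [] k ω) j = n
            · rw [Set.indicator_of_mem (by exact hω), hω]
              exact ihD.trans le_add_self
            · rw [Set.indicator_of_notMem (by exact hω), add_zero]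
              have hlt := lt_of_le_of_ne (hM.size_le n j ω) hω
              refine (hC _ hlt D).trans (ENNReal.ofReal_le_ofReal ?_)
              exact Finset.single_le_sum (f := C) (fun k hk => hC0 k (Finset.mem_range.1 hk))
                (Finset.mem_range.2 hlt)
          have h3 : ∀ j, ∫⁻ ω, ∑ d ∈ Finset.range D,
                e d (childSize s s₀ s₁ n (fun k => J [] k ω) j) ∂P
              ≤ ENNReal.ofReal (∑ k ∈ Finset.range n, C k)
                + ENNReal.ofReal (A / (1 - q))
                  * P {ω | childSize s s₀ s₁ n (fun k => J [] k ω) j = n} := by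
            intro j
            refine (lintegral_mono (h2 j)).trans (le_of_eq ?_)
            rw [lintegral_add_left measurable_const, lintegral_const, measure_univ, mul_one,
              lintegral_indicator_const]
            exact hM.measurable_size n j (measurableSet_singleton n)
          have h4 : ∑ j, P {ω | childSize s s₀ s₁ n (fun k => J [] k ω) j = n}
              ≤ ENNReal.ofReal q := by
            have h5 := ENNReal.ofReal_le_ofReal (hM.self_le n hn)
            rw [ENNReal.ofReal_sum_of_nonneg fun _ _ => measureReal_nonneg] at h5
            simpa only [measureReal_def, ENNReal.ofReal_toReal (measure_ne_top P _)] using h5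
          rw [h0, h1]
          calc ∑ j, ∫⁻ ω, ∑ d ∈ Finset.range D,
                  e d (childSize s s₀ s₁ n (fun k => J [] k ω) j) ∂P + n
              ≤ ∑ j, (ENNReal.ofReal (∑ k ∈ Finset.range n, C k) + ENNReal.ofReal (A / (1 - q))
                  * P {ω | childSize s s₀ s₁ n (fun k => J [] k ω) j = n}) + n := by
                gcongr with j _
                exact h3 j
            _ = ENNReal.ofReal (b * ∑ k ∈ Finset.range n, C k) + ENNReal.ofReal (A / (1 - q))
                  * ∑ j, P {ω | childSize s s₀ s₁ n (fun k => J [] k ω) j = n} + n := by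
                rw [Finset.sum_add_distrib, ← Finset.mul_sum, ENNReal.ofReal_mul (by positivity)]
                simp
            _ ≤ ENNReal.ofReal (b * ∑ k ∈ Finset.range n, C k) + ENNReal.ofReal (A / (1 - q))
                  * ENNReal.ofReal q + n := by gcongr
            _ = ENNReal.ofReal (A / (1 - q)) := by
                rw [← ENNReal.ofReal_natCast n, ← ENNReal.ofReal_mul (div_nonneg hA0 (by linarith)),
                  ← ENNReal.ofReal_add (by positivity) (mul_nonneg (div_nonneg hA0 (by linarith)) hq0),
                  ← ENNReal.ofReal_add (add_nonneg (by positivity)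
                    (mul_nonneg (div_nonneg hA0 (by linarith)) hq0)) (by positivity)]
                congr 1
                have : (1 - q) ≠ 0 := by linarith
                rw [show (b : ℝ) * ∑ k ∈ Finset.range n, C k = A - n by rw [hA]; ring]
                field_simp
                ring
  obtain ⟨C, -, hC⟩ := key n
  rw [hT]
  exact (ENNReal.tsum_le_of_sum_range_le hC).trans_lt ENNReal.ofReal_lt_top

theorem lintegral_powerSum_lt_top (hJ : IsRouting P σ V J)
    (hM : SizeModel P s s₀ K (V []) (fun n j ω => childSize s s₀ s₁ n (fun k => J [] k ω) j))
    (hs₁ : s₀ + b * s₁ ≤ s + 1) {p : ℕ} (hp : p = 1 ∨ p = 2) (n : ℕ) :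
    ∫⁻ ω, powerSum p s s₀ s₁ (fun u k => J u k ω) n ∂P < ⊤ := by
  rcases hp with rfl | rfl
  · exact hJ.lintegral_powerSum_one_lt_top hM n
  · refine (lintegral_mono fun ω => powerSum_two_le hs₁ (fun u k => J u k ω) n).trans_lt ?_
    have hm : Measurable fun ω => powerSum 1 s s₀ s₁ (fun u k => J u k ω) n :=
      (measurable_powerSum s s₀ s₁ 1 n).comp hJ.measurable_route
    rw [lintegral_const_mul _ hm]
    exact ENNReal.mul_lt_top (ENNReal.natCast_lt_top n) (hJ.lintegral_powerSum_one_lt_top hM n)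

/-- The mean of the sum of the `p`-th powers of the subtree sizes. -/
noncomputable def meanPowerSum (P : Measure Ω) (J : List (Fin b) → ℕ → Ω → Fin b) (s s₀ s₁ p n : ℕ) :
    ℝ := ∫ ω, (powerSum p s s₀ s₁ (fun u k => J u k ω) n).toReal ∂P

theorem meanPowerSum_zero {p : ℕ} (hp : p ≠ 0) : meanPowerSum P J s s₀ s₁ p 0 = 0 := by
  simp [meanPowerSum, powerSum_zero hp]

theorem ae_powerSum_ne_top (hJ : IsRouting P σ V J)
    (hM : SizeModel P s s₀ K (V []) (fun n j ω => childSize s s₀ s₁ n (fun k => J [] k ω) j))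
    (hs₁ : s₀ + b * s₁ ≤ s + 1) {p : ℕ} (hp : p = 1 ∨ p = 2) (n : ℕ) :
    ∀ᵐ ω ∂P, powerSum p s s₀ s₁ (fun u k => J u k ω) n ≠ ⊤ := by
  filter_upwards [ae_lt_top ((measurable_powerSum s s₀ s₁ p n).comp hJ.measurable_route)
    (hJ.lintegral_powerSum_lt_top hM hs₁ hp n).ne] with ω hω
  exact hω.ne

theorem integrable_powerSum (hJ : IsRouting P σ V J)
    (hM : SizeModel P s s₀ K (V []) (fun n j ω => childSize s s₀ s₁ n (fun k => J [] k ω) j))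
    (hs₁ : s₀ + b * s₁ ≤ s + 1) {p : ℕ} (hp : p = 1 ∨ p = 2) (n : ℕ) :
    Integrable (fun ω => (powerSum p s s₀ s₁ (fun u k => J u k ω) n).toReal) P :=
  integrable_toReal_of_lintegral_ne_top
    ((measurable_powerSum s s₀ s₁ p n).comp hJ.measurable_route).aemeasurable
    (hJ.lintegral_powerSum_lt_top hM hs₁ hp n).ne

theorem meanPowerSum_eq (hJ : IsRouting P σ V J)
    (hM : SizeModel P s s₀ K (V []) (fun n j ω => childSize s s₀ s₁ n (fun k => J [] k ω) j))
    (hs₁ : s₀ + b * s₁ ≤ s + 1) {p : ℕ} (hp : p = 1 ∨ p = 2) (n : ℕ) :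
    meanPowerSum P J s s₀ s₁ p n = (n : ℝ) ^ p + ∑ j, ∫ ω, meanPowerSum P J s s₀ s₁ p
      (childSize s s₀ s₁ n (fun k => J [] k ω) j) ∂P := by
  set T : ℕ → ℝ≥0∞ := fun n => ∫⁻ ω, powerSum p s s₀ s₁ (fun u k => J u k ω) n ∂P with hT
  have hTfin : ∀ n, T n < ⊤ := hJ.lintegral_powerSum_lt_top hM hs₁ hp
  have ht : ∀ n, meanPowerSum P J s s₀ s₁ p n = (T n).toReal := fun n =>
    integral_toReal ((measurable_powerSum s s₀ s₁ p n).comp hJ.measurable_route).aemeasurable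
      (ae_lt_top ((measurable_powerSum s s₀ s₁ p n).comp hJ.measurable_route) (hTfin n).ne)
  have hrec : T n = (n : ℝ≥0∞) ^ p +
      ∑ j, ∫⁻ ω, T (childSize s s₀ s₁ n (fun k => J [] k ω) j) ∂P :=
    hJ.lintegral_powerSum_eq p n
  have hfin := (hTfin n).ne
  rw [hrec] at hfin
  have h1 := (ENNReal.add_ne_top.1 hfin).1
  have h2 := (ENNReal.add_ne_top.1 hfin).2
  simp only [ht]
  rw [hrec, ENNReal.toReal_add h1 h2, ENNReal.toReal_sum (ENNReal.sum_ne_top.1 h2)]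
  rw [ENNReal.toReal_pow, ENNReal.toReal_natCast]
  congr 1
  refine Finset.sum_congr rfl fun j _ => (integral_toReal ?_ ?_).symm
  · exact ((measurable_from_nat (f := T)).comp (hM.measurable_size n j)).aemeasurable
  · exact ae_of_all _ fun ω => hTfin _

end IsRouting

end SplitTree

/-! ### Discrete maximum principle and quadratic growth. -/

namespace SplitTree

namespace SizeModel

open Topology

set_option linter.unusedSectionVars false

variable {b : ℕ} {Ω : Type*} [MeasurableSpace Ω] {P : Measure Ω} [IsProbabilityMeasure P]
  {s s₀ : ℕ} {K : ℝ} {V : Ω → Fin b → ℝ} {I : ℕ → Fin b → Ω → ℕ}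

theorem integrable_size_comp_mul (hM : SizeModel P s s₀ K V I) (n : ℕ) (j : Fin b) (f : ℕ → ℝ)
    {c : Ω → ℝ} (hc : Measurable c) (hc1 : ∀ᵐ ω ∂P, 0 ≤ c ω ∧ c ω ≤ 1) :
    Integrable (fun ω => c ω * f (I n j ω)) P := by
  refine Integrable.of_bound (hc.mul
    ((measurable_from_nat (f := f)).comp (hM.measurable_size n j))).aestronglyMeasurable
    (∑ k ∈ Finset.range (n + 1), |f k|) ?_
  filter_upwards [hc1] with ω hω
  rw [Real.norm_eq_abs, abs_mul, abs_of_nonneg hω.1]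
  refine (mul_le_of_le_one_left (abs_nonneg _) hω.2).trans ?_
  exact Finset.single_le_sum (f := fun k => |f k|) (fun k _ => abs_nonneg _)
    (Finset.mem_range.2 (Nat.lt_succ_of_le (hM.size_le n j ω)))

theorem integrable_size_comp (hM : SizeModel P s s₀ K V I) (n : ℕ) (j : Fin b) (f : ℕ → ℝ) :
    Integrable (fun ω => f (I n j ω)) P := by
  simpa using hM.integrable_size_comp_mul n j f (c := fun _ => 1) measurable_const
    (ae_of_all _ fun _ => by norm_num)

theorem ae_coord_mem (hM : SizeModel P s s₀ K V I) (j : Fin b) :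
    ∀ᵐ ω ∂P, 0 ≤ V ω j ∧ V ω j ≤ 1 := by
  filter_upwards [hM.pos_lt_one] with ω hω
  exact ⟨(hω j).1.le, (hω j).2.le⟩

theorem integrable_coord_mul_size_comp (hM : SizeModel P s s₀ K V I) (n : ℕ) (j : Fin b)
    (f : ℕ → ℝ) : Integrable (fun ω => V ω j * f (I n j ω)) P :=
  hM.integrable_size_comp_mul n j f (hM.measurable_coord j) (hM.ae_coord_mem j)

theorem integrable_comp_coord (hM : SizeModel P s s₀ K V I) (j : Fin b) {f : ℝ → ℝ}
    (hf : Continuous f) : Integrable (fun ω => f (V ω j)) P := by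
  obtain ⟨C, hC⟩ := isCompact_Icc.exists_bound_of_continuousOn
    (s := Set.Icc (0 : ℝ) 1) (f := f) hf.continuousOn
  refine Integrable.of_bound (hf.measurable.comp (hM.measurable_coord j)).aestronglyMeasurable C ?_
  filter_upwards [hM.ae_coord_mem j] with ω hω
  exact hC _ hω

/-- A discrete maximum principle: a superharmonic function that is nonnegative on an initial segment
is nonnegative. -/
theorem nonneg_of_superharmonic (hM : SizeModel P s s₀ K V I) {c : Fin b → Ω → ℝ}
    (hc : ∀ j, Measurable (c j)) (hc1 : ∀ j, ∀ᵐ ω ∂P, 0 ≤ c j ω ∧ c j ω ≤ 1) {u : ℕ → ℝ} {N : ℕ}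
    (hN : s < N) (h0 : ∀ n < N, 0 ≤ u n)
    (h1 : ∀ n, N ≤ n → ∑ j, ∫ ω, c j ω * u (I n j ω) ∂P ≤ u n) (n : ℕ) : 0 ≤ u n := by
  induction n using Nat.strong_induction_on with
  | _ n ih =>
    rcases lt_or_ge n N with hn | hn
    · exact h0 n hn
    · by_contra hcon
      push Not at hcon
      -- At the first negative index n only children of full size n contribute negatively.
      have h2 : ∀ j, u n * P.real {ω | I n j ω = n} ≤ ∫ ω, c j ω * u (I n j ω) ∂P := by
        intro j
        have hms : MeasurableSet {ω | I n j ω = n} :=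
          hM.measurable_size n j (measurableSet_singleton n)
        have h3 : ∫ ω, Set.indicator {ω | I n j ω = n} (fun _ => u n) ω ∂P
            = u n * P.real {ω | I n j ω = n} := by
          rw [integral_indicator_const _ hms, smul_eq_mul, mul_comm]
        rw [← h3]
        refine integral_mono_ae ((integrable_const _).indicator hms)
          (hM.integrable_size_comp_mul n j u (hc j) (hc1 j)) ?_
        filter_upwards [hc1 j] with ω hω
        by_cases h4 : I n j ω = n
        · rw [Set.indicator_of_mem (by exact h4), h4]
          nlinarith [hω.1, hω.2]
        · rw [Set.indicator_of_notMem (by exact h4)]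
          exact mul_nonneg hω.1 (ih _ (lt_of_le_of_ne (hM.size_le n j ω) h4))
      -- The total weight of the full-size children is below 1, so u n < 0 would give u n * weight >
      -- u n, contrary to this bound.
      have h5 : u n * ∑ j, P.real {ω | I n j ω = n} ≤ u n := by
        rw [Finset.mul_sum]
        exact (Finset.sum_le_sum fun j _ => h2 j).trans (h1 n hn)
      have h6 := hM.self_le n (hN.trans_le hn)
      have h7 := hM.integral_sq_lt_one
      nlinarith

theorem sum_size_le (hM : SizeModel P s s₀ K V I) {n : ℕ} (hn : s < n) :
    ∑ j, ∫ ω, (I n j ω : ℝ) ∂P ≤ n := by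
  rw [← integral_finsetSum _ fun j _ => hM.integrable_size_comp n j fun k => (k : ℝ)]
  calc ∫ ω, ∑ j, (I n j ω : ℝ) ∂P ≤ ∫ _ω, (n : ℝ) ∂P := by
        refine integral_mono (integrable_finsetSum _ fun j _ =>
          hM.integrable_size_comp n j fun k => (k : ℝ)) (integrable_const _) fun ω => ?_
        have := hM.sum_size n ω hn
        have h2 : ∑ j, I n j ω ≤ n := by omega
        exact_mod_cast h2
    _ = n := by simp

/-- The mean of the sum of the squared sizes. -/
theorem abs_sum_sq_sub_le (hM : SizeModel P s s₀ K V I) (n : ℕ) :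
    |∑ j, ∫ ω, (I n j ω : ℝ) ^ 2 ∂P - (∫ ω, ∑ j, V ω j ^ 2 ∂P) * (n : ℝ) ^ 2|
      ≤ b * (2 * n * (√n + K)) := by
  have hV2 : ∀ j, Integrable (fun ω => V ω j ^ 2) P := fun j =>
    hM.integrable_comp_coord j (continuous_pow 2)
  have hI2 : ∀ j, Integrable (fun ω => (I n j ω : ℝ) ^ 2) P := fun j =>
    hM.integrable_size_comp n j fun k => (k : ℝ) ^ 2
  have hd : ∀ j, Integrable (fun ω => |(I n j ω : ℝ) - n * V ω j|) P := fun j =>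
    ((hM.integrable_size_comp n j fun k => (k : ℝ)).sub
      ((hM.integrable_comp_coord j continuous_id).const_mul _)).abs
  rw [integral_finsetSum _ fun j _ => hV2 j, Finset.sum_mul, ← Finset.sum_sub_distrib]
  refine (Finset.abs_sum_le_sum_abs _ _).trans ?_
  have : ∀ j ∈ (Finset.univ : Finset (Fin b)),
      |∫ ω, (I n j ω : ℝ) ^ 2 ∂P - (∫ ω, V ω j ^ 2 ∂P) * (n : ℝ) ^ 2| ≤ 2 * n * (√n + K) := by
    intro j _
    rw [← integral_mul_const, ← integral_sub (hI2 j) ((hV2 j).mul_const _)]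
    refine (abs_integral_le_integral_abs).trans ?_
    calc ∫ ω, |(I n j ω : ℝ) ^ 2 - V ω j ^ 2 * (n : ℝ) ^ 2| ∂P
        ≤ ∫ ω, 2 * n * |(I n j ω : ℝ) - n * V ω j| ∂P := by
          refine integral_mono_ae ((hI2 j).sub ((hV2 j).mul_const _)).abs ((hd j).const_mul _) ?_
          filter_upwards [hM.ae_coord_mem j] with ω hω
          have h1 : (I n j ω : ℝ) ≤ n := by exact_mod_cast hM.size_le n j ω
          have h2 : (n : ℝ) * V ω j ≤ n := mul_le_of_le_one_right (by positivity) hω.2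
          have h3 : 0 ≤ (n : ℝ) * V ω j := mul_nonneg (by positivity) hω.1
          have h4 : (I n j ω : ℝ) ^ 2 - V ω j ^ 2 * (n : ℝ) ^ 2
              = (I n j ω + n * V ω j) * ((I n j ω : ℝ) - n * V ω j) := by ring
          rw [h4, abs_mul, abs_of_nonneg (by positivity)]
          exact mul_le_mul_of_nonneg_right (by linarith) (abs_nonneg _)
      _ ≤ 2 * n * (√n + K) := by
          rw [integral_const_mul]
          exact mul_le_mul_of_nonneg_left (hM.mean_dist n j) (by positivity)
  refine (Finset.sum_le_sum this).trans ?_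
  simp

theorem tendsto_sqrt_add_div (K : ℝ) : Tendsto (fun n : ℕ => (√n + K) / n) atTop (𝓝 0) := by
  have h1 : Tendsto (fun n : ℕ => (√(n : ℝ))⁻¹ + K * (n : ℝ)⁻¹) atTop (𝓝 (0 + K * 0)) :=
    (tendsto_inv_atTop_zero.comp (Real.tendsto_sqrt_atTop.comp tendsto_natCast_atTop_atTop)).add
      ((tendsto_inv_atTop_zero.comp tendsto_natCast_atTop_atTop).const_mul K)
  rw [mul_zero, add_zero] at h1
  refine h1.congr fun n => ?_
  rw [add_div, Real.sqrt_div_self, div_eq_mul_inv]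

/-- Asymptotics of the solution of the recursion with quadratic toll. -/
theorem tendsto_div_sq_of_recursion (hM : SizeModel P s s₀ K V I) {t : ℕ → ℝ}
    (ht0 : t 0 = 0) (ht : ∀ n, t n = (n : ℝ) ^ 2 + ∑ j, ∫ ω, t (I n j ω) ∂P) :
    Tendsto (fun n : ℕ => t n / (n : ℝ) ^ 2) atTop (𝓝 (1 - ∫ ω, ∑ j, V ω j ^ 2 ∂P)⁻¹) := by
  set q := ∫ ω, ∑ j, V ω j ^ 2 ∂P with hq
  have hq1 : q < 1 := hM.integral_sq_lt_one
  have hp : 0 < 1 - q := by linarith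
  set a : ℕ → ℝ := fun n => t n - (1 - q)⁻¹ * (n : ℝ) ^ 2 with ha
  -- The deviation from n² / (1 - q) is squeezed between the barriers ± (ε n² + A n); that both
  -- differences are superharmonic for large n is the content of `key`.
  have hsuff : ∀ ε > 0, ∃ A, ∀ n : ℕ, |a n| ≤ ε * (n : ℝ) ^ 2 + A * n := by
    intro ε hε
    -- Chosen so that the error of the mean squared sizes, weighted by (1 - q)⁻¹ + ε, equals the
    -- gain ε (1 - q) n² of the barrier.
    set δ : ℝ := ε * (1 - q) / ((1 - q)⁻¹ + ε) with hδ
    have hδ0 : 0 < δ := by positivity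
    have h1 : Tendsto (fun n : ℕ => 2 * b * ((√n + K) / n)) atTop (𝓝 0) := by
      simpa using (tendsto_sqrt_add_div K).const_mul (2 * b : ℝ)
    obtain ⟨N₀, hN₀⟩ := eventually_atTop.1 (h1.eventually (gt_mem_nhds hδ0))
    set N := max (N₀ + 1) (s + 1) with hN
    have herr : ∀ n, N ≤ n → |∑ j, ∫ ω, (I n j ω : ℝ) ^ 2 ∂P - q * (n : ℝ) ^ 2|
        ≤ δ * (n : ℝ) ^ 2 := by
      intro n hn
      have hn0 : (0 : ℝ) < n := by
        have : 0 < n := by omega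
        exact_mod_cast this
      refine (hM.abs_sum_sq_sub_le n).trans ?_
      have h2 := (hN₀ n (by omega)).le
      have h3 : 2 * b * ((√n + K) / n) * (n : ℝ) ^ 2 = b * (2 * n * (√n + K)) := by
        field_simp
      rw [← h3]
      exact mul_le_mul_of_nonneg_right h2 (by positivity)
    -- The linear term is harmless, as the sizes sum to at most n, and with this constant it
    -- dominates the deviation at all indices below N. At 0 both vanish.
    set A : ℝ := ∑ k ∈ Finset.range N, |a k| with hA
    have hA0 : 0 ≤ A := Finset.sum_nonneg fun _ _ => abs_nonneg _
    refine ⟨A, fun n => ?_⟩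
    have hintg : ∀ n j (τ : ℝ), ∫ ω, (1 : ℝ) * (ε * (I n j ω : ℝ) ^ 2 + A * I n j ω
        + τ * (t (I n j ω) - (1 - q)⁻¹ * (I n j ω : ℝ) ^ 2)) ∂P
        = (ε - τ * (1 - q)⁻¹) * ∫ ω, (I n j ω : ℝ) ^ 2 ∂P + A * ∫ ω, (I n j ω : ℝ) ∂P
          + τ * ∫ ω, t (I n j ω) ∂P := by
      intro n j τ
      have i1 := hM.integrable_size_comp n j fun k => (k : ℝ) ^ 2
      have i2 := hM.integrable_size_comp n j fun k => (k : ℝ)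
      have i3 := hM.integrable_size_comp n j t
      have i12 : Integrable (fun ω => (ε - τ * (1 - q)⁻¹) * (I n j ω : ℝ) ^ 2 + A * I n j ω) P :=
        (i1.const_mul _).add (i2.const_mul _)
      rw [← integral_const_mul, ← integral_const_mul, ← integral_const_mul,
        ← integral_add (i1.const_mul _) (i2.const_mul _), ← integral_add i12 (i3.const_mul _)]
      exact integral_congr_ae (ae_of_all _ fun ω => by ring)
    have key : ∀ τ : ℝ, |τ| = 1 → ∀ n : ℕ, 0 ≤ ε * (n : ℝ) ^ 2 + A * n
        + τ * (t n - (1 - q)⁻¹ * (n : ℝ) ^ 2) := by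
      intro τ hτ
      refine hM.nonneg_of_superharmonic (c := fun _ _ => 1) (N := N) (fun _ => measurable_const)
        (fun _ => ae_of_all _ fun _ => by norm_num)
        (u := fun n => ε * (n : ℝ) ^ 2 + A * n + τ * (t n - (1 - q)⁻¹ * (n : ℝ) ^ 2))
        (by omega) ?_ ?_
      · intro n hn
        rcases Nat.eq_zero_or_pos n with rfl | hpos
        · simp [ht0]
        · have h3 : |a n| ≤ A := Finset.single_le_sum (f := fun k => |a k|)
            (fun k _ => abs_nonneg _) (Finset.mem_range.2 hn)
          have h4 : |τ * (t n - (1 - q)⁻¹ * (n : ℝ) ^ 2)| = |a n| := by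
            rw [abs_mul, hτ, one_mul]
          have h5 := neg_abs_le (τ * (t n - (1 - q)⁻¹ * (n : ℝ) ^ 2))
          have h6 : (1 : ℝ) ≤ n := by exact_mod_cast hpos
          have h7 : 0 ≤ ε * (n : ℝ) ^ 2 := by positivity
          nlinarith
      · intro n hn
        simp only [hintg]
        rw [Finset.sum_add_distrib, Finset.sum_add_distrib, ← Finset.mul_sum, ← Finset.mul_sum,
          ← Finset.mul_sum]
        have h3 := hM.sum_size_le (n := n) (by omega)
        have h4 := herr n hn
        have h5 := ht n
        set S2 := ∑ j, ∫ ω, (I n j ω : ℝ) ^ 2 ∂P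
        set S1 := ∑ j, ∫ ω, (I n j ω : ℝ) ∂P
        set St := ∑ j, ∫ ω, t (I n j ω) ∂P
        have h6 : (ε - τ * (1 - q)⁻¹) * (S2 - q * (n : ℝ) ^ 2)
            ≤ ((1 - q)⁻¹ + ε) * (δ * (n : ℝ) ^ 2) := by
          refine (le_abs_self _).trans ?_
          rw [abs_mul]
          refine mul_le_mul ?_ h4 (abs_nonneg _) (by positivity)
          refine (abs_sub _ _).trans ?_
          rw [abs_mul, hτ, abs_of_pos hε, abs_of_pos (inv_pos.2 hp)]
          linarith
        have h7 : ((1 - q)⁻¹ + ε) * (δ * (n : ℝ) ^ 2) = ε * (1 - q) * (n : ℝ) ^ 2 := by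
          rw [hδ]
          field_simp
        have h8 : A * S1 ≤ A * n := mul_le_mul_of_nonneg_left h3 hA0
        have h9 : (1 - q)⁻¹ * (1 - q) = 1 := inv_mul_cancel₀ hp.ne'
        have h10 : τ * ((1 - q)⁻¹ * (1 - q)) * (n : ℝ) ^ 2 = τ * (n : ℝ) ^ 2 := by rw [h9]; ring
        rw [h5]
        nlinarith
    rw [abs_le]
    constructor
    · have := key 1 (by simp) n
      simp only [ha]
      linarith
    · have := key (-1) (by simp) n
      simp only [ha]
      linarith
  have hlim : Tendsto (fun n : ℕ => a n / (n : ℝ) ^ 2) atTop (𝓝 0) := by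
    rw [Metric.tendsto_atTop]
    intro ε hε
    obtain ⟨A, hA⟩ := hsuff (ε / 2) (by positivity)
    have h1 : Tendsto (fun n : ℕ => A * (n : ℝ)⁻¹) atTop (𝓝 0) := by
      simpa using (tendsto_inv_atTop_zero.comp tendsto_natCast_atTop_atTop).const_mul A
    obtain ⟨N, hN⟩ := eventually_atTop.1 (h1.eventually (gt_mem_nhds (half_pos hε)))
    refine ⟨N + 1, fun n hn => ?_⟩
    have hn0 : (0 : ℝ) < n := by
      have : 0 < n := by omega
      exact_mod_cast this
    rw [Real.dist_eq, sub_zero, abs_div, abs_of_pos (by positivity : (0 : ℝ) < (n : ℝ) ^ 2)]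
    have h2 := hN n (by omega)
    refine lt_of_le_of_lt (div_le_div_of_nonneg_right (hA n) (by positivity)) ?_
    have h3 : (ε / 2 * (n : ℝ) ^ 2 + A * n) / (n : ℝ) ^ 2 = ε / 2 + A * (n : ℝ)⁻¹ := by
      field_simp
    rw [h3]
    linarith
  have hfin := hlim.const_add (1 - q)⁻¹
  rw [add_zero] at hfin
  refine hfin.congr' ?_
  filter_upwards [eventually_gt_atTop 0] with n hn
  have hn0 : (n : ℝ) ≠ 0 := by exact_mod_cast hn.ne'
  simp only [ha]
  field_simp
  ring

end SizeModel

end SplitTree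

/-! ### Logarithmic growth for the size-biased recursion. -/

/-- The weight v compensates the slope 1/v of the logarithm when x ≥ v. When x < v, the slope bound
costs a weight x, and the remaining v - x is multiplied by log (v / x) ≤ log M. -/
theorem mul_abs_log_sub_log_le {v x M : ℝ} (hv : 0 < v) (hv1 : v ≤ 1) (hx : 0 < x)
    (hM : 1 ≤ M) (hxM : -Real.log x ≤ Real.log M) :
    v * |Real.log x - Real.log v| ≤ |x - v| * (1 + Real.log M) := by
  have hM0 : 0 ≤ Real.log M := Real.log_nonneg hM
  rcases le_or_gt v x with h | h
  · rw [abs_of_nonneg (sub_nonneg.2 (Real.log_le_log hv h)), abs_of_nonneg (sub_nonneg.2 h),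
      ← Real.log_div hx.ne' hv.ne']
    have h1 := Real.log_le_sub_one_of_pos (div_pos hx hv)
    have h2 : v * (x / v - 1) = x - v := by field_simp
    have h3 := mul_le_mul_of_nonneg_left h1 hv.le
    have h4 : 0 ≤ (x - v) * Real.log M := mul_nonneg (sub_nonneg.2 h) hM0
    linarith
  · have h0 : Real.log x ≤ Real.log v := Real.log_le_log hx h.le
    rw [abs_of_nonpos (sub_nonpos.2 h0), abs_of_nonpos (sub_nonpos.2 h.le)]
    have h1 := Real.log_le_sub_one_of_pos (div_pos hv hx)
    rw [Real.log_div hv.ne' hx.ne'] at h1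
    have h2 : x * (v / x - 1) = v - x := by field_simp
    have h3 := mul_le_mul_of_nonneg_left h1 hx.le
    have h4 : Real.log v - Real.log x ≤ Real.log M := by
      have := Real.log_nonpos hv.le hv1
      linarith
    have h5 := mul_le_mul_of_nonneg_left h4 (sub_nonneg.2 h.le)
    nlinarith

namespace SplitTree

namespace SizeModel

open Topology

set_option linter.unusedSectionVars false

variable {b : ℕ} {Ω : Type*} [MeasurableSpace Ω] {P : Measure Ω} [IsProbabilityMeasure P]
  {s s₀ : ℕ} {K : ℝ} {V : Ω → Fin b → ℝ} {I : ℕ → Fin b → Ω → ℕ}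

theorem integrable_entropy (hM : SizeModel P s s₀ K V I) (j : Fin b) :
    Integrable (fun ω => V ω j * Real.log (V ω j)) P :=
  hM.integrable_comp_coord j Real.continuous_mul_log

theorem entropy_pos (hM : SizeModel P s s₀ K V I) :
    0 < -∫ ω, ∑ j, V ω j * Real.log (V ω j) ∂P := by
  rw [← integral_neg]
  have hae : ∀ᵐ ω ∂P, 0 < -∑ j, V ω j * Real.log (V ω j) := by
    filter_upwards [hM.mem_simplex, hM.pos_lt_one] with ω hω h1
    have hne : (Finset.univ : Finset (Fin b)).Nonempty := by
      by_contra hcon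
      rw [Finset.not_nonempty_iff_eq_empty] at hcon
      have := hω.2
      rw [hcon] at this
      simp at this
    rw [← Finset.sum_neg_distrib]
    refine Finset.sum_pos (fun j _ => ?_) hne
    have h2 := Real.log_neg (h1 j).1 (h1 j).2
    have := mul_neg_of_pos_of_neg (h1 j).1 h2
    linarith
  rw [integral_pos_iff_support_of_nonneg_ae]
  · have : (Function.support fun ω => -∑ j, V ω j * Real.log (V ω j)) ∈ ae P := by
      filter_upwards [hae] with ω hω
      exact hω.ne'
    rw [measure_congr (eventuallyEq_univ.2 this), measure_univ]
    exact one_pos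
  · filter_upwards [hae] with ω hω
    exact hω.le
  · exact (integrable_finsetSum _ fun j _ => hM.integrable_entropy j).neg

theorem sum_integral_coord (hM : SizeModel P s s₀ K V I) : ∑ j, ∫ ω, V ω j ∂P = 1 := by
  have hi : ∀ j, Integrable (fun ω => V ω j) P := fun j =>
    hM.integrable_comp_coord j continuous_id
  rw [← integral_finsetSum _ fun j _ => hi j]
  have : ∀ᵐ ω ∂P, ∑ j, V ω j = 1 := by
    filter_upwards [hM.mem_simplex] with ω hω
    exact hω.2
  rw [integral_congr_ae this]
  simp

/-- Under size-biasing the logarithm of the size decreases on average by the entropy. The comparison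
of (I + 1)/(n + 1) with V uses `mul_abs_log_sub_log_le` with M = n + 1, since the shifted ratio is
at least 1/(n + 1), and the L¹ distance of the sizes. -/
theorem abs_sum_log_sub_le (hM : SizeModel P s s₀ K V I) (n : ℕ) :
    |∑ j, ∫ ω, V ω j * Real.log ((I n j ω : ℝ) + 1) ∂P - Real.log ((n : ℝ) + 1)
      - ∑ j, ∫ ω, V ω j * Real.log (V ω j) ∂P|
      ≤ b * ((√n + K + 1) / (n + 1) * (1 + Real.log ((n : ℝ) + 1))) := by
  have hlog0 : 0 ≤ Real.log ((n : ℝ) + 1) := Real.log_nonneg (by simp)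
  have i1 : ∀ j, Integrable (fun ω => V ω j * Real.log ((I n j ω : ℝ) + 1)) P := fun j =>
    hM.integrable_coord_mul_size_comp n j fun k => Real.log ((k : ℝ) + 1)
  have i2 : ∀ j, Integrable (fun ω => V ω j * Real.log ((n : ℝ) + 1)) P := fun j =>
    (hM.integrable_comp_coord j continuous_id).mul_const _
  have i3 : ∀ j, Integrable (fun ω => V ω j * Real.log ((I n j ω : ℝ) + 1)
      - V ω j * Real.log ((n : ℝ) + 1)) P := fun j => (i1 j).sub (i2 j)
  have hd : ∀ j, Integrable (fun ω => |(I n j ω : ℝ) - n * V ω j|) P := fun j =>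
    ((hM.integrable_size_comp n j fun k => (k : ℝ)).sub
      ((hM.integrable_comp_coord j continuous_id).const_mul _)).abs
  have h1 : Real.log ((n : ℝ) + 1) = ∑ j, ∫ ω, V ω j * Real.log ((n : ℝ) + 1) ∂P := by
    simp only [integral_mul_const]
    rw [← Finset.sum_mul, hM.sum_integral_coord, one_mul]
  have h2 : ∑ j, ∫ ω, V ω j * Real.log ((I n j ω : ℝ) + 1) ∂P - Real.log ((n : ℝ) + 1)
      - ∑ j, ∫ ω, V ω j * Real.log (V ω j) ∂P
      = ∑ j, ∫ ω, (V ω j * Real.log ((I n j ω : ℝ) + 1) - V ω j * Real.log ((n : ℝ) + 1)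
        - V ω j * Real.log (V ω j)) ∂P := by
    conv_lhs => rw [h1]
    rw [← Finset.sum_sub_distrib, ← Finset.sum_sub_distrib]
    refine Finset.sum_congr rfl fun j _ => ?_
    rw [integral_sub (i3 j) (hM.integrable_entropy j), integral_sub (i1 j) (i2 j)]
  rw [h2]
  refine (Finset.abs_sum_le_sum_abs _ _).trans ?_
  have h3 : ∀ j ∈ (Finset.univ : Finset (Fin b)),
      |∫ ω, (V ω j * Real.log ((I n j ω : ℝ) + 1) - V ω j * Real.log ((n : ℝ) + 1)
        - V ω j * Real.log (V ω j)) ∂P|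
      ≤ (√n + K + 1) / (n + 1) * (1 + Real.log ((n : ℝ) + 1)) := by
    intro j _
    refine abs_integral_le_integral_abs.trans ?_
    calc ∫ ω, |V ω j * Real.log ((I n j ω : ℝ) + 1) - V ω j * Real.log ((n : ℝ) + 1)
          - V ω j * Real.log (V ω j)| ∂P
        ≤ ∫ ω, (|(I n j ω : ℝ) - n * V ω j| + 1)
            * ((1 + Real.log ((n : ℝ) + 1)) / (n + 1)) ∂P := by
          refine integral_mono_ae ((i3 j).sub (hM.integrable_entropy j)).abs
            (((hd j).add (integrable_const 1)).mul_const _) ?_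
          filter_upwards [hM.pos_lt_one] with ω hω
          have hn : (0 : ℝ) < (n : ℝ) + 1 := by positivity
          have hI : (0 : ℝ) < (I n j ω : ℝ) + 1 := by positivity
          have h4 := mul_abs_log_sub_log_le (M := (n : ℝ) + 1) (hω j).1 (hω j).2.le (div_pos hI hn)
            (by simp) (by
              rw [Real.log_div hI.ne' hn.ne']
              have : 0 ≤ Real.log ((I n j ω : ℝ) + 1) := Real.log_nonneg (by simp)
              linarith)
          have h5 : |V ω j * Real.log ((I n j ω : ℝ) + 1) - V ω j * Real.log ((n : ℝ) + 1)
              - V ω j * Real.log (V ω j)|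
              = V ω j * |Real.log (((I n j ω : ℝ) + 1) / (n + 1)) - Real.log (V ω j)| := by
            rw [Real.log_div hI.ne' hn.ne', ← abs_of_pos (hω j).1, ← abs_mul, abs_of_pos (hω j).1]
            congr 1
            ring
          have h6 : |((I n j ω : ℝ) + 1) / (n + 1) - V ω j|
              ≤ (|(I n j ω : ℝ) - n * V ω j| + 1) / (n + 1) := by
            rw [show ((I n j ω : ℝ) + 1) / (n + 1) - V ω j
              = ((I n j ω - n * V ω j) + (1 - V ω j)) / (n + 1) by field_simp; ring,
              abs_div, abs_of_pos hn]
            refine div_le_div_of_nonneg_right ((abs_add_le _ _).trans ?_) hn.le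
            rw [abs_of_pos (by linarith [(hω j).2] : 0 < 1 - V ω j)]
            linarith [(hω j).1]
          rw [h5]
          refine h4.trans ((mul_le_mul_of_nonneg_right h6 (by linarith)).trans (le_of_eq ?_))
          ring
      _ ≤ (√n + K + 1) / (n + 1) * (1 + Real.log ((n : ℝ) + 1)) := by
          rw [integral_mul_const, integral_add (hd j) (integrable_const 1)]
          have h7 := hM.mean_dist n j
          simp only [integral_const, probReal_univ, smul_eq_mul, mul_one]
          rw [div_mul_eq_mul_div, mul_div_assoc]
          exact mul_le_mul_of_nonneg_right (by linarith) (by positivity)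
  refine (Finset.sum_le_sum h3).trans ?_
  simp

theorem tendsto_one_add_mul_exp_neg :
    Tendsto (fun y : ℝ => (1 + y) * Real.exp (-(y / 4))) atTop (𝓝 0) := by
  have h0 : Tendsto (fun y : ℝ => y / 4) atTop atTop :=
    tendsto_id.atTop_div_const (by norm_num)
  have h1 := (Real.tendsto_pow_mul_exp_neg_atTop_nhds_zero 0).comp h0
  have h2 := ((Real.tendsto_pow_mul_exp_neg_atTop_nhds_zero 1).comp h0).const_mul 4
  have h3 := h1.add h2
  simp only [mul_zero, add_zero] at h3
  refine h3.congr fun y => ?_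
  simp only [Function.comp_apply, pow_zero, pow_one, one_mul]
  ring

/-- Solutions of the recursion with size-biased weights and constant toll grow logarithmically. -/
theorem exists_abs_sub_log_le (hM : SizeModel P s s₀ K V I) {μ : ℝ}
    (hμ : μ = -∫ ω, ∑ j, V ω j * Real.log (V ω j) ∂P) {D : ℕ → ℝ}
    (hD : ∀ n, s < n → D n = 1 + ∑ j, ∫ ω, V ω j * D (I n j ω) ∂P) :
    ∃ A, ∀ n : ℕ, |D n - μ⁻¹ * Real.log ((n : ℝ) + 1)| ≤ A := by
  have hμ0 : 0 < μ := hμ ▸ hM.entropy_pos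
  set y : ℕ → ℝ := fun n => Real.log ((n : ℝ) + 1) with hy
  -- The barrier (n + 1)^(-1/4) decays more slowly than the error, which is of order n^(-1/2) log n,
  -- so that a small multiple of it dominates the error for large n.
  set g : ℕ → ℝ := fun n => Real.exp (-(y n / 4)) with hg
  have hy0 : ∀ n, 0 ≤ y n := fun n => Real.log_nonneg (by simp)
  have hg0 : ∀ n, 0 < g n := fun n => Real.exp_pos _
  have hg1 : ∀ n, g n ≤ 1 := fun n => Real.exp_le_one_iff.2 (by linarith [hy0 n])
  set e : ℕ → ℝ := fun n => ∑ j, ∫ ω, V ω j * y (I n j ω) ∂P - y n + μ with he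
  have hμ' : μ = -∑ j, ∫ ω, V ω j * Real.log (V ω j) ∂P := by
    rw [hμ, integral_finsetSum _ fun j _ => hM.integrable_entropy j]
  have heb : ∀ n, |e n| ≤ b * (K + 2) * ((1 + y n) * Real.exp (-(y n / 4))) * g n := by
    intro n
    have h1 := hM.abs_sum_log_sub_le n
    have h2 : e n = ∑ j, ∫ ω, V ω j * Real.log ((I n j ω : ℝ) + 1) ∂P - Real.log ((n : ℝ) + 1)
      - ∑ j, ∫ ω, V ω j * Real.log (V ω j) ∂P := by
      simp only [he, hy]
      rw [hμ']
      ring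
    rw [h2]
    refine h1.trans ?_
    have hn : (0 : ℝ) < (n : ℝ) + 1 := by positivity
    have h3 : √((n : ℝ) + 1) = Real.exp (y n / 2) := by
      rw [Real.exp_half, Real.exp_log hn]
    have h4 : (n : ℝ) + 1 = Real.exp (y n / 2) * Real.exp (y n / 2) := by
      rw [← Real.exp_add, add_halves, Real.exp_log hn]
    have h5 : √(n : ℝ) ≤ √((n : ℝ) + 1) := Real.sqrt_le_sqrt (by linarith)
    have h6 : 1 ≤ √((n : ℝ) + 1) := Real.one_le_sqrt.2 (by simp)
    have hK := hM.K_nonneg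
    have h7 : √(n : ℝ) + K + 1 ≤ (K + 2) * Real.exp (y n / 2) := by
      rw [← h3]
      nlinarith
    have h8 : Real.exp (-(y n / 4)) * g n = (Real.exp (y n / 2))⁻¹ := by
      rw [hg, ← Real.exp_add, ← Real.exp_neg]
      congr 1
      ring
    have h9 : (√(n : ℝ) + K + 1) / (n + 1) ≤ (K + 2) * (Real.exp (-(y n / 4)) * g n) := by
      rw [h8, div_le_iff₀ hn, h4]
      have := Real.exp_pos (y n / 2)
      calc √(n : ℝ) + K + 1 ≤ (K + 2) * Real.exp (y n / 2) := h7
        _ = _ := by field_simp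
    calc (b : ℝ) * ((√n + K + 1) / (n + 1) * (1 + y n))
        ≤ b * ((K + 2) * (Real.exp (-(y n / 4)) * g n) * (1 + y n)) := by
          refine mul_le_mul_of_nonneg_left (mul_le_mul_of_nonneg_right h9 ?_) (by positivity)
          linarith [hy0 n]
      _ = _ := by ring
  -- The first bound keeps the drift of y at most -μ/2, the second makes the error μ⁻¹ |e n| at most
  -- μ/8 times g n, which is the resulting gain of the barrier.
  set η : ℝ := min (μ / 2) (μ ^ 2 / 8) with hη
  have hη0 : 0 < η := lt_min (by positivity) (by positivity)
  have hylim : Tendsto y atTop atTop := Real.tendsto_log_atTop.comp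
    (tendsto_atTop_add_const_right _ _ tendsto_natCast_atTop_atTop)
  have hlim : Tendsto (fun n => b * (K + 2) * ((1 + y n) * Real.exp (-(y n / 4)))) atTop (𝓝 0) := by
    simpa using (tendsto_one_add_mul_exp_neg.comp hylim).const_mul (b * (K + 2))
  obtain ⟨N₀, hN₀⟩ := eventually_atTop.1 (hlim.eventually (gt_mem_nhds hη0))
  set N := max N₀ (s + 1) with hN
  have heN : ∀ n, N ≤ n → |e n| ≤ η * g n := fun n hn =>
    (heb n).trans (mul_le_mul_of_nonneg_right (hN₀ n (by omega)).le (hg0 n).le)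
  -- The summand 1 pays for the barrier, which is at most 1.
  set A : ℝ := 1 + ∑ k ∈ Finset.range N, |D k - μ⁻¹ * y k| with hA
  refine ⟨A, fun n => ?_⟩
  have iy : ∀ n j, Integrable (fun ω => V ω j * y (I n j ω)) P := fun n j =>
    hM.integrable_coord_mul_size_comp n j y
  have ig : ∀ n j, Integrable (fun ω => V ω j * g (I n j ω)) P := fun n j =>
    hM.integrable_coord_mul_size_comp n j g
  have iD : ∀ n j, Integrable (fun ω => V ω j * D (I n j ω)) P := fun n j =>
    hM.integrable_coord_mul_size_comp n j D
  have iV : ∀ j, Integrable (fun ω => V ω j) P := fun j =>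
    hM.integrable_comp_coord j continuous_id
  -- The exponential lies above its tangent at y n; averaging turns the negative drift of y into a
  -- gain for g.
  have hgle : ∀ n, g n * (1 + (μ - e n) / 4) ≤ ∑ j, ∫ ω, V ω j * g (I n j ω) ∂P := by
    intro n
    have h1 : g n * (1 + (μ - e n) / 4)
        = ∑ j, ∫ ω, (V ω j * (g n * (1 + y n / 4)) - V ω j * y (I n j ω) * (g n / 4)) ∂P := by
      have h2 : ∀ j, ∫ ω, (V ω j * (g n * (1 + y n / 4)) - V ω j * y (I n j ω) * (g n / 4)) ∂P
          = (∫ ω, V ω j ∂P) * (g n * (1 + y n / 4))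
            - (∫ ω, V ω j * y (I n j ω) ∂P) * (g n / 4) := fun j => by
        rw [integral_sub ((iV j).mul_const _) ((iy n j).mul_const _), integral_mul_const,
          integral_mul_const]
      simp only [h2]
      rw [Finset.sum_sub_distrib, ← Finset.sum_mul, ← Finset.sum_mul, hM.sum_integral_coord]
      simp only [he]
      ring
    rw [h1]
    refine Finset.sum_le_sum fun j _ => integral_mono_ae
      (((iV j).mul_const _).sub ((iy n j).mul_const _)) (ig n j) ?_
    filter_upwards [hM.ae_coord_mem j] with ω hω
    have h3 : g (I n j ω) = g n * Real.exp (-((y (I n j ω) - y n) / 4)) := by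
      simp only [hg]
      rw [← Real.exp_add]
      congr 1
      ring
    have h4 := Real.add_one_le_exp (-((y (I n j ω) - y n) / 4))
    rw [h3]
    have h5 := mul_le_mul_of_nonneg_left h4 (mul_nonneg hω.1 (hg0 n).le)
    nlinarith
  have key : ∀ τ : ℝ, |τ| = 1 → ∀ n : ℕ, 0 ≤ A - g n + τ * (D n - μ⁻¹ * y n) := by
    intro τ hτ
    refine hM.nonneg_of_superharmonic (c := fun j ω => V ω j) (N := N) hM.measurable_coord
      hM.ae_coord_mem (u := fun n => A - g n + τ * (D n - μ⁻¹ * y n)) (by omega) ?_ ?_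
    · intro n hn
      have h3 : |D n - μ⁻¹ * y n| ≤ ∑ k ∈ Finset.range N, |D k - μ⁻¹ * y k| :=
        Finset.single_le_sum (f := fun k => |D k - μ⁻¹ * y k|)
        (fun k _ => abs_nonneg _) (Finset.mem_range.2 hn)
      have h4 : |τ * (D n - μ⁻¹ * y n)| = |D n - μ⁻¹ * y n| := by
        rw [abs_mul, hτ, one_mul]
      have h5 := neg_abs_le (τ * (D n - μ⁻¹ * y n))
      have h6 := hg1 n
      linarith
    · intro n hn
      have hintg : ∀ j, ∫ ω, V ω j * (A - g (I n j ω) + τ * (D (I n j ω) - μ⁻¹ * y (I n j ω))) ∂P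
          = A * (∫ ω, V ω j ∂P) - (∫ ω, V ω j * g (I n j ω) ∂P)
            + τ * (∫ ω, V ω j * D (I n j ω) ∂P)
            - τ * μ⁻¹ * ∫ ω, V ω j * y (I n j ω) ∂P := by
        intro j
        have i1 : Integrable (fun ω => A * V ω j - V ω j * g (I n j ω)) P :=
          ((iV j).const_mul A).sub (ig n j)
        have i2 : Integrable (fun ω => A * V ω j - V ω j * g (I n j ω)
            + τ * (V ω j * D (I n j ω))) P := i1.add ((iD n j).const_mul τ)
        rw [← integral_const_mul, ← integral_const_mul, ← integral_const_mul,
          ← integral_sub ((iV j).const_mul A) (ig n j), ← integral_add i1 ((iD n j).const_mul τ),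
          ← integral_sub i2 ((iy n j).const_mul _)]
        exact integral_congr_ae (ae_of_all _ fun ω => by ring)
      simp only [hintg]
      rw [Finset.sum_sub_distrib, Finset.sum_add_distrib, Finset.sum_sub_distrib, ← Finset.mul_sum,
        ← Finset.mul_sum, ← Finset.mul_sum, hM.sum_integral_coord]
      have h3 := hD n (by omega)
      have h4 := heN n hn
      have h5 := hgle n
      have h6 : ∑ j, ∫ ω, V ω j * y (I n j ω) ∂P = y n - μ + e n := by
        simp only [he]
        ring
      rw [h6]
      have h7 : ∑ j, ∫ ω, V ω j * D (I n j ω) ∂P = D n - 1 := by linarith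
      rw [h7]
      have h8 : μ⁻¹ * μ = 1 := inv_mul_cancel₀ hμ0.ne'
      have h9 : -(τ * μ⁻¹ * e n) ≤ μ / 8 * g n := by
        have h10 : |τ * μ⁻¹ * e n| ≤ μ⁻¹ * (μ ^ 2 / 8 * g n) := by
          rw [abs_mul, abs_mul, hτ, one_mul, abs_of_pos (inv_pos.2 hμ0)]
          exact mul_le_mul_of_nonneg_left (h4.trans (mul_le_mul_of_nonneg_right (min_le_right _ _)
            (hg0 n).le)) (inv_pos.2 hμ0).le
        have h11 : μ⁻¹ * (μ ^ 2 / 8 * g n) = μ / 8 * g n := by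
          field_simp
        rw [h11] at h10
        linarith [neg_abs_le (τ * μ⁻¹ * e n)]
      have h12 : e n ≤ μ / 2 := by
        refine (le_abs_self _).trans (h4.trans ?_)
        have : η * g n ≤ η := mul_le_of_le_one_right hη0.le (hg1 n)
        exact this.trans (min_le_left _ _)
      have h13 : g n * (1 + μ / 8) ≤ g n * (1 + (μ - e n) / 4) :=
        mul_le_mul_of_nonneg_left (by linarith) (hg0 n).le
      have h14 : τ * μ⁻¹ * (y n - μ + e n) = τ * μ⁻¹ * y n - τ * (μ⁻¹ * μ) + τ * μ⁻¹ * e n := by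
        ring
      rw [h14, h8]
      linarith
  have h1 := key 1 (by simp) n
  have h2 := key (-1) (by simp) n
  have h3 := hg0 n
  rw [abs_le]
  constructor <;> linarith

end SizeModel

end SplitTree

/-! ### Sequences with bounded increments. -/

section LipschitzSequences

variable {H : ℕ → ℝ} {Λ : ℝ}

theorem abs_sub_le_of_increments (hΛ : ∀ n, |H (n + 1) - H n| ≤ Λ) (m n : ℕ) :
    |H m - H n| ≤ Λ * |(m : ℝ) - n| := by
  have key : ∀ n k : ℕ, |H (n + k) - H n| ≤ Λ * k := by
    intro n k
    induction k with
    | zero => simp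
    | succ k ih =>
      have h1 := hΛ (n + k)
      have h2 := abs_sub_le (H (n + k + 1)) (H (n + k)) (H n)
      rw [← add_assoc]
      push_cast
      linarith
  rcases le_total n m with h | h
  · obtain ⟨k, rfl⟩ := Nat.exists_eq_add_of_le h
    simpa using key n k
  · obtain ⟨k, rfl⟩ := Nat.exists_eq_add_of_le h
    rw [abs_sub_comm, abs_sub_comm (m : ℝ)]
    simpa using key m k

theorem abs_floor_sub_le (hΛ : ∀ n, |H (n + 1) - H n| ≤ Λ) {x y : ℝ} (hx : 0 ≤ x) (hy : 0 ≤ y) :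
    |H ⌊x⌋₊ - H ⌊y⌋₊| ≤ Λ * (|x - y| + 1) := by
  have hΛ0 : 0 ≤ Λ := (abs_nonneg _).trans (hΛ 0)
  refine (abs_sub_le_of_increments hΛ _ _).trans (mul_le_mul_of_nonneg_left ?_ hΛ0)
  have h1 := Nat.floor_le hx
  have h2 := Nat.floor_le hy
  have h3 := Nat.lt_floor_add_one x
  have h4 := Nat.lt_floor_add_one y
  have h5 := le_abs_self (x - y)
  have h6 := neg_abs_le (x - y)
  rw [abs_le]
  constructor <;> linarith

theorem abs_le_of_increments (h0 : H 0 = 0) (hΛ : ∀ n, |H (n + 1) - H n| ≤ Λ) (n : ℕ) :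
    |H n| ≤ Λ * n := by
  simpa [h0] using abs_sub_le_of_increments hΛ n 0

theorem abs_floor_le (h0 : H 0 = 0) (hΛ : ∀ n, |H (n + 1) - H n| ≤ Λ) {x : ℝ} (hx : 0 ≤ x) :
    |H ⌊x⌋₊| ≤ Λ * x := by
  have hΛ0 : 0 ≤ Λ := (abs_nonneg _).trans (hΛ 0)
  exact (abs_le_of_increments h0 hΛ _).trans (mul_le_mul_of_nonneg_left (Nat.floor_le hx) hΛ0)

/-- The logarithmic rescaling of a Lipschitz sequence is asymptotically uniformly continuous. -/
theorem abs_exp_neg_mul_floor_sub_le (h0 : H 0 = 0) (hΛ : ∀ n, |H (n + 1) - H n| ≤ Λ) (x y : ℝ) :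
    |Real.exp (-x) * H ⌊Real.exp x⌋₊ - Real.exp (-y) * H ⌊Real.exp y⌋₊|
      ≤ Λ * (2 * |Real.exp (y - x) - 1| + Real.exp (-x)) := by
  have h1 : Real.exp (-x) * H ⌊Real.exp x⌋₊ - Real.exp (-y) * H ⌊Real.exp y⌋₊
      = Real.exp (-x) * (H ⌊Real.exp x⌋₊ - H ⌊Real.exp y⌋₊)
        + Real.exp (-y) * (Real.exp (y - x) - 1) * H ⌊Real.exp y⌋₊ := by
    have h2 : Real.exp (-y) * Real.exp (y - x) = Real.exp (-x) := by
      rw [← Real.exp_add]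
      congr 1
      ring
    rw [mul_sub (Real.exp (-y)), h2]
    ring
  rw [h1]
  refine (abs_add_le _ _).trans ?_
  have h3 := abs_floor_sub_le hΛ (Real.exp_pos x).le (Real.exp_pos y).le
  have h4 := abs_floor_le h0 hΛ (Real.exp_pos y).le
  have h5 : Real.exp (-x) * |Real.exp x - Real.exp y| = |Real.exp (y - x) - 1| := by
    rw [← abs_of_pos (Real.exp_pos (-x)), ← abs_mul, mul_sub, ← Real.exp_add, ← Real.exp_add,
      abs_sub_comm, neg_add_cancel, Real.exp_zero, neg_add_eq_sub]
  have h6 : Real.exp (-y) * Real.exp y = 1 := by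
    rw [← Real.exp_add]
    simp
  rw [abs_mul, abs_mul, abs_mul, abs_of_pos (Real.exp_pos _), abs_of_pos (Real.exp_pos _)]
  have h7 := mul_le_mul_of_nonneg_left h3 (Real.exp_pos (-x)).le
  have h8 := mul_le_mul_of_nonneg_left h4
    (mul_nonneg (Real.exp_pos (-y)).le (abs_nonneg (Real.exp (y - x) - 1)))
  calc _ ≤ Real.exp (-x) * (Λ * (|Real.exp x - Real.exp y| + 1))
        + Real.exp (-y) * |Real.exp (y - x) - 1| * (Λ * Real.exp y) := add_le_add h7 h8
    _ = Λ * (Real.exp (-x) * |Real.exp x - Real.exp y|) + Λ * Real.exp (-x)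
        + (Real.exp (-y) * Real.exp y) * Λ * |Real.exp (y - x) - 1| := by ring
    _ = _ := by
      rw [h5, h6]
      ring

end LipschitzSequences

/-! ### Asymptotic linearity on multiplicative scales. -/

namespace SplitTree

namespace SizeModel

open Topology

set_option linter.unusedSectionVars false

variable {b : ℕ} {Ω : Type*} [MeasurableSpace Ω] {P : Measure Ω} [IsProbabilityMeasure P]
  {s s₀ : ℕ} {K : ℝ} {V : Ω → Fin b → ℝ} {I : ℕ → Fin b → Ω → ℕ}

theorem integrable_coord (hM : SizeModel P s s₀ K V I) (j : Fin b) :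
    Integrable (fun ω => V ω j) P :=
  hM.integrable_comp_coord j continuous_id

/-- The mean distance of I to n V is of order √n, so the ratios converge even in L¹. -/
theorem tendstoInMeasure_size (hM : SizeModel P s s₀ K V I) (j : Fin b) :
    TendstoInMeasure P (fun (n : ℕ) ω => (I n j ω : ℝ) / n) atTop (fun ω => V ω j) := by
  have hm : ∀ n : ℕ, Measurable fun ω => (I n j ω : ℝ) / n := fun n =>
    (measurable_from_nat.comp (hM.measurable_size n j)).div_const _
  refine tendstoInMeasure_of_tendsto_eLpNorm (p := 1) one_ne_zero
    (fun n => (hm n).aestronglyMeasurable) (hM.measurable_coord j).aestronglyMeasurable ?_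
  have hi : ∀ n : ℕ, Integrable ((fun ω => (I n j ω : ℝ) / n) - fun ω => V ω j) P := fun n =>
    (hM.integrable_size_comp n j fun k => (k : ℝ) / n).sub
      (hM.integrable_comp_coord j continuous_id)
  have h1 : ∀ n : ℕ, eLpNorm ((fun ω => (I n j ω : ℝ) / n) - fun ω => V ω j) 1 P
      = ENNReal.ofReal (∫ ω, |(I n j ω : ℝ) / n - V ω j| ∂P) := fun n => by
    rw [eLpNorm_one_eq_lintegral_enorm, ← ofReal_integral_norm_eq_lintegral_enorm (hi n)]
    rfl
  simp only [h1]
  rw [← ENNReal.ofReal_zero]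
  refine ENNReal.tendsto_ofReal ?_
  refine squeeze_zero' (Eventually.of_forall fun n => integral_nonneg fun ω => abs_nonneg _) ?_
    (tendsto_sqrt_add_div K)
  filter_upwards [eventually_gt_atTop 0] with n hn
  have hn0 : (0 : ℝ) < n := by exact_mod_cast hn
  have h2 : ∀ ω, |(I n j ω : ℝ) / n - V ω j| = |(I n j ω : ℝ) - n * V ω j| / n := fun ω => by
    rw [← abs_of_pos hn0, ← abs_div, abs_of_pos hn0]
    congr 1
    field_simp
  simp only [h2]
  rw [integral_div]
  exact div_le_div_of_nonneg_right (hM.mean_dist n j) hn0.le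

theorem tendsto_integral_comp_size (hM : SizeModel P s s₀ K V I) (j : Fin b) {f : ℝ → ℝ}
    (hf : Continuous f) :
    Tendsto (fun n : ℕ => ∫ ω, f ((I n j ω : ℝ) / n) ∂P) atTop (𝓝 (∫ ω, f (V ω j) ∂P)) := by
  obtain ⟨C, hC⟩ := isCompact_Icc.exists_bound_of_continuousOn
    (s := Set.Icc (0 : ℝ) 1) (f := f) hf.continuousOn
  refine tendsto_of_subseq_tendsto fun ns hns => ?_
  obtain ⟨ms, -, hms⟩ := ((hM.tendstoInMeasure_size j).comp hns).exists_seq_tendsto_ae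
  refine ⟨ms, tendsto_integral_of_dominated_convergence (fun _ => C) (fun k => ?_)
    (integrable_const C) (fun k => ae_of_all _ fun ω => hC _ ⟨by positivity, ?_⟩) ?_⟩
  · exact (hf.measurable.comp ((measurable_from_nat.comp
      (hM.measurable_size _ j)).div_const _)).aestronglyMeasurable
  · exact div_le_one_of_le₀ (by exact_mod_cast hM.size_le _ j ω) (by positivity)
  · filter_upwards [hms] with ω hω
    exact (hf.tendsto _).comp hω

/-- The law of the logarithm of a size-biased coordinate of the split vector. -/
noncomputable def logLaw (P : Measure Ω) (V : Ω → Fin b → ℝ) : Measure ℝ :=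
  ∑ j, (P.withDensity fun ω => ENNReal.ofReal (V ω j)).map fun ω => Real.log (V ω j)

theorem measurable_log_coord (hM : SizeModel P s s₀ K V I) (j : Fin b) :
    Measurable fun ω => Real.log (V ω j) := (hM.measurable_coord j).log

theorem isProbabilityMeasure_logLaw (hM : SizeModel P s s₀ K V I) :
    IsProbabilityMeasure (logLaw P V) := by
  refine ⟨?_⟩
  simp only [logLaw, Measure.finsetSum_apply]
  have h1 : ∀ j, (P.withDensity fun ω => ENNReal.ofReal (V ω j)).map (fun ω => Real.log (V ω j))
      Set.univ = ENNReal.ofReal (∫ ω, V ω j ∂P) := fun j => by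
    rw [Measure.map_apply (hM.measurable_log_coord j) MeasurableSet.univ, Set.preimage_univ,
      withDensity_apply _ MeasurableSet.univ, Measure.restrict_univ,
      ofReal_integral_eq_lintegral_ofReal (hM.integrable_coord j)]
    filter_upwards [hM.ae_coord_mem j] with ω hω
    exact hω.1
  simp only [h1]
  rw [← ENNReal.ofReal_sum_of_nonneg, hM.sum_integral_coord, ENNReal.ofReal_one]
  intro j _
  refine integral_nonneg_of_ae ?_
  filter_upwards [hM.ae_coord_mem j] with ω hω
  exact hω.1

/-- The exponential is injective and the coordinates have no atoms. This excludes lattice step laws,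
for which periodic harmonic functions would survive. -/
theorem nullSingletonClass_logLaw (hM : SizeModel P s s₀ K V I) :
    NullSingletonClass (logLaw P V) := by
  refine ⟨fun x => ?_⟩
  simp only [logLaw, Measure.finsetSum_apply]
  refine Finset.sum_eq_zero fun j _ => ?_
  rw [Measure.map_apply (hM.measurable_log_coord j) (measurableSet_singleton x)]
  refine withDensity_absolutelyContinuous P _ ?_
  rw [measure_eq_zero_iff_ae_notMem]
  have h1 : ∀ᵐ ω ∂P, V ω j ≠ Real.exp x := by
    rw [ae_iff]
    simpa using hM.null_singleton j (Real.exp x)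
  filter_upwards [h1, hM.pos_lt_one] with ω hω h2 h3
  exact hω (by rw [← (show Real.log (V ω j) = x from h3), Real.exp_log (h2 j).1])

theorem integral_logLaw (hM : SizeModel P s s₀ K V I) {f : ℝ → ℝ} (hf : Measurable f) {B : ℝ}
    (hB : ∀ x, |f x| ≤ B) :
    ∫ x, f x ∂(logLaw P V) = ∑ j, ∫ ω, V ω j * f (Real.log (V ω j)) ∂P := by
  have := hM.isProbabilityMeasure_logLaw
  have hle : ∀ j : Fin b, (P.withDensity fun ω => ENNReal.ofReal (V ω j)).map
      (fun ω => Real.log (V ω j)) ≤ logLaw P V := fun j => by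
    refine Measure.le_iff.2 fun A _ => ?_
    simp only [logLaw, Measure.finsetSum_apply]
    exact Finset.single_le_sum (f := fun j => ((P.withDensity fun ω =>
      ENNReal.ofReal (V ω j)).map fun ω => Real.log (V ω j)) A) (fun _ _ => zero_le)
      (Finset.mem_univ j)
  have hintg : Integrable f (logLaw P V) :=
    Integrable.of_bound hf.aestronglyMeasurable B (ae_of_all _ hB)
  rw [logLaw, integral_finsetSum_measure fun j _ => hintg.mono_measure (hle j)]
  refine Finset.sum_congr rfl fun j _ => ?_
  rw [integral_map (hM.measurable_log_coord j).aemeasurable hf.aestronglyMeasurable,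
    integral_withDensity_eq_integral_toReal_smul (hM.measurable_coord j).ennreal_ofReal
      (ae_of_all _ fun _ => ENNReal.ofReal_lt_top)]
  refine integral_congr_ae ?_
  filter_upwards [hM.ae_coord_mem j] with ω hω
  rw [ENNReal.toReal_ofReal hω.1, smul_eq_mul]

/-- A Lipschitz sequence that is asymptotically harmonic is asymptotically linear on
multiplicative scales. -/
theorem tendsto_floor_sub_div (hM : SizeModel P s s₀ K V I) {H : ℕ → ℝ} {Λ : ℝ} (h0 : H 0 = 0)
    (hΛ : ∀ n, |H (n + 1) - H n| ≤ Λ)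
    (hh : Tendsto (fun n : ℕ => (H n - ∑ j, ∫ ω, H (I n j ω) ∂P) / n) atTop (𝓝 0))
    {c : ℝ} (hc : 0 < c) :
    Tendsto (fun n : ℕ => (H ⌊(n : ℝ) * c⌋₊ - c * H n) / n) atTop (𝓝 0) := by
  have hΛ0 : 0 ≤ Λ := (abs_nonneg _).trans (hΛ 0)
  have := hM.isProbabilityMeasure_logLaw
  have := hM.nullSingletonClass_logLaw
  -- In the variable y = log n, multiplying n by V_j becomes a translation by log V_j, and the
  -- factor exp (-y) turns the sum over children into a mean under the size-biased law `logLaw`.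
  set h : ℝ → ℝ := fun y => Real.exp (-y) * H ⌊Real.exp y⌋₊ with hh'
  have hm : Measurable h := by
    refine (Real.measurable_exp.comp measurable_neg).mul ?_
    exact (measurable_from_nat (f := H)).comp (Nat.measurable_floor.comp Real.measurable_exp)
  have hB : ∀ x, |h x| ≤ Λ := fun x => by
    simp only [hh']
    rw [abs_mul, abs_of_pos (Real.exp_pos _)]
    have h1 := mul_le_mul_of_nonneg_left (abs_floor_le h0 hΛ (Real.exp_pos x).le)
      (Real.exp_pos (-x)).le
    refine h1.trans (le_of_eq ?_)
    rw [mul_left_comm, ← Real.exp_add]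
    simp
  have huc : ∀ ε > 0, ∃ δ > 0, ∃ R, ∀ x y, R ≤ x → R ≤ y → |x - y| < δ → |h x - h y| < ε := by
    intro ε hε
    set κ : ℝ := ε / (3 * (Λ + 1)) with hκ
    have hκ0 : 0 < κ := by positivity
    have h1 : Tendsto (fun z : ℝ => Real.exp z - 1) (𝓝 0) (𝓝 0) := by
      have := (Real.continuous_exp.sub continuous_const).tendsto (0 : ℝ) (f := fun z => Real.exp z - 1)
      simpa using this
    obtain ⟨δ, hδ, hδ'⟩ := Metric.tendsto_nhds_nhds.1 h1 κ hκ0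
    have h2 : Tendsto (fun x : ℝ => Real.exp (-x)) atTop (𝓝 0) :=
      Real.tendsto_exp_neg_atTop_nhds_zero
    obtain ⟨R, hR⟩ := eventually_atTop.1 (h2.eventually (gt_mem_nhds hκ0))
    refine ⟨δ, hδ, R, fun x y hx _ hxy => ?_⟩
    have h3 := abs_exp_neg_mul_floor_sub_le h0 hΛ x y
    have h4 := hδ' (x := y - x) (by rw [Real.dist_eq, sub_zero, abs_sub_comm]; exact hxy)
    rw [Real.dist_eq, sub_zero] at h4
    have h5 := hR x hx
    refine h3.trans_lt ?_
    calc Λ * (2 * |Real.exp (y - x) - 1| + Real.exp (-x)) ≤ Λ * (3 * κ) :=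
          mul_le_mul_of_nonneg_left (by linarith) hΛ0
      _ < (Λ + 1) * (3 * κ) := mul_lt_mul_of_pos_right (by linarith) (by positivity)
      _ = ε := by
          rw [hκ]
          field_simp
  have hharm : Tendsto (fun x => h x - ∫ y, h (x + y) ∂(logLaw P V)) atTop (𝓝 0) := by
    have hfl : Tendsto (fun x : ℝ => ⌊Real.exp x⌋₊) atTop atTop :=
      tendsto_nat_floor_atTop.comp Real.tendsto_exp_atTop
    -- The harmonicity defect of h at x is that of H at n = ⌊exp x⌋ plus the Lipschitz cost of
    -- replacing the sizes I n j by exp x * V_j.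
    have hbound : ∀ x : ℝ, 0 ≤ x → |h x - ∫ y, h (x + y) ∂(logLaw P V)|
        ≤ |(H ⌊Real.exp x⌋₊ - ∑ j, ∫ ω, H (I ⌊Real.exp x⌋₊ j ω) ∂P) / (⌊Real.exp x⌋₊ : ℕ)|
          + b * Λ * ((√(⌊Real.exp x⌋₊ : ℕ) + (K + 2)) / (⌊Real.exp x⌋₊ : ℕ)) := by
      intro x hx
      set n := ⌊Real.exp x⌋₊ with hn
      have hex : 1 ≤ Real.exp x := Real.one_le_exp hx
      have hn1 : 1 ≤ n := Nat.one_le_floor_iff _ |>.2 hex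
      have hn0 : (0 : ℝ) < n := by exact_mod_cast hn1
      have hnx : (n : ℝ) ≤ Real.exp x := Nat.floor_le (Real.exp_pos x).le
      have hxn : Real.exp x < n + 1 := Nat.lt_floor_add_one _
      rw [hM.integral_logLaw (f := fun y => h (x + y)) (hm.comp (measurable_const_add x))
        (fun y => hB _)]
      have hHm : ∀ j, Measurable fun ω => H ⌊Real.exp x * V ω j⌋₊ := fun j =>
        (measurable_from_nat (f := H)).comp
          (Nat.measurable_floor.comp ((hM.measurable_coord j).const_mul _))
      have hHi : ∀ j, Integrable (fun ω => H ⌊Real.exp x * V ω j⌋₊) P := fun j => by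
        refine Integrable.of_bound (hHm j).aestronglyMeasurable (Λ * Real.exp x) ?_
        filter_upwards [hM.ae_coord_mem j] with ω hω
        refine (abs_floor_le h0 hΛ (mul_nonneg (Real.exp_pos x).le hω.1)).trans ?_
        exact mul_le_mul_of_nonneg_left (mul_le_of_le_one_right (Real.exp_pos x).le hω.2) hΛ0
      have h1 : ∀ j, ∫ ω, V ω j * h (x + Real.log (V ω j)) ∂P
          = Real.exp (-x) * ∫ ω, H ⌊Real.exp x * V ω j⌋₊ ∂P := by
        intro j
        rw [← integral_const_mul]
        refine integral_congr_ae ?_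
        filter_upwards [hM.pos_lt_one] with ω hω
        simp only [hh']
        rw [neg_add, Real.exp_add, Real.exp_add, Real.exp_neg (Real.log _),
          Real.exp_log (hω j).1]
        have := (hω j).1.ne'
        field_simp
      simp only [h1]
      rw [← Finset.mul_sum]
      have hHI : ∀ j, Integrable (fun ω => H (I n j ω)) P := fun j => hM.integrable_size_comp n j H
      have hd : ∀ j, Integrable (fun ω => |(I n j ω : ℝ) - n * V ω j|) P := fun j =>
        ((hM.integrable_size_comp n j fun k => (k : ℝ)).sub
          ((hM.integrable_comp_coord j continuous_id).const_mul _)).abs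
      have h2 : ∀ j, |∫ ω, H (I n j ω) ∂P - ∫ ω, H ⌊Real.exp x * V ω j⌋₊ ∂P|
          ≤ Λ * (√n + (K + 2)) := by
        intro j
        rw [← integral_sub (hHI j) (hHi j)]
        refine abs_integral_le_integral_abs.trans ?_
        calc ∫ ω, |H (I n j ω) - H ⌊Real.exp x * V ω j⌋₊| ∂P
            ≤ ∫ ω, Λ * (|(I n j ω : ℝ) - n * V ω j| + 2) ∂P := by
              refine integral_mono_ae ((hHI j).sub (hHi j)).abs
                (((hd j).add (integrable_const 2)).const_mul _) ?_
              filter_upwards [hM.ae_coord_mem j] with ω hω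
              have h3 := abs_floor_sub_le hΛ (x := (I n j ω : ℝ)) (y := Real.exp x * V ω j)
                (by positivity) (mul_nonneg (Real.exp_pos x).le hω.1)
              rw [Nat.floor_natCast] at h3
              refine h3.trans (mul_le_mul_of_nonneg_left ?_ hΛ0)
              have h4 : (I n j ω : ℝ) - Real.exp x * V ω j
                  = ((I n j ω : ℝ) - n * V ω j) + ((n - Real.exp x) * V ω j) := by ring
              have h5 : |(n - Real.exp x) * V ω j| ≤ 1 := by
                rw [abs_mul, abs_of_nonneg hω.1]
                refine mul_le_one₀ ?_ hω.1 hω.2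
                rw [abs_le]
                constructor <;> linarith
              have h6 := abs_add_le ((I n j ω : ℝ) - n * V ω j) ((n - Real.exp x) * V ω j)
              rw [h4]
              linarith
          _ ≤ Λ * (√n + (K + 2)) := by
              rw [integral_const_mul, integral_add (hd j) (integrable_const 2)]
              have := hM.mean_dist n j
              refine mul_le_mul_of_nonneg_left ?_ hΛ0
              simp only [integral_const, probReal_univ, smul_eq_mul, one_mul]
              linarith
      have h7 : |∑ j, ∫ ω, H (I n j ω) ∂P - ∑ j, ∫ ω, H ⌊Real.exp x * V ω j⌋₊ ∂P|
          ≤ b * (Λ * (√n + (K + 2))) := by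
        rw [← Finset.sum_sub_distrib]
        refine (Finset.abs_sum_le_sum_abs _ _).trans
          ((Finset.sum_le_sum fun j _ => h2 j).trans ?_)
        simp
      have h8 : h x - Real.exp (-x) * ∑ j, ∫ ω, H ⌊Real.exp x * V ω j⌋₊ ∂P
          = Real.exp (-x) * ((H n - ∑ j, ∫ ω, H (I n j ω) ∂P)
            + (∑ j, ∫ ω, H (I n j ω) ∂P - ∑ j, ∫ ω, H ⌊Real.exp x * V ω j⌋₊ ∂P)) := by
        simp only [hh', ← hn]
        ring
      have h9 : Real.exp (-x) ≤ (n : ℝ)⁻¹ := by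
        rw [Real.exp_neg]
        exact inv_anti₀ hn0 hnx
      rw [h8, abs_mul, abs_of_pos (Real.exp_pos _)]
      refine (mul_le_mul h9 (abs_add_le _ _) (abs_nonneg _) (inv_pos.2 hn0).le).trans ?_
      rw [abs_div, abs_of_pos hn0]
      have h10 := mul_le_mul_of_nonneg_left h7 (inv_pos.2 hn0).le
      calc _ = |H n - ∑ j, ∫ ω, H (I n j ω) ∂P| / n
          + (n : ℝ)⁻¹ * |∑ j, ∫ ω, H (I n j ω) ∂P - ∑ j, ∫ ω, H ⌊Real.exp x * V ω j⌋₊ ∂P| := by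
            ring
        _ ≤ _ := by
            refine add_le_add le_rfl (h10.trans (le_of_eq ?_))
            ring
    have hlim : Tendsto (fun n : ℕ => |(H n - ∑ j, ∫ ω, H (I n j ω) ∂P) / n|
        + b * Λ * ((√n + (K + 2)) / n)) atTop (𝓝 0) := by
      simpa using hh.abs.add ((tendsto_sqrt_add_div (K + 2)).const_mul (b * Λ))
    refine squeeze_zero_norm' ?_ (hlim.comp hfl)
    filter_upwards [eventually_ge_atTop 0] with x hx
    exact hbound x hx
  -- The shift by log c at the points log n is multiplication of n by c.
  have hliou := tendsto_shift_sub_of_asymptotically_harmonic hm hB huc hharm (Real.log c)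
  have hl2 := (hliou.comp (Real.tendsto_log_atTop.comp tendsto_natCast_atTop_atTop)).const_mul c
  rw [mul_zero] at hl2
  refine hl2.congr' ?_
  filter_upwards [eventually_gt_atTop 0] with n hn
  have hn0 : (0 : ℝ) < n := by exact_mod_cast hn
  simp only [Function.comp_apply, hh']
  rw [neg_add, Real.exp_add, Real.exp_add, Real.exp_neg, Real.exp_neg, Real.exp_log hn0,
    Real.exp_log hc, Nat.floor_natCast]
  field_simp

end SizeModel

end SplitTree

/-! ### Limits of the tolls. -/

namespace SplitTree

namespace SizeModel

open Topology

set_option linter.unusedSectionVars false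

variable {b : ℕ} {Ω : Type*} [MeasurableSpace Ω] {P : Measure Ω} [IsProbabilityMeasure P]
  {s s₀ : ℕ} {K : ℝ} {V : Ω → Fin b → ℝ} {I : ℕ → Fin b → Ω → ℕ}

/-- The extra item of a tree with n + 1 items enters child j with conditional probability V_j, so
the increments of t solve the size-biased recursion with toll 1. They are therefore μ⁻¹ log n +
O(1), as are those of μ⁻¹ n log n. -/
theorem exists_abs_increment_le (hM : SizeModel P s s₀ K V I) {μ : ℝ}
    (hμ : μ = -∫ ω, ∑ j, V ω j * Real.log (V ω j) ∂P) {t : ℕ → ℝ}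
    (ht : ∀ n, t n = (n : ℝ) + ∑ j, ∫ ω, t (I n j ω) ∂P) :
    ∃ Λ, ∀ n : ℕ, |(t (n + 1) - μ⁻¹ * (((n + 1 : ℕ) : ℝ) * Real.log ((n + 1 : ℕ) : ℝ)))
      - (t n - μ⁻¹ * ((n : ℝ) * Real.log n))| ≤ Λ := by
  have hμ0 : 0 < μ := hμ ▸ hM.entropy_pos
  obtain ⟨A, hA⟩ := hM.exists_abs_sub_log_le hμ (D := fun n => t (n + 1) - t n) (fun n hn => by
    have h1 : ∀ j, ∫ ω, t (I (n + 1) j ω) ∂P - ∫ ω, t (I n j ω) ∂P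
        = ∫ ω, V ω j * (t (I n j ω + 1) - t (I n j ω)) ∂P := fun j => by
      rw [hM.increment n hn j t]
      exact integral_congr_ae (ae_of_all _ fun ω => mul_comm _ _)
    simp only [← h1]
    rw [Finset.sum_sub_distrib]
    have h2 := ht (n + 1)
    have h3 := ht n
    push_cast at h2
    linarith)
  refine ⟨A + μ⁻¹, fun n => ?_⟩
  have h1 : t (n + 1) - μ⁻¹ * (((n + 1 : ℕ) : ℝ) * Real.log ((n + 1 : ℕ) : ℝ))
      - (t n - μ⁻¹ * ((n : ℝ) * Real.log n))
      = (t (n + 1) - t n - μ⁻¹ * Real.log ((n : ℝ) + 1))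
        - μ⁻¹ * (n * (Real.log ((n : ℝ) + 1) - Real.log n)) := by
    push_cast
    ring
  rw [h1]
  refine (abs_sub _ _).trans (add_le_add (hA n) ?_)
  rw [abs_mul, abs_of_pos (inv_pos.2 hμ0)]
  refine mul_le_of_le_one_right (inv_pos.2 hμ0).le ?_
  rcases Nat.eq_zero_or_pos n with rfl | hn
  · simp
  · have hn0 : (0 : ℝ) < n := by exact_mod_cast hn
    have h2 : 0 ≤ Real.log ((n : ℝ) + 1) - Real.log n :=
      sub_nonneg.2 (Real.log_le_log hn0 (by linarith))
    rw [abs_of_nonneg (mul_nonneg hn0.le h2), ← Real.log_div (by positivity) hn0.ne']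
    have h3 := Real.log_le_sub_one_of_pos (x := ((n : ℝ) + 1) / n) (by positivity)
    calc (n : ℝ) * Real.log (((n : ℝ) + 1) / n) ≤ n * (((n : ℝ) + 1) / n - 1) :=
          mul_le_mul_of_nonneg_left h3 hn0.le
      _ = 1 := by
          field_simp
          ring

theorem tendsto_const_mul_log_div (c : ℝ) :
    Tendsto (fun n : ℕ => c * Real.log n / n) atTop (𝓝 0) := by
  have h1 : Tendsto (fun x : ℝ => Real.log x / x) atTop (𝓝 0) := by
    simpa using Real.isLittleO_log_id_atTop.tendsto_div_nhds_zero
  have h2 := (h1.comp tendsto_natCast_atTop_atTop).const_mul c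
  rw [mul_zero] at h2
  refine h2.congr fun n => ?_
  simp only [Function.comp_apply]
  ring

theorem natCast_mul_log_eq (i : ℕ) {n : ℕ} (hn : 0 < n) :
    (i : ℝ) * Real.log i = n * ((i : ℝ) / n * Real.log ((i : ℝ) / n)) + i * Real.log n := by
  have hn0 : (n : ℝ) ≠ 0 := by exact_mod_cast hn.ne'
  rcases Nat.eq_zero_or_pos i with rfl | hi
  · simp
  · have hi0 : (i : ℝ) ≠ 0 := by exact_mod_cast hi.ne'
    rw [Real.log_div hi0 hn0]
    field_simp
    ring

/-- The toll n of the recursion is cancelled to first order by the entropy of n log n: the sum of I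
log I is n times the sum of (I/n) log (I/n) plus (n - s₀) log n, and the first part has mean about
-μ n. -/
theorem tendsto_harmonic_defect (hM : SizeModel P s s₀ K V I) {μ : ℝ}
    (hμ : μ = -∫ ω, ∑ j, V ω j * Real.log (V ω j) ∂P) {t : ℕ → ℝ}
    (ht : ∀ n, t n = (n : ℝ) + ∑ j, ∫ ω, t (I n j ω) ∂P) :
    Tendsto (fun n : ℕ => ((t n - μ⁻¹ * ((n : ℝ) * Real.log n))
      - ∑ j, ∫ ω, (t (I n j ω) - μ⁻¹ * ((I n j ω : ℝ) * Real.log (I n j ω))) ∂P) / n)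
      atTop (𝓝 0) := by
  have hμ0 : 0 < μ := hμ ▸ hM.entropy_pos
  have h1 : Tendsto (fun n : ℕ => 1 + μ⁻¹ * (∑ j, ∫ ω, (I n j ω : ℝ) / n
      * Real.log ((I n j ω : ℝ) / n) ∂P - s₀ * Real.log n / n)) atTop
      (𝓝 (1 + μ⁻¹ * (∑ j, ∫ ω, V ω j * Real.log (V ω j) ∂P - 0))) :=
    (((tendsto_finsetSum _ fun j _ => hM.tendsto_integral_comp_size j
      Real.continuous_mul_log).sub (tendsto_const_mul_log_div s₀)).const_mul μ⁻¹).const_add 1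
  have h2 : 1 + μ⁻¹ * (∑ j, ∫ ω, V ω j * Real.log (V ω j) ∂P - 0) = 0 := by
    rw [← integral_finsetSum _ fun j _ => hM.integrable_entropy j, sub_zero,
      show ∫ ω, ∑ j, V ω j * Real.log (V ω j) ∂P = -μ by rw [hμ, neg_neg]]
    field_simp
    ring
  rw [h2] at h1
  refine h1.congr' ?_
  filter_upwards [eventually_gt_atTop s] with n hn
  have hn' : 0 < n := by omega
  have hn0 : (n : ℝ) ≠ 0 := by exact_mod_cast hn'.ne'
  have i1 : ∀ j, Integrable (fun ω => t (I n j ω)) P := fun j => hM.integrable_size_comp n j t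
  have i2 : ∀ j, Integrable (fun ω => (I n j ω : ℝ) * Real.log (I n j ω)) P := fun j =>
    hM.integrable_size_comp n j fun k => (k : ℝ) * Real.log k
  have i3 : ∀ j, Integrable (fun ω => (I n j ω : ℝ) / n * Real.log ((I n j ω : ℝ) / n)) P :=
    fun j => hM.integrable_size_comp n j fun k => (k : ℝ) / n * Real.log ((k : ℝ) / n)
  have i4 : ∀ j, Integrable (fun ω => (I n j ω : ℝ)) P := fun j =>
    hM.integrable_size_comp n j fun k => (k : ℝ)
  have h3 : ∀ j, ∫ ω, (t (I n j ω) - μ⁻¹ * ((I n j ω : ℝ) * Real.log (I n j ω))) ∂P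
      = ∫ ω, t (I n j ω) ∂P - μ⁻¹ * (n * ∫ ω, (I n j ω : ℝ) / n * Real.log ((I n j ω : ℝ) / n) ∂P
        + (∫ ω, (I n j ω : ℝ) ∂P) * Real.log n) := fun j => by
    rw [integral_sub (i1 j) ((i2 j).const_mul _), integral_const_mul, ← integral_const_mul (n : ℝ),
      ← integral_mul_const, ← integral_add ((i3 j).const_mul _) ((i4 j).mul_const _)]
    congr 3
    exact funext fun ω => natCast_mul_log_eq _ hn'
  have h4 : ∑ j, ∫ ω, (I n j ω : ℝ) ∂P = n - s₀ := by
    rw [← integral_finsetSum _ fun j _ => i4 j]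
    have h5 : ∀ ω, ∑ j, (I n j ω : ℝ) = n - s₀ := fun ω => by
      have := hM.sum_size n ω hn
      rw [eq_sub_iff_add_eq]
      exact_mod_cast this
    simp [h5]
  simp only [h3]
  rw [Finset.sum_sub_distrib, ← Finset.mul_sum, Finset.sum_add_distrib, ← Finset.mul_sum,
    ← Finset.sum_mul, h4]
  have h6 := ht n
  set St := ∑ j, ∫ ω, t (I n j ω) ∂P
  set Sf := ∑ j, ∫ ω, (I n j ω : ℝ) / n * Real.log ((I n j ω : ℝ) / n) ∂P
  rw [h6]
  field_simp
  ring

/-- The toll of the centred and rescaled recursion for the path length converges. -/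
theorem tendsto_linear_toll (hM : SizeModel P s s₀ K V I) {μ : ℝ}
    (hμ : μ = -∫ ω, ∑ j, V ω j * Real.log (V ω j) ∂P) {t : ℕ → ℝ} (ht0 : t 0 = 0)
    (ht : ∀ n, t n = (n : ℝ) + ∑ j, ∫ ω, t (I n j ω) ∂P)
    {ι : Type*} {l : Filter ι} {n : ι → ℕ} (hn : Tendsto n l atTop) {i : Fin b → ι → ℕ}
    (hi : ∀ k, s < n k → ∑ j, i j k + s₀ = n k) {v : Fin b → ℝ} (hv : v ∈ stdSimplex ℝ (Fin b))
    (hv0 : ∀ j, 0 < v j) (hlim : ∀ j, Tendsto (fun k => (i j k : ℝ) / n k) l (𝓝 (v j))) :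
    Tendsto (fun k => ((n k : ℝ) + ∑ j, t (i j k) - t (n k)) / n k) l
      (𝓝 (1 + 1 / μ * ∑ j, v j * Real.log (v j))) := by
  obtain ⟨Λ, hΛ⟩ := hM.exists_abs_increment_le hμ ht
  set H : ℕ → ℝ := fun n => t n - μ⁻¹ * ((n : ℝ) * Real.log n) with hH
  have hΛ0 : 0 ≤ Λ := (abs_nonneg _).trans (hΛ 0)
  have hH0 : H 0 = 0 := by simp [hH, ht0]
  have hdef := hM.tendsto_harmonic_defect hμ ht
  have hninv : Tendsto (fun k => ((n k : ℝ))⁻¹) l (𝓝 0) :=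
    (tendsto_inv_atTop_zero.comp tendsto_natCast_atTop_atTop).comp hn
  -- The child size is first replaced by ⌊n v_j⌋ at Lipschitz cost o(n), then multiplicative
  -- linearity applies.
  have h1 : ∀ j, Tendsto (fun k => (H (i j k) - v j * H (n k)) / n k) l (𝓝 0) := by
    intro j
    have h2 := (hM.tendsto_floor_sub_div (H := H) hH0 hΛ hdef (hv0 j)).comp hn
    have h3 : Tendsto (fun k => (H (i j k) - H ⌊(n k : ℝ) * v j⌋₊) / n k) l (𝓝 0) := by
      have h4 : Tendsto (fun k => Λ * (|(i j k : ℝ) / n k - v j| + (n k : ℝ)⁻¹)) l (𝓝 0) := by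
        have := (((hlim j).sub_const (v j)).abs.add hninv).const_mul Λ
        simpa using this
      refine squeeze_zero_norm' ?_ h4
      filter_upwards [hn.eventually_gt_atTop 0] with k hk
      have hk0 : (0 : ℝ) < n k := by exact_mod_cast hk
      have h5 := abs_floor_sub_le (H := H) hΛ (x := (i j k : ℝ)) (y := (n k : ℝ) * v j)
        (by positivity) (mul_nonneg hk0.le (hv0 j).le)
      rw [Nat.floor_natCast] at h5
      rw [Real.norm_eq_abs, abs_div, abs_of_pos hk0, div_le_iff₀ hk0]
      refine h5.trans (le_of_eq ?_)
      have h6 : |(i j k : ℝ) - n k * v j| = |(i j k : ℝ) / n k - v j| * n k := by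
        rw [← abs_of_pos hk0, ← abs_mul, abs_of_pos hk0]
        congr 1
        field_simp
      rw [h6]
      field_simp
    have h7 := h3.add h2
    rw [add_zero] at h7
    refine h7.congr fun k => ?_
    simp only [Function.comp_apply]
    ring
  have h2 : Tendsto (fun k => ∑ j, (H (i j k) - v j * H (n k)) / n k) l (𝓝 0) := by
    simpa using tendsto_finsetSum Finset.univ fun j _ => h1 j
  have h3 : Tendsto (fun k => ∑ j, (i j k : ℝ) / n k * Real.log ((i j k : ℝ) / n k)) l
      (𝓝 (∑ j, v j * Real.log (v j))) :=
    tendsto_finsetSum _ fun j _ => (Real.continuous_mul_log.tendsto (v j)).comp (hlim j)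
  have h4 := (h2.const_add 1).add
    ((h3.sub ((tendsto_const_mul_log_div s₀).comp hn)).const_mul μ⁻¹)
  rw [add_zero, sub_zero, ← one_div] at h4
  refine h4.congr' ?_
  filter_upwards [hn.eventually_gt_atTop s] with k hk
  have hk' : 0 < n k := by omega
  have hk0 : (n k : ℝ) ≠ 0 := by exact_mod_cast hk'.ne'
  simp only [Function.comp_apply]
  -- The corrections v_j H(n) recombine to H(n) because ∑ v_j = 1, so no asymptotics of H enter.
  have h5 : ∑ j, (H (i j k) - v j * H (n k)) / n k = (∑ j, H (i j k) - H (n k)) / n k := by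
    rw [← Finset.sum_div, Finset.sum_sub_distrib, ← Finset.sum_mul, hv.2, one_mul]
  have h6 : ∑ j, H (i j k) = ∑ j, t (i j k) - μ⁻¹ * (n k * ∑ j, (i j k : ℝ) / n k
      * Real.log ((i j k : ℝ) / n k) + (n k - s₀) * Real.log (n k)) := by
    have h7 : ∀ j, H (i j k) = t (i j k) - μ⁻¹ * (n k * ((i j k : ℝ) / n k
        * Real.log ((i j k : ℝ) / n k)) + i j k * Real.log (n k)) := fun j => by
      simp only [hH]
      rw [natCast_mul_log_eq (i j k) hk']
    have h8 : ∑ j, (i j k : ℝ) = n k - s₀ := by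
      rw [eq_sub_iff_add_eq]
      exact_mod_cast hi k hk
    simp only [h7]
    rw [Finset.sum_sub_distrib, ← Finset.mul_sum, Finset.sum_add_distrib, ← Finset.mul_sum,
      ← Finset.sum_mul, h8]
  rw [h5, h6]
  simp only [hH, one_div]
  set St := ∑ j, t (i j k)
  set Sf := ∑ j, (i j k : ℝ) / n k * Real.log ((i j k : ℝ) / n k)
  field_simp
  ring

theorem tendsto_atTop_of_tendsto_div {ι : Type*} {l : Filter ι} {n i : ι → ℕ}
    (hn : Tendsto n l atTop) {v : ℝ} (hv : 0 < v)
    (hlim : Tendsto (fun k => (i k : ℝ) / n k) l (𝓝 v)) : Tendsto i l atTop := by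
  have h1 : Tendsto (fun k => (i k : ℝ) / n k * n k) l atTop :=
    hlim.pos_mul_atTop hv (tendsto_natCast_atTop_atTop.comp hn)
  refine tendsto_natCast_atTop_iff (R := ℝ) |>.1 (h1.congr' ?_)
  filter_upwards [hn.eventually_gt_atTop 0] with k hk
  have hk0 : (n k : ℝ) ≠ 0 := by exact_mod_cast hk.ne'
  field_simp

/-- The toll of the centred and rescaled recursion for the sum of the squared subtree sizes
converges. -/
theorem tendsto_quadratic_toll (hM : SizeModel P s s₀ K V I) {q : ℝ}
    (hq : q = ∫ ω, ∑ j, V ω j ^ 2 ∂P) {t : ℕ → ℝ} (ht0 : t 0 = 0)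
    (ht : ∀ n, t n = (n : ℝ) ^ 2 + ∑ j, ∫ ω, t (I n j ω) ∂P)
    {ι : Type*} {l : Filter ι} {n : ι → ℕ} (hn : Tendsto n l atTop) {i : Fin b → ι → ℕ}
    {v : Fin b → ℝ} (hv0 : ∀ j, 0 < v j)
    (hlim : ∀ j, Tendsto (fun k => (i j k : ℝ) / n k) l (𝓝 (v j))) :
    Tendsto (fun k => ((n k : ℝ) ^ 2 + ∑ j, t (i j k) - t (n k)) / (n k : ℝ) ^ 2) l
      (𝓝 ((∑ j, v j ^ 2 - q) / (1 - q))) := by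
  have hlt := hM.tendsto_div_sq_of_recursion ht0 ht
  rw [← hq] at hlt
  have hq1 : q < 1 := hq ▸ hM.integral_sq_lt_one
  -- Positive limiting proportions send every child size to infinity, where the quadratic
  -- asymptotics apply.
  have hi : ∀ j, Tendsto (i j) l atTop := fun j =>
    tendsto_atTop_of_tendsto_div hn (hv0 j) (hlim j)
  have h2 := ((tendsto_finsetSum Finset.univ fun j _ =>
    (hlt.comp (hi j)).mul ((hlim j).pow 2)).const_add 1).sub (hlt.comp hn)
  have h3 : 1 + ∑ j, (1 - q)⁻¹ * v j ^ 2 - (1 - q)⁻¹ = (∑ j, v j ^ 2 - q) / (1 - q) := by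
    have : 1 - q ≠ 0 := by linarith
    rw [← Finset.mul_sum]
    field_simp
    ring
  rw [h3] at h2
  refine h2.congr' ?_
  have hipos : ∀ᶠ k in l, ∀ j, 0 < i j k := eventually_all.2 fun j => (hi j).eventually_gt_atTop 0
  filter_upwards [hn.eventually_gt_atTop 0, hipos] with k hk hik
  have hk0 : (n k : ℝ) ≠ 0 := by exact_mod_cast hk.ne'
  simp only [Function.comp_apply]
  rw [sub_div, add_div, div_self (by positivity), Finset.sum_div]
  congr 2
  refine Finset.sum_congr rfl fun j _ => ?_
  have hik0 : (i j k : ℝ) ≠ 0 := by exact_mod_cast (hik j).ne'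
  field_simp

end SizeModel

end SplitTree

/-! ### Characteristic functions at converging arguments. -/

open Topology in
/-- Characteristic functions converge along convergent sequences of arguments. -/
theorem tendsto_integral_exp_of_tendstoInDistribution {Ω Ω' : Type*} [MeasurableSpace Ω]
    [MeasurableSpace Ω'] {P : Measure Ω} [IsProbabilityMeasure P] {P' : Measure Ω'}
    [IsProbabilityMeasure P'] {X : ℕ → Ω → ℝ × ℝ} {Z : Ω' → ℝ × ℝ}
    (h : TendstoInDistribution X atTop Z (fun _ => P) P') {m : ℕ → ℕ} (hm : Tendsto m atTop atTop)
    {z : ℕ → ℝ × ℝ} {w : ℝ × ℝ} (hz : Tendsto z atTop (𝓝 w)) :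
    Tendsto (fun k => ∫ ω, Complex.exp ((((z k).1 * (X (m k) ω).1 + (z k).2 * (X (m k) ω).2 : ℝ) : ℂ)
      * Complex.I) ∂P) atTop (𝓝 (planarCharFun (P'.map Z) w)) := by
  have h1 : TendstoInDistribution (fun k => X (m k)) atTop Z (fun _ => P) P' :=
    ⟨fun k => h.forall_aemeasurable (m k), h.aemeasurable_limit, h.tendsto.comp hm⟩
  -- Slutsky: adjoining the deterministic argument z k, joint convergence allows one bounded
  -- continuous function of both to be tested.
  have h2 : TendstoInMeasure P (fun k (_ : Ω) => z k) atTop (fun _ => w) :=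
    tendstoInMeasure_of_tendsto_ae (fun _ => aestronglyMeasurable_const) (ae_of_all _ fun _ => hz)
  have h3 := h1.prodMk_of_tendstoInMeasure_const _ _ _ h2 fun _ => aemeasurable_const
  set f : BoundedContinuousFunction ((ℝ × ℝ) × (ℝ × ℝ)) ℂ :=
    BoundedContinuousFunction.ofNormedAddCommGroup
      (fun p => Complex.exp (((p.2.1 * p.1.1 + p.2.2 * p.1.2 : ℝ) : ℂ) * Complex.I)) (by fun_prop) 1
      (fun p => norm_exp_ofReal_mul_I_le _) with hf
  have h4 := (ProbabilityMeasure.tendsto_iff_forall_integral_rclike_tendsto ℂ).1 h3.tendsto f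
  have hfm : ∀ μ, AEStronglyMeasurable f μ := fun μ => f.continuous.aestronglyMeasurable
  simp only [ProbabilityMeasure.coe_mk] at h4
  rw [integral_map h3.aemeasurable_limit (hfm _)] at h4
  rw [planarCharFun, integral_map h.aemeasurable_limit (Continuous.aestronglyMeasurable
    (by fun_prop))]
  refine h4.congr fun k => ?_
  rw [integral_map (h3.forall_aemeasurable k) (hfm _)]
  rfl

/-! ### Recursion for the characteristic functions of the centred pair. -/

namespace SplitTree

namespace IsRouting

open Topology

set_option linter.unusedSectionVars false

variable {b : ℕ} {Ω : Type*} [MeasurableSpace Ω] {P : Measure Ω} [IsProbabilityMeasure P]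
  {σ : Measure (Fin b → ℝ)} [IsProbabilityMeasure σ] {V : List (Fin b) → Ω → (Fin b → ℝ)}
  {J : List (Fin b) → ℕ → Ω → Fin b} {s s₀ s₁ : ℕ} {K : ℝ}

/-- Conditioning on the sizes of the subtrees of the root. -/
theorem integral_sizes_mul_prod_subroutes (hJ : IsRouting P σ V J) (n : ℕ)
    (G : (Fin b → ℕ) → ℂ) {h : Fin b → ℕ → (List (Fin b) → ℕ → Fin b) → ℂ}
    (hh : ∀ j i, Measurable (h j i)) (hh1 : ∀ j i r, ‖h j i r‖ ≤ 1) (hs₁ : s₀ + b * s₁ ≤ s + 1) :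
    ∫ ω, G (fun j => childSize s s₀ s₁ n (fun k => J [] k ω) j)
        * ∏ j, h j (childSize s s₀ s₁ n (fun k => J [] k ω) j) (fun u k => J (j :: u) k ω) ∂P
      = ∫ ω, G (fun j => childSize s s₀ s₁ n (fun k => J [] k ω) j)
        * ∏ j, ∫ ω', h j (childSize s s₀ s₁ n (fun k => J [] k ω) j) (fun u k => J u k ω') ∂P ∂P := by
  classical
  set N : (ℕ → Fin b) → Fin b → ℕ := fun c j => childSize s s₀ s₁ n c j with hN
  -- Only finitely many size vectors occur. On each, the sizes are constants and independence of the
  -- root choices and the subtrees factorises the mean.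
  set S : Finset (Fin b → ℕ) := Fintype.piFinset fun _ => Finset.range (n + 1) with hS
  have hmem : ∀ c, N c ∈ S := fun c => Fintype.mem_piFinset.2 fun j =>
    Finset.mem_range.2 (Nat.lt_succ_of_le (childSize_le hs₁ n c j))
  have hNm : Measurable N := measurable_pi_lambda _ fun j => measurable_childSize s s₀ s₁ n j
  set g : (Fin b → ℕ) → (ℕ → Fin b) → ℂ := fun a c => if N c = a then G a else 0 with hg
  have hgm : ∀ a, Measurable (g a) := fun a =>
    Measurable.ite (hNm (measurableSet_singleton a)) measurable_const measurable_const
  have hgi : ∀ a, Integrable (fun ω => g a (fun k => J [] k ω)) P := fun a => by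
    refine Integrable.of_bound ((hgm a).comp (hJ.measurable_choices [])).aestronglyMeasurable ‖G a‖
      (ae_of_all _ fun ω => ?_)
    simp only [hg]
    split_ifs <;> simp
  have hsplit : ∀ (c : ℕ → Fin b) (f : (Fin b → ℕ) → ℂ),
      G (N c) * f (N c) = ∑ a ∈ S, g a c * f a := by
    intro c f
    rw [Finset.sum_eq_single (N c)]
    · simp [hg]
    · intro a _ ha
      simp [hg, Ne.symm ha]
    · exact fun hcon => absurd (hmem c) hcon
  have hL : ∀ ω, G (N fun k => J [] k ω) * ∏ j, h j (N (fun k => J [] k ω) j)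
      (fun u k => J (j :: u) k ω) = ∑ a ∈ S, g a (fun k => J [] k ω)
        * ∏ j, h j (a j) (fun u k => J (j :: u) k ω) := fun ω =>
    hsplit _ fun a => ∏ j, h j (a j) (fun u k => J (j :: u) k ω)
  have hR : ∀ ω, G (N fun k => J [] k ω) * ∏ j, ∫ ω', h j (N (fun k => J [] k ω) j)
      (fun u k => J u k ω') ∂P = ∑ a ∈ S, g a (fun k => J [] k ω)
        * ∏ j, ∫ ω', h j (a j) (fun u k => J u k ω') ∂P := fun ω =>
    hsplit _ fun a => ∏ j, ∫ ω', h j (a j) (fun u k => J u k ω') ∂P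
  calc _ = ∫ ω, ∑ a ∈ S, g a (fun k => J [] k ω)
        * ∏ j, h j (a j) (fun u k => J (j :: u) k ω) ∂P := integral_congr_ae (ae_of_all _ hL)
    _ = ∑ a ∈ S, ∫ ω, g a (fun k => J [] k ω)
        * ∏ j, h j (a j) (fun u k => J (j :: u) k ω) ∂P := by
      refine integral_finsetSum _ fun a _ => ?_
      refine (hgi a).mul_bdd (c := 1) ?_ ?_
      · exact (Finset.measurable_prod _ fun j _ =>
          (hh j (a j)).comp (hJ.measurable_subroute j)).aestronglyMeasurable
      · refine ae_of_all _ fun ω => ?_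
        rw [norm_prod]
        exact Finset.prod_le_one (fun _ _ => norm_nonneg _) fun j _ => hh1 _ _ _
    _ = ∑ a ∈ S, ∫ ω, g a (fun k => J [] k ω)
        * ∏ j, ∫ ω', h j (a j) (fun u k => J u k ω') ∂P ∂P := by
      refine Finset.sum_congr rfl fun a _ => ?_
      rw [hJ.integral_root_mul_prod_subroutes (hgm a) fun j => hh j (a j), integral_mul_const]
    _ = ∫ ω, ∑ a ∈ S, g a (fun k => J [] k ω)
        * ∏ j, ∫ ω', h j (a j) (fun u k => J u k ω') ∂P ∂P :=
      (integral_finsetSum _ fun a _ => (hgi a).mul_const _).symm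
    _ = _ := integral_congr_ae (ae_of_all _ fun ω => (hR ω).symm)

/-- The centred and rescaled sums of the squared subtree sizes and of the subtree sizes. -/
noncomputable def centredPair (P : Measure Ω) (J : List (Fin b) → ℕ → Ω → Fin b) (s s₀ s₁ n : ℕ)
    (r : List (Fin b) → ℕ → Fin b) : ℝ × ℝ :=
  (((powerSum 2 s s₀ s₁ r n).toReal - meanPowerSum P J s s₀ s₁ 2 n) / (n : ℝ) ^ 2,
    ((powerSum 1 s s₀ s₁ r n).toReal - meanPowerSum P J s s₀ s₁ 1 n) / n)

theorem measurable_centredPair (n : ℕ) : Measurable (centredPair P J s s₀ s₁ n) :=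
  (((measurable_powerSum s s₀ s₁ 2 n).ennreal_toReal.sub_const _).div_const _).prodMk
    (((measurable_powerSum s s₀ s₁ 1 n).ennreal_toReal.sub_const _).div_const _)

/-- The characteristic function of the centred and rescaled pair. -/
noncomputable def pairCharFun (P : Measure Ω) (J : List (Fin b) → ℕ → Ω → Fin b) (s s₀ s₁ n : ℕ)
    (z : ℝ × ℝ) : ℂ :=
  ∫ ω, Complex.exp (((z.1 * (centredPair P J s s₀ s₁ n fun u k => J u k ω).1
    + z.2 * (centredPair P J s s₀ s₁ n fun u k => J u k ω).2 : ℝ) : ℂ) * Complex.I) ∂P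

theorem norm_pairCharFun_le (n : ℕ) (z : ℝ × ℝ) : ‖pairCharFun P J s s₀ s₁ n z‖ ≤ 1 := by
  have := norm_integral_le_of_norm_le_const (μ := P)
    (ae_of_all _ fun ω => norm_exp_ofReal_mul_I_le
      (z.1 * (centredPair P J s s₀ s₁ n fun u k => J u k ω).1
        + z.2 * (centredPair P J s s₀ s₁ n fun u k => J u k ω).2))
  simpa [pairCharFun] using this

/-- The toll of the centred and rescaled recursion for the sums of `p`-th powers, if the subtrees
of the root have the sizes `i j`. -/
noncomputable def centredToll (P : Measure Ω) (J : List (Fin b) → ℕ → Ω → Fin b) (s s₀ s₁ p n : ℕ)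
    (i : Fin b → ℕ) : ℝ :=
  ((n : ℝ) ^ p + ∑ j, meanPowerSum P J s s₀ s₁ p (i j) - meanPowerSum P J s s₀ s₁ p n) / (n : ℝ) ^ p

/-- Centring each child by its own mean moves the difference of the means into the toll, and the
change of normalisation produces the p-th power of the relative child size. For p = 2 and p = 1
these are the two weights of `dilate₂`. -/
theorem centred_powerSum_div_eq {p : ℕ} (hp : p ≠ 0) {r : List (Fin b) → ℕ → Fin b} {n : ℕ}
    (hn : 0 < n) (hr : powerSum p s s₀ s₁ r n ≠ ⊤) :
    ((powerSum p s s₀ s₁ r n).toReal - meanPowerSum P J s s₀ s₁ p n) / (n : ℝ) ^ p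
      = centredToll P J s s₀ s₁ p n (fun j => childSize s s₀ s₁ n (r []) j)
        + ∑ j, ((childSize s s₀ s₁ n (r []) j : ℝ) / n) ^ p
          * (((powerSum p s s₀ s₁ (fun w => r (j :: w)) (childSize s s₀ s₁ n (r []) j)).toReal
            - meanPowerSum P J s s₀ s₁ p (childSize s s₀ s₁ n (r []) j))
              / (childSize s s₀ s₁ n (r []) j : ℝ) ^ p) := by
  have hn0 : (n : ℝ) ≠ 0 := by exact_mod_cast hn.ne'
  have h1 : ∀ j, ((childSize s s₀ s₁ n (r []) j : ℝ) / n) ^ p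
      * (((powerSum p s s₀ s₁ (fun w => r (j :: w)) (childSize s s₀ s₁ n (r []) j)).toReal
        - meanPowerSum P J s s₀ s₁ p (childSize s s₀ s₁ n (r []) j))
          / (childSize s s₀ s₁ n (r []) j : ℝ) ^ p)
      = ((powerSum p s s₀ s₁ (fun w => r (j :: w)) (childSize s s₀ s₁ n (r []) j)).toReal
        - meanPowerSum P J s s₀ s₁ p (childSize s s₀ s₁ n (r []) j)) / (n : ℝ) ^ p := by
    intro j
    -- An empty child needs care since division by zero is 0; here both numerators vanish anyway.
    rcases Nat.eq_zero_or_pos (childSize s s₀ s₁ n (r []) j) with h | h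
    · rw [h]
      simp [powerSum_zero hp, meanPowerSum_zero hp]
    · have hi0 : (childSize s s₀ s₁ n (r []) j : ℝ) ≠ 0 := by exact_mod_cast h.ne'
      rw [div_pow]
      field_simp
  simp only [h1]
  have hrec := powerSum_eq (s := s) (s₀ := s₀) (s₁ := s₁) p r n
  rw [hrec] at hr
  have h2 := (ENNReal.add_ne_top.1 hr).1
  have h3 := (ENNReal.add_ne_top.1 hr).2
  rw [hrec, ENNReal.toReal_add h2 h3, ENNReal.toReal_sum (ENNReal.sum_ne_top.1 h3),
    ENNReal.toReal_pow, ENNReal.toReal_natCast, ← Finset.sum_div, Finset.sum_sub_distrib,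
    centredToll, ← add_div]
  congr 1
  ring

/-- The affine recursion at the root turns into a product after exponentiation, and conditioning on
the child sizes makes the factors characteristic functions at dilated arguments. -/
theorem pairCharFun_eq (hJ : IsRouting P σ V J)
    (hM : SizeModel P s s₀ K (V []) (fun n j ω => childSize s s₀ s₁ n (fun k => J [] k ω) j))
    (hs₁ : s₀ + b * s₁ ≤ s + 1) {n : ℕ} (hn : 0 < n) (z : ℝ × ℝ) :
    pairCharFun P J s s₀ s₁ n z
      = ∫ ω, Complex.exp (((z.1 * centredToll P J s s₀ s₁ 2 n
            (fun j => childSize s s₀ s₁ n (fun k => J [] k ω) j)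
          + z.2 * centredToll P J s s₀ s₁ 1 n
            (fun j => childSize s s₀ s₁ n (fun k => J [] k ω) j) : ℝ) : ℂ) * Complex.I)
        * ∏ j, pairCharFun P J s s₀ s₁ (childSize s s₀ s₁ n (fun k => J [] k ω) j)
            (dilate₂ ((childSize s s₀ s₁ n (fun k => J [] k ω) j : ℝ) / n) z) ∂P := by
  set h : Fin b → ℕ → (List (Fin b) → ℕ → Fin b) → ℂ := fun _ i r =>
    Complex.exp ((((dilate₂ ((i : ℝ) / n) z).1 * (centredPair P J s s₀ s₁ i r).1
      + (dilate₂ ((i : ℝ) / n) z).2 * (centredPair P J s s₀ s₁ i r).2 : ℝ) : ℂ) * Complex.I) with hh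
  have hhm : ∀ j i, Measurable (h j i) := fun j i => by
    have h1 : Continuous fun y : ℝ × ℝ => Complex.exp ((((dilate₂ ((i : ℝ) / n) z).1 * y.1
      + (dilate₂ ((i : ℝ) / n) z).2 * y.2 : ℝ) : ℂ) * Complex.I) := by fun_prop
    exact h1.measurable.comp (measurable_centredPair i)
  have key := hJ.integral_sizes_mul_prod_subroutes (s := s) (s₀ := s₀) (s₁ := s₁) n
    (fun i => Complex.exp (((z.1 * centredToll P J s s₀ s₁ 2 n i
      + z.2 * centredToll P J s s₀ s₁ 1 n i : ℝ) : ℂ) * Complex.I)) (h := h) hhm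
    (fun j i r => norm_exp_ofReal_mul_I_le _) hs₁
  refine Eq.trans ?_ key
  refine integral_congr_ae ?_
  filter_upwards [hJ.ae_powerSum_ne_top hM hs₁ (Or.inl rfl) n,
    hJ.ae_powerSum_ne_top hM hs₁ (Or.inr rfl) n] with ω h1 h2
  have e1 := centred_powerSum_div_eq (P := P) (J := J) one_ne_zero hn h1
  have e2 := centred_powerSum_div_eq (P := P) (J := J) two_ne_zero hn h2
  simp only [pow_one] at e1
  simp only [hh]
  rw [← Complex.exp_sum, ← Complex.exp_add, ← Finset.sum_mul, ← add_mul, ← Complex.ofReal_sum,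
    ← Complex.ofReal_add]
  congr 3
  simp only [centredPair, dilate₂]
  rw [e1, e2, mul_add, mul_add, Finset.mul_sum, Finset.mul_sum, Finset.sum_add_distrib]
  simp only [mul_assoc]
  ring

end IsRouting

end SplitTree

/-! ### Fixed point equation of the limit law. -/

namespace SplitTree

open Topology

set_option linter.unusedSectionVars false

variable {b : ℕ} {Ω : Type*} [MeasurableSpace Ω] {P : Measure Ω} [IsProbabilityMeasure P]
  {σ : Measure (Fin b → ℝ)} [IsProbabilityMeasure σ]
  {s s₀ s₁ : ℕ} {K : ℝ}

/-- Convergence in measure yields an almost surely convergent subsequence for each coordinate; they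
are extracted one after another. A subsequence is enough, because the left side of the recursion
converges along any. -/
theorem SizeModel.exists_subseq_tendsto_ae {V : Ω → Fin b → ℝ} {I : ℕ → Fin b → Ω → ℕ}
    (hM : SizeModel P s s₀ K V I) : ∃ ns : ℕ → ℕ, Tendsto ns atTop atTop ∧
      ∀ᵐ ω ∂P, ∀ j, Tendsto (fun k => (I (ns k) j ω : ℝ) / ns k) atTop (𝓝 (V ω j)) := by
  have key : ∀ S : Finset (Fin b), ∃ ns : ℕ → ℕ, Tendsto ns atTop atTop ∧
      ∀ j ∈ S, ∀ᵐ ω ∂P, Tendsto (fun k => (I (ns k) j ω : ℝ) / ns k) atTop (𝓝 (V ω j)) := by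
    intro S
    induction S using Finset.induction_on with
    | empty => exact ⟨id, tendsto_id, by simp⟩
    | insert j S _ ih =>
      obtain ⟨ns, hns, h⟩ := ih
      obtain ⟨ms, hms, h'⟩ := ((hM.tendstoInMeasure_size j).comp hns).exists_seq_tendsto_ae
      refine ⟨fun k => ns (ms k), hns.comp hms.tendsto_atTop, fun i hi => ?_⟩
      rcases Finset.mem_insert.1 hi with rfl | hi
      · exact h'
      · filter_upwards [h i hi] with ω hω
        exact hω.comp hms.tendsto_atTop
  obtain ⟨ns, hns, h⟩ := key Finset.univ
  exact ⟨ns, hns, ae_all_iff.2 fun j => h j (Finset.mem_univ j)⟩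

theorem measurable_toll : Measurable (toll σ) := by
  unfold toll
  exact ((Finset.measurable_sum _ fun j _ => (measurable_pi_apply j).mul
    (measurable_pi_apply j).log).const_mul _).const_add 1

theorem measurable_sum_sq_sub_div (q : ℝ) :
    Measurable fun v : Fin b → ℝ => (∑ j, v j ^ 2 - q) / (1 - q) :=
  ((Finset.measurable_sum _ fun j _ => (measurable_pi_apply j).pow_const 2).sub_const q).div_const _

namespace IsRouting

variable {V : List (Fin b) → Ω → (Fin b → ℝ)} {J : List (Fin b) → ℕ → Ω → Fin b}
  {Ω' : Type*} [MeasurableSpace Ω'] {P' : Measure Ω'} [IsProbabilityMeasure P']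

/-- The limit law satisfies a distributional fixed point equation. -/
theorem planarCharFun_eq_integral (hJ : IsRouting P σ V J)
    (hM : SizeModel P s s₀ K (V []) (fun n j ω => childSize s s₀ s₁ n (fun k => J [] k ω) j))
    (hs₁ : s₀ + b * s₁ ≤ s + 1) {Z : Ω' → ℝ × ℝ}
    (h : TendstoInDistribution (fun n ω => centredPair P J s s₀ s₁ n fun u k => J u k ω) atTop Z
      (fun _ => P) P') (z : ℝ × ℝ) :
    planarCharFun (P'.map Z) z = ∫ v, Complex.exp (((z.1 * ((∑ j, v j ^ 2 - ∫ v, ∑ j, v j ^ 2 ∂σ)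
          / (1 - ∫ v, ∑ j, v j ^ 2 ∂σ)) + z.2 * toll σ v : ℝ) : ℂ) * Complex.I) *
        ∏ j, planarCharFun (P'.map Z) (dilate₂ (v j) z) ∂σ := by
  have := Measure.isProbabilityMeasure_map (μ := P') h.aemeasurable_limit
  set q := ∫ v, ∑ j, v j ^ 2 ∂σ with hq
  have hq' : q = ∫ ω, ∑ j, V [] ω j ^ 2 ∂P := (hJ.integral_vector [] (g := fun v => ∑ j, v j ^ 2)
    (Finset.measurable_sum _ fun j _ =>
      (measurable_pi_apply j).pow_const 2).aestronglyMeasurable).symm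
  have hμ : meanEntropy σ = -∫ ω, ∑ j, V [] ω j * Real.log (V [] ω j) ∂P := by
    rw [meanEntropy, hJ.integral_vector [] (g := fun v => ∑ j, v j * Real.log (v j))]
    exact (Finset.measurable_sum _ fun j _ => (measurable_pi_apply j).mul
      (measurable_pi_apply j).log).aestronglyMeasurable
  set F : (Fin b → ℝ) → ℂ := fun v => Complex.exp (((z.1 * ((∑ j, v j ^ 2 - q) / (1 - q))
    + z.2 * toll σ v : ℝ) : ℂ) * Complex.I) * ∏ j, planarCharFun (P'.map Z) (dilate₂ (v j) z) with hF
  have hFm : Measurable F := by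
    refine Measurable.mul ?_ ?_
    · exact Complex.measurable_exp.comp ((Complex.measurable_ofReal.comp
        (((measurable_sum_sq_sub_div q).const_mul _).add (measurable_toll.const_mul _))).mul_const _)
    · exact (continuous_finsetProd _ fun j _ => continuous_planarCharFun.comp
        ((continuous_dilate₂ z).comp (continuous_apply j))).measurable
  have hFσ : ∫ v, F v ∂σ = ∫ ω, F (V [] ω) ∂P := by
    conv_lhs => rw [← hJ.map_vector []]
    exact integral_map (hJ.measurable_vector []).aemeasurable hFm.aestronglyMeasurable
  change _ = ∫ v, F v ∂σ
  rw [hFσ]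
  obtain ⟨ns, hns, hae⟩ := hM.exists_subseq_tendsto_ae
  have hL : Tendsto (fun k => pairCharFun P J s s₀ s₁ (ns k) z) atTop
      (𝓝 (planarCharFun (P'.map Z) z)) :=
    tendsto_integral_exp_of_tendstoInDistribution h hns (tendsto_const_nhds (x := z))
  refine tendsto_nhds_unique hL ?_
  -- The integrand of the recursion is bounded by 1 and converges almost surely to that of the fixed
  -- point equation, so dominated convergence applies.
  set Φ : ℕ → (Fin b → ℕ) → ℂ := fun n i =>
    Complex.exp (((z.1 * centredToll P J s s₀ s₁ 2 n i + z.2 * centredToll P J s s₀ s₁ 1 n i : ℝ) : ℂ)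
      * Complex.I) * ∏ j, pairCharFun P J s s₀ s₁ (i j) (dilate₂ ((i j : ℝ) / n) z) with hΦ
  have hR : Tendsto (fun k => ∫ ω, Φ (ns k)
      (fun j => childSize s s₀ s₁ (ns k) (fun l => J [] l ω) j) ∂P) atTop
      (𝓝 (∫ ω, F (V [] ω) ∂P)) := by
    refine tendsto_integral_of_dominated_convergence (fun _ => 1) (fun k => ?_)
      (integrable_const _) (fun k => ae_of_all _ fun ω => ?_) ?_
    · exact ((Measurable.of_discrete (f := Φ (ns k))).comp
        (measurable_pi_lambda _ fun j => hM.measurable_size (ns k) j)).aestronglyMeasurable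
    · simp only [hΦ]
      rw [norm_mul, Complex.norm_exp_ofReal_mul_I, one_mul, norm_prod]
      exact Finset.prod_le_one (fun _ _ => norm_nonneg _) fun j _ => norm_pairCharFun_le _ _
    · filter_upwards [hae, hM.mem_simplex, hM.pos_lt_one] with ω hω hsim hpos
      have ht1 := hM.tendsto_linear_toll hμ (t := meanPowerSum P J s s₀ s₁ 1)
        (meanPowerSum_zero one_ne_zero)
        (fun n => by simpa using hJ.meanPowerSum_eq hM hs₁ (Or.inl rfl) n)
        hns (i := fun j k => childSize s s₀ s₁ (ns k) (fun l => J [] l ω) j)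
        (fun k hk => hM.sum_size (ns k) ω hk) hsim (fun j => (hpos j).1) hω
      have ht2 := hM.tendsto_quadratic_toll hq' (t := meanPowerSum P J s s₀ s₁ 2)
        (meanPowerSum_zero two_ne_zero)
        (fun n => hJ.meanPowerSum_eq hM hs₁ (Or.inr rfl) n)
        hns (i := fun j k => childSize s s₀ s₁ (ns k) (fun l => J [] l ω) j)
        (fun j => (hpos j).1) hω
      refine Tendsto.mul ?_ (tendsto_finsetProd _ fun j _ => ?_)
      · refine (Complex.continuous_exp.tendsto _).comp (Tendsto.mul_const _
          ((Complex.continuous_ofReal.tendsto _).comp ((ht2.const_mul z.1).add ?_)))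
        refine Tendsto.const_mul z.2 ?_
        simpa [centredToll, toll] using ht1
      -- For a fixed outcome the child sizes form a deterministic sequence tending to infinity and
      -- the dilation factors converge.
      · exact tendsto_integral_exp_of_tendstoInDistribution h
          (SizeModel.tendsto_atTop_of_tendsto_div hns (hpos j).1 (hω j))
          (((continuous_dilate₂ z).tendsto _).comp (hω j))
  refine hR.congr' ?_
  filter_upwards [hns.eventually_gt_atTop 0] with k hk
  exact (hJ.pairCharFun_eq hM hs₁ hk z).symm

/-- The pair of the Wiener index and the path length in terms of the sums of powers of the subtree
sizes. -/
theorem normalizedPair_ae_eq (hJ : IsRouting P σ V J)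
    (hM : SizeModel P s s₀ K (V []) (fun n j ω => childSize s s₀ s₁ n (fun k => J [] k ω) j))
    (hs₁ : s₀ + b * s₁ ≤ s + 1) (n : ℕ) :
    (fun ω => ((normalizedPair P s s₀ s₁ J n ω).2 - (normalizedPair P s s₀ s₁ J n ω).1,
      (normalizedPair P s s₀ s₁ J n ω).2))
      =ᵐ[P] fun ω => centredPair P J s s₀ s₁ n fun u k => J u k ω := by
  have hfin := hJ.ae_powerSum_ne_top hM hs₁ (Or.inl rfl) n
  have i1 := hJ.integrable_powerSum hM hs₁ (Or.inl rfl) n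
  have i2 := hJ.integrable_powerSum hM hs₁ (Or.inr rfl) n
  have hX : ∫ ω, pathLength s s₀ s₁ (fun u k => J u k ω) n ∂P
      = meanPowerSum P J s s₀ s₁ 1 n - n := by
    have h1 : (fun ω => pathLength s s₀ s₁ (fun u k => J u k ω) n)
        =ᵐ[P] fun ω => (powerSum 1 s s₀ s₁ (fun u k => J u k ω) n).toReal - n := by
      filter_upwards [hfin] with ω hω
      exact pathLength_eq hs₁ hω
    rw [integral_congr_ae h1, integral_sub i1 (integrable_const _)]
    simp [meanPowerSum]
  have hW : ∫ ω, wienerIndex s s₀ s₁ (fun u k => J u k ω) n ∂P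
      = n * meanPowerSum P J s s₀ s₁ 1 n - meanPowerSum P J s s₀ s₁ 2 n := by
    have h1 : (fun ω => wienerIndex s s₀ s₁ (fun u k => J u k ω) n)
        =ᵐ[P] fun ω => n * (powerSum 1 s s₀ s₁ (fun u k => J u k ω) n).toReal
          - (powerSum 2 s s₀ s₁ (fun u k => J u k ω) n).toReal := by
      filter_upwards [hfin] with ω hω
      exact wienerIndex_eq hs₁ hω
    rw [integral_congr_ae h1, integral_sub (i1.const_mul _) i2, integral_const_mul]
    rfl
  filter_upwards [hfin] with ω hω
  simp only [normalizedPair, centredPair]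
  rw [hX, hW, pathLength_eq hs₁ hω, wienerIndex_eq hs₁ hω]
  rcases Nat.eq_zero_or_pos n with rfl | hn
  · simp
  · have hn0 : (n : ℝ) ≠ 0 := by exact_mod_cast hn.ne'
    refine Prod.ext ?_ ?_
    · field_simp
      ring
    · ring

end IsRouting

end SplitTree

/-! ### Change of variables and conclusion. -/

/-- The characteristic function of a linear image of the plane. -/
theorem planarCharFun_map_eq {Ω : Type*} [MeasurableSpace Ω] {P : Measure Ω} {W X : Ω → ℝ}
    (h : AEMeasurable (fun ω => (W ω, X ω)) P) (z : ℝ × ℝ) :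
    planarCharFun (P.map fun ω => (W ω, X ω)) z
      = planarCharFun (P.map fun ω => (X ω - W ω, X ω)) (-z.1, z.1 + z.2) := by
  have h2 : AEMeasurable (fun ω => (X ω - W ω, X ω)) P :=
    (h.snd.sub h.fst).prodMk h.snd
  rw [planarCharFun, planarCharFun, integral_map h (Continuous.aestronglyMeasurable (by fun_prop)),
    integral_map h2 (Continuous.aestronglyMeasurable (by fun_prop))]
  refine integral_congr_ae (ae_of_all _ fun ω => ?_)
  simp only
  congr 3
  ring

/-- The argument is the dual of the map (W, X) ↦ (X - W, X). The exponent doubles because the gauge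
sees the first coordinate only through its square root. -/
theorem norm_pow_le_gauge₂ (k : ℕ) (z : ℝ × ℝ) :
    ‖z‖ ^ k ≤ 2 ^ k * (1 + gauge₂ (-z.1, z.1 + z.2) ^ (2 * k)) := by
  set g := gauge₂ (-z.1, z.1 + z.2) with hg
  have hg0 : 0 ≤ g := gauge₂_nonneg _
  have h1 : |z.1| ≤ g ^ 2 := by
    have h2 : √|-z.1| ≤ g := le_max_left _ _
    rw [abs_neg] at h2
    exact (Real.sqrt_le_left hg0).1 h2
  have h3 : |z.1 + z.2| ≤ g := le_max_right _ _
  have h4 : ‖z‖ ≤ 2 * max 1 (g ^ 2) := by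
    have h5 : g ≤ max 1 (g ^ 2) := by
      rcases le_total g 1 with h | h
      · exact h.trans (le_max_left _ _)
      · exact (by nlinarith : g ≤ g ^ 2).trans (le_max_right _ _)
    have h6 : g ^ 2 ≤ max 1 (g ^ 2) := le_max_right _ _
    have h7 : |z.2| ≤ |z.1 + z.2| + |z.1| := by
      have := abs_sub (z.1 + z.2) z.1
      rwa [add_sub_cancel_left] at this
    have h8 : 0 ≤ max 1 (g ^ 2) := le_trans zero_le_one (le_max_left _ _)
    rw [Prod.norm_def, Real.norm_eq_abs, Real.norm_eq_abs]
    exact max_le (by linarith) (by linarith)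
  calc ‖z‖ ^ k ≤ (2 * max 1 (g ^ 2)) ^ k := pow_le_pow_left₀ (norm_nonneg _) h4 k
    _ = 2 ^ k * max 1 (g ^ 2) ^ k := mul_pow _ _ _
    _ ≤ 2 ^ k * (1 + g ^ (2 * k)) := by
      refine mul_le_mul_of_nonneg_left ?_ (by positivity)
      have h9 : 0 ≤ g ^ (2 * k) := by positivity
      rcases max_cases (1 : ℝ) (g ^ 2) with ⟨h, -⟩ | ⟨h, -⟩
      · rw [h, one_pow]
        linarith
      · rw [h, ← pow_mul]
        linarith

theorem mainTheorem7
    (b s s₀ s₁ : ℕ) (hb : 2 ≤ b) (hs : 1 ≤ s) (hs₀ : s₀ ≤ s) (hs₁ : s₀ + b * s₁ ≤ s + 1)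
    -- `σ` is the law of the split vector
    (σ : Measure (Fin b → ℝ)) [IsProbabilityMeasure σ]
    (hσ : ∀ᵐ v ∂σ, v ∈ stdSimplex ℝ (Fin b))
    (hdens : ∀ j : Fin b, σ.map (fun v => v j) ≪ (volume : Measure ℝ))
    (hmax : ∃ lam ν : ℝ, 0 < lam ∧ 0 < ν ∧
      ∀ x : ℝ, 0 ≤ x → σ.real {v | 1 - x ≤ ⨆ j, v j} ≤ lam * x ^ ν)
    (hsq : ∀ x : ℝ, σ.real {v | ∑ j, v j ^ 2 = x} < 1)
    (hC : 0 < σ.real {v | SplitTree.toll σ v ≠ 0})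
    -- the random split trees
    {Ω : Type*} [MeasurableSpace Ω] (P : Measure Ω) [IsProbabilityMeasure P]
    (V : List (Fin b) → Ω → (Fin b → ℝ)) (J : List (Fin b) → ℕ → Ω → Fin b)
    (hJ : SplitTree.IsRouting P σ V J)
    -- the limit in distribution
    {Ω' : Type*} [MeasurableSpace Ω'] (P' : Measure Ω') [IsProbabilityMeasure P']
    (W X : Ω' → ℝ)
    (hlim : TendstoInDistribution (SplitTree.normalizedPair P s s₀ s₁ J) atTop
      (fun ω => (W ω, X ω)) (fun _ => P) P') :
    SplitTree.HasBoundedSmoothDensity (P'.map (fun ω => (W ω, X ω))) := by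
  have hM := hJ.sizeModel hσ hdens hb hs hs₁
  have hZ : TendstoInDistribution
      (fun n ω => SplitTree.IsRouting.centredPair P J s s₀ s₁ n fun u k => J u k ω) atTop
      (fun ω => (X ω - W ω, X ω)) (fun _ => P) P' :=
    (hlim.continuous_comp (g := fun p : ℝ × ℝ => (p.2 - p.1, p.2)) (by fun_prop)).congr
      (fun n => hJ.normalizedPair_ae_eq hM hs₁ n) (ae_of_all _ fun _ => rfl)
  have := Measure.isProbabilityMeasure_map (μ := P') hlim.aemeasurable_limit
  have := Measure.isProbabilityMeasure_map (μ := P') hZ.aemeasurable_limit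
  set ρ := P'.map fun ω => (X ω - W ω, X ω) with hρ
  have hfix := hJ.planarCharFun_eq_integral hM hs₁ hZ
  -- The marginals have no atoms at 0 and 1.
  have hσ1 : ∀ᵐ v ∂σ, ∀ j, 0 < v j ∧ v j < 1 := by
    have h1 := hM.pos_lt_one
    rw [← hJ.map_vector []]
    exact ae_all_iff.2 fun j => (ae_map_iff (hJ.measurable_vector []).aemeasurable
      (measurable_pi_apply j measurableSet_Ioo)).2 (h1.mono fun ω hω => hω j)
  have hq' : ∫ v, ∑ j, v j ^ 2 ∂σ = ∫ ω, ∑ j, V [] ω j ^ 2 ∂P :=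
    (hJ.integral_vector [] (g := fun v => ∑ j, v j ^ 2) (Finset.measurable_sum _ fun j _ =>
      (measurable_pi_apply j).pow_const 2).aestronglyMeasurable).symm
  have hq1 : ∫ v, ∑ j, v j ^ 2 ∂σ < 1 := hq' ▸ hM.integral_sq_lt_one
  set q := ∫ v, ∑ j, v j ^ 2 ∂σ with hq
  have hndγ : ¬ ∀ᵐ v ∂σ, SplitTree.toll σ v = 0 := by
    intro h
    rw [ae_iff] at h
    rw [measureReal_def, h] at hC
    simp at hC
  have hndβ : ∀ c : ℝ, ¬ ∀ᵐ v ∂σ, (∑ j, v j ^ 2 - q) / (1 - q) + c * ∑ j, v j ^ 2 = c := by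
    intro c h
    have hp : (0 : ℝ) < 1 - q := by linarith
    -- The relation is affine in ∑ v_j². With zero slope it would read c = -q/(1 - q), incompatible
    -- with c = -1/(1 - q); otherwise it makes ∑ v_j² constant.
    by_cases hcase : (1 - q)⁻¹ + c = 0
    · obtain ⟨v, hv⟩ := h.exists
      have h1 : (∑ j, v j ^ 2 - q) / (1 - q) + c * ∑ j, v j ^ 2
          = ((1 - q)⁻¹ + c) * ∑ j, v j ^ 2 - q * (1 - q)⁻¹ := by
        rw [div_eq_mul_inv]
        ring
      rw [h1, hcase] at hv
      have h2 : (1 - q)⁻¹ * (1 - q) = 1 := inv_mul_cancel₀ hp.ne'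
      nlinarith
    · have h1 : ∀ᵐ v ∂σ, ∑ j, v j ^ 2 = (c + q * (1 - q)⁻¹) / ((1 - q)⁻¹ + c) := by
        filter_upwards [h] with v hv
        rw [eq_div_iff hcase]
        rw [div_eq_mul_inv] at hv
        linear_combination hv
      have h2 := hsq ((c + q * (1 - q)⁻¹) / ((1 - q)⁻¹ + c))
      rw [measureReal_def, (prob_compl_eq_zero_iff₀ ?_).1 h1] at h2
      · simp at h2
      · exact ((Finset.measurable_sum _ fun j _ => (measurable_pi_apply j).pow_const 2)
          (measurableSet_singleton _)).nullMeasurableSet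
  have hlt : ∀ z : ℝ × ℝ, z ≠ 0 → ‖planarCharFun ρ z‖ < 1 := fun z hz =>
    norm_planarCharFun_lt_one hb hσ hσ1 (SplitTree.measurable_sum_sq_sub_div q)
      SplitTree.measurable_toll hfix hndγ hndβ hz
  refine hasBoundedSmoothDensity_of_rapid_decay fun k => ?_
  have hdecay := rapid_decay_of_recursion (ψ := fun z => ‖planarCharFun ρ z‖)
    continuous_planarCharFun.norm (fun z => norm_nonneg _) (fun z => norm_planarCharFun_le z) hlt hb
    hσ hσ1 (norm_planarCharFun_le_integral hfix)
  -- Decay of order 2k in the gauge is decay of order k in the norm.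
  obtain ⟨C, hC'⟩ := hdecay (2 * k)
  refine ⟨2 ^ k * (1 + C), fun z => ?_⟩
  rw [planarCharFun_map_eq hlim.aemeasurable_limit, ← hρ]
  have h1 := hC' (-z.1, z.1 + z.2)
  have h2 := norm_planarCharFun_le (ρ := ρ) (-z.1, z.1 + z.2)
  calc ‖z‖ ^ k * ‖planarCharFun ρ (-z.1, z.1 + z.2)‖
      ≤ 2 ^ k * (1 + gauge₂ (-z.1, z.1 + z.2) ^ (2 * k)) * ‖planarCharFun ρ (-z.1, z.1 + z.2)‖ :=
        mul_le_mul_of_nonneg_right (norm_pow_le_gauge₂ k z) (norm_nonneg _)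
    _ = 2 ^ k * (‖planarCharFun ρ (-z.1, z.1 + z.2)‖
        + ‖planarCharFun ρ (-z.1, z.1 + z.2)‖ * gauge₂ (-z.1, z.1 + z.2) ^ (2 * k)) := by ring
    _ ≤ 2 ^ k * (1 + C) := mul_le_mul_of_nonneg_left (add_le_add h2 h1) (by positivity)
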